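/- Conventions. For a bounded domain (non-empty connected open set) $\Omega\subset\mathbb C$ with rectifiable boundary and $\Omega=\operatorname{Int}(\operatorname{Cl}\Omega)$, let $\oint_{\partial\Omega}$ be the contour integral over the positively oriented boundary, divided by $2\pi i$, and let $dA=\frac{dx\,dy}{\pi}$. Here the boundary is rectifiable if $\partial\Omega$ is the union of finitely many closed rectifiable curves that together have winding number $1$ about every point of $\Omega$ and $0$ about every point outside $\operatorname{Cl}\Omega$. Let $A(\Omega)$ be the space of functions analytic in $\Omega$ and continuous on $\operatorname{Cl}\Omega$, and let $\mathrm{Rat}_0(\Omega)$ be the set of rational functions vanishing at $\infty$ all of whose poles lie in $\Omega$. Such an $\Omega$ is a bounded (classical) quadrature domain with quadrature function $h\in\mathrm{Rat}_0(\Omega)$, written $\Omega\in QD(h)$, if $$\int_\Omega f\,dA=\oint_{\partial\Omega}f(w)h(w)\,dw\qquad\text{for all } f\in A(\Omega).$$ If $0\notin\partial\Omega$, it is a log-weighted quadrature domain (LQD) with quadrature function $h\in\mathrm{Rat}_0(\Omega)$, written $\Omega\in QD_0(h)$, if $$\int_\Omega \frac{f(w)}{|w|^2}\,dA(w)=\oint_{\partial\Omega}f(w)h(w)\,dw\qquad\text{for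 all } f\in A(\Omega)\text{ with }\int_\Omega\frac{|f(w)|}{|w|^2}\,dA(w)<\infty .$$ **Theorem 2.1.** Let $\Omega\in QD(h)$ be a bounded quadrature domain on which $w\mapsto e^w$ is injective. Then $e^\Omega$ is a bounded domain with rectifiable boundary, $e^\Omega=\operatorname{Int}(\operatorname{Cl}e^\Omega)$, $0\notin\partial e^\Omega$, and $e^\Omega\in QD_0(\widetilde h)$, where $\widetilde h\in\mathrm{Rat}_0(e^\Omega)$ is the Cauchy projection of $\frac{h(\ln w)}{w}$ onto the exterior of $e^\Omega$, that is, the rational function with $$\widetilde h(w)=-\oint_{\partial e^\Omega}\frac{h(\ln\xi)}{\xi\,(\xi-w)}\,d\xi\qquad\text{for all } w\in\mathbb C\setminus\operatorname{Cl}(e^\Omega).$$ (The minus sign appears because $\partial e^\Omega$ is oriented positively with respect to $e^\Omega$, not with respect to its exterior.) Here $\ln$ is the logarithm on $\operatorname{Cl}(e^\Omega)$ with values in $\operatorname{Cl}\Omega$, which on $e^\Omega$ is the inverse of $\exp:\Omega\to e^\Omega$; at a boundary point with several logarithms in $\operatorname{Cl}\Omega$, any of them may be used. Moreover, if $p_1,\dots,p_m$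 are the poles of $h$, then the poles of $\widetilde h$ are exactly $e^{p_1},\dots,e^{p_m}$, with the same multiplicities. -/

import Mathlib

open Set MeasureTheory
open scoped NNReal

noncomputable section

/-- A finite family of closed rectifiable curves in the plane. A rectifiable curve can always be
parametrized proportionally to arc length, so the parametrizations over `[0, 1]` are taken to be
Lipschitz; conversely a Lipschitz curve is rectifiable. -/
structure RectifiableContour where
  /-- the number of curves -/
  n : ℕ
  /-- the base point of each closed curve -/
  base : Fin n → ℂ
  /-- the closed curves -/
  curve : ∀ j, Path (base j) (base j)
  lipschitz : ∀ j, ∃ K : ℝ≥0, LipschitzWith K (curve j)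

namespace RectifiableContour

/-- The union of the curves, as a subset of the plane. -/
def trace (Γ : RectifiableContour) : Set ℂ := ⋃ j, range (Γ.curve j)

/-- The contour integral `∮_Γ g(ζ) dζ`, normalized by the factor `1 / (2πi)`. -/
def integral (Γ : RectifiableContour) (g : ℂ → ℂ) : ℂ :=
  (2 * Real.pi * Complex.I)⁻¹ *
    ∑ j, curveIntegral (fun ζ => ContinuousLinearMap.toSpanSingleton ℂ (g ζ)) (Γ.curve j)

/-- The winding number of `Γ` about a point `z` off the curves. -/
def windingNumber (Γ : RectifiableContour) (z : ℂ) : ℂ := Γ.integral fun ζ => (ζ - z)⁻¹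

/-- `Γ` is the boundary `∂Ω` of `Ω`, positively oriented with respect to `Ω`: the curves fill out
exactly the topological boundary, and wind once about every point of `Ω` and zero times about every
exterior point. (Curves may touch each other or themselves, as for domains whose boundary has
double points.) -/
structure IsBoundaryOf (Γ : RectifiableContour) (Ω : Set ℂ) : Prop where
  trace_eq : Γ.trace = frontier Ω
  winding_inside : ∀ z ∈ Ω, Γ.windingNumber z = 1
  winding_outside : ∀ z ∉ closure Ω, Γ.windingNumber z = 0

/-- The Cauchy projection of a boundary function `g` onto the exterior of the domain bounded by `Γ`,
`w ↦ ∮ g(ξ) / (ξ - w) dξ`, where the boundary is oriented positively with respect to the exterior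
domain, that is, oppositely to `Γ`. -/
def exteriorCauchyProjection (Γ : RectifiableContour) (g : ℂ → ℂ) (w : ℂ) : ℂ :=
  -Γ.integral fun ξ => g ξ / (ξ - w)

end RectifiableContour

/-- A bounded plane domain whose boundary is rectifiable, with `Ω = Int (Cl Ω)`. -/
structure IsBoundedRectifiableDomain (Ω : Set ℂ) : Prop where
  isOpen : IsOpen Ω
  isConnected : IsConnected Ω
  isBounded : Bornology.IsBounded Ω
  interior_closure : interior (closure Ω) = Ω
  rectifiable : ∃ Γ : RectifiableContour, Γ.IsBoundaryOf Ω

/-- The space `A(Ω)` of functions analytic in `Ω` and continuous on `Cl Ω`. -/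
def AnalyticClass (Ω : Set ℂ) : Set (ℂ → ℂ) :=
  {f | DifferentiableOn ℂ f Ω ∧ ContinuousOn f (closure Ω)}

/-- The functions in `A(Ω)` that are integrable over `Ω` with respect to the weight `|w|⁻²`. -/
def LogWeightedClass (Ω : Set ℂ) : Set (ℂ → ℂ) :=
  {f | f ∈ AnalyticClass Ω ∧ IntegrableOn (fun w => ‖f w‖ / ‖w‖ ^ 2) Ω}

/-- The value of a rational function at a point that is not a pole. -/
def ratEval (h : RatFunc ℂ) (w : ℂ) : ℂ := h.eval (RingHom.id ℂ) w

/-- The poles of a rational function in the plane, repeated according to multiplicity. -/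
def ratPoles (h : RatFunc ℂ) : Multiset ℂ := h.denom.roots

/-- `h ∈ Rat₀(Ω)`: every pole of `h` lies in `Ω`, and `h` vanishes at infinity. -/
def IsRatZero (Ω : Set ℂ) (h : RatFunc ℂ) : Prop :=
  (∀ p ∈ ratPoles h, p ∈ Ω) ∧ h.num.degree < h.denom.degree

/-- Integration against the normalized area measure `dA = dx dy / π`. -/
def areaIntegral (Ω : Set ℂ) (f : ℂ → ℂ) : ℂ := (Real.pi : ℂ)⁻¹ * ∫ w in Ω, f w

/-- `Ω` is a bounded (classical) quadrature domain with quadrature function `h`: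
`∫_Ω f dA = ∮_{∂Ω} f(w) h(w) dw` for all `f ∈ A(Ω)`. -/
structure IsBoundedQD (Ω : Set ℂ) (h : RatFunc ℂ) : Prop where
  domain : IsBoundedRectifiableDomain Ω
  rat : IsRatZero Ω h
  quadrature : ∀ Γ : RectifiableContour, Γ.IsBoundaryOf Ω → ∀ f ∈ AnalyticClass Ω,
    areaIntegral Ω f = Γ.integral fun w => f w * ratEval h w

/-- `Ω` is a bounded log-weighted quadrature domain with quadrature function `h`: `0 ∉ ∂Ω`, and
`∫_Ω f(w) |w|⁻² dA(w) = ∮_{∂Ω} f(w) h(w) dw` for all `f ∈ L¹ₐ(Ω; |w|⁻²)`. -/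
structure IsBoundedLQD (Ω : Set ℂ) (h : RatFunc ℂ) : Prop where
  domain : IsBoundedRectifiableDomain Ω
  zero_notMem : (0 : ℂ) ∉ frontier Ω
  rat : IsRatZero Ω h
  quadrature : ∀ Γ : RectifiableContour, Γ.IsBoundaryOf Ω → ∀ f ∈ LogWeightedClass Ω,
    areaIntegral Ω (fun w => f w / (‖w‖ : ℂ) ^ 2) = Γ.integral fun w => f w * ratEval h w

/-- `ℓ` is a logarithm on `Cl (e^Ω)` with values in `Cl Ω`. When `exp` is injective on `Ω`, it is the
inverse of `exp : Ω → e^Ω` on `e^Ω`; at a boundary point with several logarithms in `Cl Ω` any of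
them is allowed. -/
def IsLogInto (Ω : Set ℂ) (ℓ : ℂ → ℂ) : Prop :=
  ∀ w ∈ closure (Complex.exp '' Ω), ℓ w ∈ closure Ω ∧ Complex.exp (ℓ w) = w

end

/-! ### Contour integrals along Lipschitz curves -/

section ContourBasics

open Filter Topology

/-! The substitution w = e^z carries |w|⁻² dA(w) to dA(z), so the quadrature identity of Ω, applied
to f ∘ exp, gives ∮ f(e^z) h(z) dz. Newton division in the variable e^z
(`IsRatZero.exists_pushforward`) writes h(z) = e^z h'(e^z) + e^z r(z) on ∂Ω, where h' is rational,
vanishes at infinity and has the poles e^p, and r ∈ A(Ω). Cauchy's theorem removes the term with r,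
and what is left is ∮ f h' over the image contour. The same replacement with f(ξ) = 1/(ξ - w),
followed by the Cauchy formula for h', identifies h' with the exterior Cauchy projection
(`IsBoundedQD.exteriorCauchyProjection_eq`).

The boundary is known only through rectifiable curves and their winding numbers, so Cauchy's theorem
up to the boundary has to be derived from these. Convolving f with a radial kernel supported in a
disc of radius ε gives a Cauchy transform of the first moments of f over such discs; by Fubini its
contour integral is the area integral of the moments against the winding number, which is almost
everywhere the indicator of the domain. Hence the integral depends on the domain alone. For f ∈ A(D)
the moments vanish except in a strip of area O(ε) along the boundary, where they are o(ε³), while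
the normalizing constant is at least ε⁴ (`RectifiableContour.IsBoundaryOf.integral_eq_zero`).

The equality e^Ω = Int Cl e^Ω could fail if ∂Ω shared an arc with a translate of itself by 2πin. The
quadrature identity excludes this: z̄ has a meromorphic extension from ∂Ω to Ω (the Schwarz
function), a dimension count then yields a real polynomial relation between Re z and Im z on ∂Ω, and
∂Ω lies on an irreducible real curve (`IsBoundedQD.exists_irreducible`). Such a curve, not being a
vertical line, meets its vertical translates in finitely many points, so there are finitely many
double points (`IsBoundedQD.finite_double`). Finiteness gives the topological statement, and it also
makes the choice of logarithm at double points harmless, because a Lipschitz curve has zero velocity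
at almost all times spent at a given point. -/

theorem Path.lipschitzWith_extend {X : Type*} [PseudoMetricSpace X] {a b : X} {γ : Path a b}
    {K : ℝ≥0} (h : LipschitzWith K γ) : LipschitzWith K γ.extend := by
  have := h.comp (LipschitzWith.projIcc (zero_le_one' ℝ))
  rwa [mul_one] at this

namespace RectifiableContour

variable (Γ : RectifiableContour)

/-- The position on the `j`-th curve at time `t`. -/
noncomputable def pos (j : Fin Γ.n) : ℝ → ℂ := (Γ.curve j).extend

/-- The velocity on the `j`-th curve at time `t`. -/
noncomputable def vel (j : Fin Γ.n) : ℝ → ℂ := deriv (Γ.pos j)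

theorem integral_eq (g : ℂ → ℂ) :
    Γ.integral g = (2 * Real.pi * Complex.I)⁻¹ *
      ∑ j, ∫ t in (0 : ℝ)..1, g (Γ.pos j t) * Γ.vel j t := by
  unfold integral
  congr 1
  refine Finset.sum_congr rfl fun j _ => ?_
  rw [curveIntegral_eq_intervalIntegral_deriv]
  refine intervalIntegral.integral_congr fun t _ => ?_
  simp [pos, vel, mul_comm]

theorem exists_lipschitz_pos : ∃ K : ℝ≥0, ∀ j, LipschitzWith K (Γ.pos j) := by
  choose K hK using Γ.lipschitz
  exact ⟨∑ j, K j, fun j => (Path.lipschitzWith_extend (hK j)).weaken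
    (Finset.single_le_sum (f := K) (fun _ _ => zero_le) (Finset.mem_univ j))⟩

theorem continuous_pos (j : Fin Γ.n) : Continuous (Γ.pos j) := (Γ.curve j).continuous_extend

theorem exists_norm_vel_le : ∃ K : ℝ, 0 ≤ K ∧ ∀ j t, ‖Γ.vel j t‖ ≤ K := by
  obtain ⟨K, hK⟩ := Γ.exists_lipschitz_pos
  exact ⟨K, K.2, fun j t => norm_deriv_le_of_lipschitz (hK j)⟩

theorem measurable_vel (j : Fin Γ.n) : Measurable (Γ.vel j) := measurable_deriv _

theorem ae_hasDerivAt_pos (j : Fin Γ.n) : ∀ᵐ t : ℝ, HasDerivAt (Γ.pos j) (Γ.vel j t) t := by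
  obtain ⟨K, hK⟩ := Γ.exists_lipschitz_pos
  filter_upwards [(hK j).ae_differentiableAt] with t ht using ht.hasDerivAt

theorem pos_mem_trace (j : Fin Γ.n) (t : ℝ) : Γ.pos j t ∈ Γ.trace := by
  refine mem_iUnion.2 ⟨j, ?_⟩
  rw [pos, ← Path.extend_range]
  exact mem_range_self t

theorem exists_pos_eq {z : ℂ} (hz : z ∈ Γ.trace) : ∃ j, ∃ t ∈ Icc (0 : ℝ) 1, Γ.pos j t = z := by
  obtain ⟨j, t, ht⟩ := mem_iUnion.1 hz
  exact ⟨j, t, t.2, by rw [pos, Path.extend_apply _ t.2]; exact ht⟩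

theorem isCompact_trace : IsCompact Γ.trace :=
  isCompact_iUnion fun j => isCompact_range (Γ.curve j).continuous

variable {Γ}

theorem continuousOn_comp_pos {g : ℂ → ℂ} (hg : ContinuousOn g Γ.trace) (j : Fin Γ.n) :
    Continuous fun t => g (Γ.pos j t) :=
  hg.comp_continuous (Γ.continuous_pos j) (Γ.pos_mem_trace j)

theorem intervalIntegrable {g : ℂ → ℂ} (hg : ContinuousOn g Γ.trace) (j : Fin Γ.n) :
    IntervalIntegrable (fun t => g (Γ.pos j t) * Γ.vel j t) volume 0 1 := by
  obtain ⟨K, -, hK⟩ := Γ.exists_norm_vel_le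
  have : IntervalIntegrable (Γ.vel j) volume 0 1 :=
    (intervalIntegrable_const (c := K)).mono_fun
      (Γ.measurable_vel j).aestronglyMeasurable
      (ae_of_all _ fun t => (hK j t).trans (le_abs_self K))
  exact this.continuousOn_mul (continuousOn_comp_pos hg j).continuousOn

theorem integral_congr {f g : ℂ → ℂ} (h : EqOn f g Γ.trace) : Γ.integral f = Γ.integral g := by
  simp only [integral_eq]
  congr 1
  refine Finset.sum_congr rfl fun j _ => intervalIntegral.integral_congr fun t _ => ?_
  simp only [h (Γ.pos_mem_trace j t)]

theorem integral_add {f g : ℂ → ℂ} (hf : ContinuousOn f Γ.trace) (hg : ContinuousOn g Γ.trace) :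
    Γ.integral (fun z => f z + g z) = Γ.integral f + Γ.integral g := by
  simp only [integral_eq, ← mul_add, ← Finset.sum_add_distrib]
  congr 1
  refine Finset.sum_congr rfl fun j _ => ?_
  rw [← intervalIntegral.integral_add (intervalIntegrable hf j) (intervalIntegrable hg j)]
  simp only [add_mul]

theorem integral_const_mul (c : ℂ) (f : ℂ → ℂ) :
    Γ.integral (fun z => c * f z) = c * Γ.integral f := by
  simp only [integral_eq, mul_assoc, intervalIntegral.integral_const_mul, ← Finset.mul_sum]
  ring

theorem integral_neg (f : ℂ → ℂ) : Γ.integral (fun z => -f z) = -Γ.integral f := by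
  simpa using Γ.integral_const_mul (-1) f

theorem integral_sub {f g : ℂ → ℂ} (hf : ContinuousOn f Γ.trace) (hg : ContinuousOn g Γ.trace) :
    Γ.integral (fun z => f z - g z) = Γ.integral f - Γ.integral g := by
  simp only [sub_eq_add_neg]
  rw [← integral_neg]
  exact integral_add hf hg.neg

theorem integral_zero : Γ.integral (fun _ => 0) = 0 := by
  simpa using Γ.integral_const_mul 0 fun _ => 0

variable (Γ) in
theorem exists_norm_integral_le : ∃ C : ℝ, 0 ≤ C ∧ ∀ (f : ℂ → ℂ) (M : ℝ),
    (∀ z ∈ Γ.trace, ‖f z‖ ≤ M) → ‖Γ.integral f‖ ≤ C * M := by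
  obtain ⟨K, hK0, hK⟩ := Γ.exists_norm_vel_le
  refine ⟨‖(2 * Real.pi * Complex.I : ℂ)⁻¹‖ * ∑ j : Fin Γ.n, K, by positivity, fun f M hM => ?_⟩
  rw [integral_eq, norm_mul, mul_assoc ‖_‖, Finset.sum_mul]
  refine mul_le_mul_of_nonneg_left ((norm_sum_le _ _).trans (Finset.sum_le_sum fun j _ => ?_))
    (norm_nonneg _)
  have := intervalIntegral.norm_integral_le_of_norm_le_const (a := (0 : ℝ)) (b := 1)
    (f := fun t => f (Γ.pos j t) * Γ.vel j t) (C := K * M) fun t _ => by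
      rw [norm_mul, mul_comm]
      exact mul_le_mul (hK j t) (hM _ (Γ.pos_mem_trace j t)) (norm_nonneg _) hK0
  simpa using this

/-- A curve has velocity zero at almost every time spent in a given point. -/
theorem ae_vel_eq_zero (j : Fin Γ.n) (p : ℂ) : ∀ᵐ t : ℝ, Γ.pos j t = p → Γ.vel j t = 0 := by
  set B : Set ℝ := {t | HasDerivAt (Γ.pos j) (Γ.vel j t) t ∧ Γ.pos j t = p ∧ Γ.vel j t ≠ 0}
  have hB : B.Countable := by
    have : DiscreteTopology B := by
      -- A nonzero derivative makes t an isolated point of the fibre over p, and a discrete subset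
      -- of the line is countable, hence null.
      refine discreteTopology_subtype_iff.2 fun t ht => ?_
      have h1 : ∀ᶠ s in 𝓝[≠] t, s ∉ B := by
        filter_upwards [ht.1.eventually_ne (c := p) ht.2.2] with s hs hsB using hs hsB.2.1
      rw [← disjoint_iff, Filter.disjoint_principal_right]
      exact h1
    exact Set.countable_coe_iff.1 (countable_of_Lindelof_of_discrete (X := B))
  filter_upwards [Γ.ae_hasDerivAt_pos j, hB.ae_notMem volume] with t ht hn hp
  by_contra h
  exact hn ⟨ht, hp, h⟩

/-- The times spent in `s` contribute nothing, since the velocity vanishes at almost all of them.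
Applied with the double points as `s`, this makes the choice of logarithm there irrelevant. -/
theorem integral_congr_off_finite {f g : ℂ → ℂ} {s : Set ℂ} (hs : s.Finite)
    (h : EqOn f g (Γ.trace \ s)) : Γ.integral f = Γ.integral g := by
  simp only [integral_eq]
  congr 1
  refine Finset.sum_congr rfl fun j _ => intervalIntegral.integral_congr_ae ?_
  filter_upwards [(ae_ball_iff hs.countable).2 fun p _ => Γ.ae_vel_eq_zero j p] with t ht _
  by_cases hp : Γ.pos j t ∈ s
  · simp [ht _ hp rfl]
  · rw [h ⟨Γ.pos_mem_trace j t, hp⟩]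

/-- Dominated convergence along a contour, pointwise off a finite set. -/
theorem tendsto_integral_of_dominated {F : ℕ → ℂ → ℂ} {f : ℂ → ℂ} {s : Set ℂ} (hs : s.Finite)
    (M : ℝ) (hF : ∀ n, ContinuousOn (F n) Γ.trace) (hM : ∀ n, ∀ z ∈ Γ.trace, ‖F n z‖ ≤ M)
    (h : ∀ z ∈ Γ.trace \ s, Tendsto (fun n => F n z) atTop (𝓝 (f z))) :
    Tendsto (fun n => Γ.integral (F n)) atTop (𝓝 (Γ.integral f)) := by
  simp only [integral_eq]
  refine Tendsto.const_mul _ (tendsto_finsetSum _ fun j _ => ?_)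
  obtain ⟨K, hK0, hK⟩ := Γ.exists_norm_vel_le
  refine intervalIntegral.tendsto_integral_filter_of_dominated_convergence (fun _ => M * K)
    (Eventually.of_forall fun n => ?_) (Eventually.of_forall fun n => ae_of_all _ fun t _ => ?_)
    intervalIntegrable_const ?_
  · exact ((continuousOn_comp_pos (hF n) j).measurable.mul
      (Γ.measurable_vel j)).aestronglyMeasurable
  · rw [norm_mul]
    exact mul_le_mul (hM n _ (Γ.pos_mem_trace j t)) (hK j t) (norm_nonneg _)
      ((norm_nonneg _).trans (hM n _ (Γ.pos_mem_trace j t)))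
  · filter_upwards [(ae_ball_iff hs.countable).2 fun p _ => Γ.ae_vel_eq_zero j p] with t ht _
    by_cases hp : Γ.pos j t ∈ s
    · simp [ht _ hp rfl]
    · exact (h _ ⟨Γ.pos_mem_trace j t, hp⟩).mul_const _

end RectifiableContour

end ContourBasics

/-! ### Contour integrals of derivatives vanish -/

section Primitives

open Filter Topology

namespace RectifiableContour

variable {Γ : RectifiableContour}

/-- Analytic functions are only locally Lipschitz; compactness of the parameter interval makes the
constant uniform. -/
theorem exists_lipschitzOnWith_comp_pos {U : Set ℂ} (hU : IsOpen U) (hΓ : Γ.trace ⊆ U) {F : ℂ → ℂ}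
    (hF : DifferentiableOn ℂ F U) (j : Fin Γ.n) :
    ∃ K, LipschitzOnWith K (fun t => F (Γ.pos j t)) (Icc 0 1) := by
  obtain ⟨K, hK⟩ := Γ.exists_lipschitz_pos
  have h1 : LocallyLipschitzOn U F := fun z hz => by
    obtain ⟨C, t, ht, hC⟩ := (((hF.analyticAt (hU.mem_nhds hz)).contDiffAt
      (n := 1)).restrict_scalars ℝ).exists_lipschitzOnWith
    exact ⟨C, t, mem_nhdsWithin_of_mem_nhds ht, hC⟩
  refine LocallyLipschitzOn.exists_lipschitzOnWith_of_compact isCompact_Icc fun t _ => ?_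
  obtain ⟨C, s, hs, hC⟩ := h1 (hΓ (Γ.pos_mem_trace j t))
  rw [hU.nhdsWithin_eq (hΓ (Γ.pos_mem_trace j t))] at hs
  exact ⟨C * K, _, mem_nhdsWithin_of_mem_nhds ((Γ.continuous_pos j).continuousAt hs),
    hC.comp ((hK j).lipschitzOnWith) (mapsTo_preimage _ _)⟩

theorem intervalIntegral_deriv_eq_zero {G : ℝ → ℂ} {K : ℝ≥0} (hG : LipschitzOnWith K G (Icc 0 1))
    {g : ℝ → ℂ} (hg : IntervalIntegrable g volume 0 1)
    (h : ∀ᵐ t, t ∈ Ioc (0 : ℝ) 1 → HasDerivAt G (g t) t) (h01 : G 0 = G 1) :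
    ∫ t in (0 : ℝ)..1, g t = 0 := by
  -- The fundamental theorem for absolutely continuous functions is applied to real-valued
  -- functions, so G is tested against real functionals; real and imaginary part suffice.
  have key : ∀ L : ℂ →L[ℝ] ℝ, L (∫ t in (0 : ℝ)..1, g t) = 0 := by
    intro L
    rw [← ContinuousLinearMap.intervalIntegral_comp_comm L hg]
    have hAC : AbsolutelyContinuousOnInterval (fun t => L (G t)) 0 1 := by
      refine LipschitzOnWith.absolutelyContinuousOnInterval (K := ‖L‖₊ * K) ?_
      rw [uIcc_of_le zero_le_one]
      exact L.lipschitz.comp_lipschitzOnWith hG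
    have := hAC.integral_deriv_eq_sub
    rw [h01, sub_self] at this
    refine (intervalIntegral.integral_congr_ae ?_).trans this
    filter_upwards [h] with t ht htm
    rw [uIoc_of_le zero_le_one] at htm
    exact ((L.hasFDerivAt (x := G t)).comp_hasDerivAt t (ht htm)).deriv.symm
  exact Complex.ext (key Complex.reCLM) (key Complex.imCLM)

/-- The contour integral of the derivative of a function analytic near the contour vanishes. -/
theorem integral_deriv_eq_zero {U : Set ℂ} (hU : IsOpen U) (hΓ : Γ.trace ⊆ U) {F : ℂ → ℂ}
    (hF : DifferentiableOn ℂ F U) : Γ.integral (deriv F) = 0 := by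
  rw [integral_eq, Finset.sum_eq_zero, mul_zero]
  intro j _
  obtain ⟨K, hK⟩ := exists_lipschitzOnWith_comp_pos hU hΓ hF j
  refine intervalIntegral_deriv_eq_zero hK
    (intervalIntegrable ((hF.deriv hU).continuousOn.mono hΓ) j) ?_ ?_
  · filter_upwards [Γ.ae_hasDerivAt_pos j] with t ht _
    have := (hF.differentiableAt (hU.mem_nhds (hΓ (Γ.pos_mem_trace j t)))).hasDerivAt
    exact this.comp_of_eq t ht rfl
  · simp [pos]

/-- The exponent is at least 2, so there is a single-valued primitive on the plane without a. -/
theorem integral_inv_pow_eq_zero {a : ℂ} (ha : a ∉ Γ.trace) (k : ℕ) :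
    Γ.integral (fun z => ((z - a) ^ (k + 2))⁻¹) = 0 := by
  have hU : IsOpen {z : ℂ | z ≠ a} := isOpen_ne
  have hΓ : Γ.trace ⊆ {z : ℂ | z ≠ a} := fun z hz h => ha (h ▸ hz)
  have hd : ∀ z : ℂ, z ≠ a → HasDerivAt (fun z => -(k + 1 : ℂ)⁻¹ * ((z - a) ^ (k + 1))⁻¹)
      (((z - a) ^ (k + 2))⁻¹) z := by
    intro z hz
    have hz' : z - a ≠ 0 := sub_ne_zero.2 hz
    have hk : (k + 1 : ℂ) ≠ 0 := by exact_mod_cast Nat.succ_ne_zero k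
    have := ((((hasDerivAt_id' z).sub_const a).fun_pow (k + 1)).fun_inv
      (pow_ne_zero _ hz')).const_mul (-(k + 1 : ℂ)⁻¹)
    refine this.congr_deriv ?_
    simp only [Nat.add_sub_cancel, Nat.cast_add, Nat.cast_one]
    field_simp
    ring
  rw [← integral_deriv_eq_zero hU hΓ fun z hz => (hd z hz).differentiableAt.differentiableWithinAt]
  exact integral_congr fun z hz => (hd z (hΓ hz)).deriv.symm

end RectifiableContour

end Primitives

/-! ### Cauchy formula for proper rational functions, by partial fractions -/

section CauchyFormulaRational

open Polynomial

namespace RectifiableContour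

variable {Γ : RectifiableContour} {D : Set ℂ}

theorem IsBoundaryOf.notMem_trace (hΓ : Γ.IsBoundaryOf D) (hD : IsOpen D) {z : ℂ} (hz : z ∈ D) :
    z ∉ Γ.trace := by
  rw [hΓ.trace_eq, hD.frontier_eq]
  exact fun h => h.2 hz

theorem IsBoundaryOf.notMem_trace' (hΓ : Γ.IsBoundaryOf D) {z : ℂ} (hz : z ∉ closure D) :
    z ∉ Γ.trace := by
  rw [hΓ.trace_eq]
  exact fun h => hz (frontier_subset_closure h)

theorem continuousOn_sub_inv {a : ℂ} (ha : a ∉ Γ.trace) :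
    ContinuousOn (fun z => (z - a)⁻¹) Γ.trace :=
  (continuous_id.sub continuous_const).continuousOn.inv₀ fun _ hz h =>
    ha ((sub_eq_zero.1 h : _ = a) ▸ hz)

/-- Principal parts `(z - a)⁻ᵏ` with `a` inside reproduce themselves outside. -/
theorem IsBoundaryOf.integral_inv_pow_div (hΓ : Γ.IsBoundaryOf D) (hD : IsOpen D) {a w : ℂ}
    (ha : a ∈ D) (hw : w ∉ closure D) (k : ℕ) :
    Γ.integral (fun z => ((z - a) ^ (k + 1))⁻¹ * (z - w)⁻¹) = -((w - a) ^ (k + 1))⁻¹ := by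
  have hwa : w - a ≠ 0 := fun h => hw (sub_eq_zero.1 h ▸ subset_closure ha)
  have haT := hΓ.notMem_trace hD ha
  have hwT := hΓ.notMem_trace' hw
  have hza : ∀ z ∈ Γ.trace, z - a ≠ 0 := fun z hz h => haT (sub_eq_zero.1 h ▸ hz)
  have hzw : ∀ z ∈ Γ.trace, z - w ≠ 0 := fun z hz h => hwT (sub_eq_zero.1 h ▸ hz)
  have hc : ∀ k : ℕ, ContinuousOn (fun z => ((z - a) ^ k)⁻¹) Γ.trace := fun k => by
    simpa only [← inv_pow] using (continuousOn_sub_inv haT).fun_pow k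
  -- Obtained from w - a = (z - a) - (z - w): each step lowers the order of the pole at a, until
  -- only the winding numbers about a and w remain.
  have step : ∀ k : ℕ, Γ.integral (fun z => ((z - a) ^ (k + 1))⁻¹ * (z - w)⁻¹) =
      (w - a)⁻¹ * (Γ.integral (fun z => ((z - a) ^ k)⁻¹ * (z - w)⁻¹) -
        Γ.integral (fun z => ((z - a) ^ (k + 1))⁻¹)) := by
    intro k
    rw [← integral_sub ((hc k).fun_mul (continuousOn_sub_inv hwT)) (hc _), ← integral_const_mul]
    refine integral_congr fun z hz => ?_
    have h1 := hza z hz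
    have h2 := hzw z hz
    field_simp
    ring
  induction k with
  | zero =>
    have h1 : Γ.integral (fun z => (z - a)⁻¹) = 1 := hΓ.winding_inside a ha
    have h0 : Γ.integral (fun z => (z - w)⁻¹) = 0 := hΓ.winding_outside w hw
    rw [step]
    simp [h1, h0]
  | succ k ih =>
    rw [step, ih, integral_inv_pow_eq_zero haT k, sub_zero, pow_succ (w - a) (k + 1), mul_inv]
    ring

/-- The span of the principal parts `(z - a)⁻ᵏ`, `a ∈ D`, `k ≥ 1`. -/
def principalParts (D : Set ℂ) : Submodule ℂ (ℂ → ℂ) :=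
  Submodule.span ℂ (range fun (p : D × ℕ) (z : ℂ) => ((z - p.1) ^ (p.2 + 1))⁻¹)

theorem mem_principalParts {a : ℂ} (ha : a ∈ D) (k : ℕ) :
    (fun z : ℂ => ((z - a) ^ (k + 1))⁻¹) ∈ principalParts D :=
  Submodule.subset_span ⟨(⟨a, ha⟩, k), rfl⟩

/-- A factor with the same pole raises the order by one; for b ≠ a, the identity b - a = (z - a) -
(z - b) separates the poles by induction on the order. Agreement is asked only off D, which avoids
the values at the poles themselves. -/
theorem exists_principalParts_mul_inv {a : ℂ} (ha : a ∈ D) {φ : ℂ → ℂ}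
    (hφ : φ ∈ principalParts D) :
    ∃ ψ ∈ principalParts D, EqOn ψ (fun z => φ z * (z - a)⁻¹) Dᶜ := by
  induction hφ using Submodule.span_induction with
  | mem φ hφ =>
    obtain ⟨⟨⟨b, hb⟩, k⟩, rfl⟩ := hφ
    simp only
    by_cases hab : b = a
    · subst hab
      refine ⟨_, mem_principalParts hb (k + 1), fun z _ => ?_⟩
      simp only
      rw [pow_succ (z - b) (k + 1), mul_inv]
    have hba : b - a ≠ 0 := sub_ne_zero.2 hab
    have ne : ∀ z ∈ Dᶜ, ∀ c ∈ D, z - c ≠ 0 := fun z hz c hc h => hz (sub_eq_zero.1 h ▸ hc)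
    induction k with
    | zero =>
      refine ⟨_, (principalParts D).smul_mem (b - a)⁻¹ ((principalParts D).sub_mem
        (mem_principalParts hb 0) (mem_principalParts ha 0)), fun z hz => ?_⟩
      have h1 := ne z hz a ha
      have h2 := ne z hz b hb
      simp only [Pi.smul_apply, Pi.sub_apply, smul_eq_mul, zero_add, pow_one]
      field_simp
      ring
    | succ k ih =>
      obtain ⟨ψ, hψ, hE⟩ := ih
      refine ⟨_, (principalParts D).smul_mem (b - a)⁻¹ ((principalParts D).sub_mem
        (mem_principalParts hb (k + 1)) hψ), fun z hz => ?_⟩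
      have h1 := ne z hz a ha
      have h2 := ne z hz b hb
      simp only [Pi.smul_apply, Pi.sub_apply, smul_eq_mul, hE hz]
      field_simp
      ring
  | zero => exact ⟨0, zero_mem _, fun z _ => by simp⟩
  | add φ₁ φ₂ _ _ h₁ h₂ =>
    obtain ⟨ψ₁, m₁, e₁⟩ := h₁
    obtain ⟨ψ₂, m₂, e₂⟩ := h₂
    exact ⟨_, add_mem m₁ m₂, fun z hz => by simp [e₁ hz, e₂ hz, add_mul]⟩
  | smul c φ _ h =>
    obtain ⟨ψ, m, e⟩ := h
    exact ⟨_, Submodule.smul_mem _ c m, fun z hz => by simp [e hz, mul_assoc]⟩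

/-- A proper rational function with poles in `D` is a combination of principal parts. -/
theorem exists_principalParts_eq (s : Multiset ℂ) (hs : ∀ p ∈ s, p ∈ D) (N : ℂ[X])
    (hN : N.degree < Multiset.card s) :
    ∃ φ ∈ principalParts D, EqOn φ
      (fun z => N.eval z / (s.map fun p => X - C p).prod.eval z) Dᶜ := by
  induction s using Multiset.induction_on generalizing N with
  | empty =>
    have : N = 0 := by simpa [Nat.WithBot.lt_zero_iff] using hN
    exact ⟨0, zero_mem _, fun z _ => by simp [this]⟩
  | cons a s ih =>
    have ha : a ∈ D := hs a (by simp)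
    have hs' : ∀ p ∈ s, p ∈ D := fun p hp => hs p (by simp [hp])
    set q : ℂ[X] := (s.map fun p => X - C p).prod with hq
    have hqm : q.Monic := monic_multiset_prod_of_monic _ _ fun p _ => monic_X_sub_C p
    have hqd : q.natDegree = Multiset.card s := natDegree_multiset_prod_X_sub_C_eq_card s
    -- With c the possible top coefficient, N/((X - a)q) = c/(X - a) + ((N - cq)/q)·1/(X - a), and
    -- the degree of N - cq has dropped enough for the induction hypothesis.
    set c := N.coeff (Multiset.card s)
    have hN' : (N - C c * q).degree < Multiset.card s := by
      rw [degree_lt_iff_coeff_zero]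
      intro m hm
      rcases hm.eq_or_lt with rfl | hm
      · have : q.coeff (Multiset.card s) = 1 := by rw [← hqd]; exact hqm
        simp [this, c]
      · rw [coeff_sub, coeff_C_mul, coeff_eq_zero_of_natDegree_lt (p := q) (by lia),
          coeff_eq_zero_of_degree_lt (p := N), mul_zero, sub_zero]
        refine hN.trans_le ?_
        rw [Multiset.card_cons]
        exact_mod_cast hm
    obtain ⟨φ, hφ, hE⟩ := ih hs' _ hN'
    obtain ⟨ψ, hψ, hE'⟩ := exists_principalParts_mul_inv ha hφ
    refine ⟨_, add_mem (Submodule.smul_mem _ c (mem_principalParts ha 0)) hψ, fun z hz => ?_⟩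
    have hza : z - a ≠ 0 := fun h => hz (sub_eq_zero.1 h ▸ ha)
    have hqz : q.eval z ≠ 0 := by
      rw [hq, eval_multiset_prod, Ne, Multiset.prod_eq_zero_iff]
      simp only [Multiset.map_map, Multiset.mem_map, not_exists, not_and]
      intro p hp h
      simp only [Function.comp_apply, eval_sub, eval_X, eval_C] at h
      exact hz (sub_eq_zero.1 h ▸ hs' p hp)
    simp only [Pi.add_apply, Pi.smul_apply, smul_eq_mul, zero_add, pow_one, hE' hz, hE hz,
      Multiset.map_cons, Multiset.prod_cons, eval_mul, eval_sub, eval_X, eval_C, ← hq]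
    field_simp
    ring

/-- Linear extension of the case of a single power; continuity is carried along because additivity
of the contour integral needs it. -/
theorem IsBoundaryOf.integral_principalParts (hΓ : Γ.IsBoundaryOf D) (hD : IsOpen D)
    {φ : ℂ → ℂ} (hφ : φ ∈ principalParts D) {w : ℂ} (hw : w ∉ closure D) :
    ContinuousOn φ Γ.trace ∧ Γ.integral (fun z => φ z * (z - w)⁻¹) = -φ w := by
  have hwc := continuousOn_sub_inv (hΓ.notMem_trace' hw)
  induction hφ using Submodule.span_induction with
  | mem φ hφ =>
    obtain ⟨⟨⟨a, ha⟩, k⟩, rfl⟩ := hφ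
    refine ⟨?_, hΓ.integral_inv_pow_div hD ha hw k⟩
    simpa only [← inv_pow] using (continuousOn_sub_inv (hΓ.notMem_trace hD ha)).fun_pow (k + 1)
  | zero => exact ⟨continuousOn_const, by simpa using Γ.integral_zero⟩
  | add φ₁ φ₂ _ _ h₁ h₂ =>
    refine ⟨h₁.1.add h₂.1, ?_⟩
    simp only [Pi.add_apply, add_mul, neg_add, ← h₁.2, ← h₂.2]
    exact integral_add (h₁.1.mul hwc) (h₂.1.mul hwc)
  | smul c φ _ h =>
    refine ⟨h.1.const_smul c, ?_⟩
    simp only [Pi.smul_apply, smul_eq_mul, mul_assoc, integral_const_mul, h.2, mul_neg]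

/-- The Cauchy formula for a proper rational function with all its poles inside. -/
theorem IsBoundaryOf.integral_rational (hΓ : Γ.IsBoundaryOf D) (hD : IsOpen D)
    (s : Multiset ℂ) (hs : ∀ p ∈ s, p ∈ D) (N : ℂ[X]) (hN : N.degree < Multiset.card s)
    {w : ℂ} (hw : w ∉ closure D) :
    Γ.integral (fun z => N.eval z / (s.map fun p => X - C p).prod.eval z * (z - w)⁻¹) =
      -(N.eval w / (s.map fun p => X - C p).prod.eval w) := by
  obtain ⟨φ, hφ, hE⟩ := exists_principalParts_eq s hs N hN
  have hT : Γ.trace ⊆ Dᶜ := fun z hz hzD => hΓ.notMem_trace hD hzD hz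
  have hEw := hE (fun h => hw (subset_closure h) : w ∈ Dᶜ)
  simp only at hEw
  rw [← hEw, ← (hΓ.integral_principalParts hD hφ hw).2]
  exact integral_congr fun z hz => by simp only [hE (hT hz)]

end RectifiableContour

end CauchyFormulaRational

/-! ### Evaluation and Cauchy formula for Rat₀ -/

section RatZero

open Polynomial

variable {Ω : Set ℂ} {h : RatFunc ℂ}

theorem ratEval_eq (h : RatFunc ℂ) (w : ℂ) : ratEval h w = h.num.eval w / h.denom.eval w := by
  rfl

theorem prod_ratPoles (h : RatFunc ℂ) : ((ratPoles h).map fun p => X - C p).prod = h.denom := by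
  have := C_leadingCoeff_mul_prod_multiset_X_sub_C (p := h.denom)
    IsAlgClosed.card_roots_eq_natDegree
  rwa [h.monic_denom.leadingCoeff, map_one, one_mul] at this

theorem IsRatZero.degree_num_lt (hh : IsRatZero Ω h) :
    h.num.degree < Multiset.card (ratPoles h) := by
  rw [ratPoles, IsAlgClosed.card_roots_eq_natDegree,
    ← degree_eq_natDegree h.denom_ne_zero]
  exact hh.2

theorem IsRatZero.denom_eval_ne_zero (hh : IsRatZero Ω h) {z : ℂ} (hz : z ∉ Ω) :
    h.denom.eval z ≠ 0 := fun h0 =>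
  hz (hh.1 z ((mem_roots h.denom_ne_zero).2 h0))

theorem IsRatZero.continuousOn (hh : IsRatZero Ω h) : ContinuousOn (ratEval h) Ωᶜ := by
  have : ratEval h = fun w => h.num.eval w / h.denom.eval w := funext (ratEval_eq h)
  rw [this]
  exact h.num.continuous.continuousOn.div h.denom.continuous.continuousOn
    fun z hz => hh.denom_eval_ne_zero hz

theorem RectifiableContour.IsBoundaryOf.integral_ratEval {Γ : RectifiableContour}
    (hΓ : Γ.IsBoundaryOf Ω) (hΩ : IsOpen Ω) (hh : IsRatZero Ω h) {w : ℂ} (hw : w ∉ closure Ω) :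
    Γ.integral (fun z => ratEval h z * (z - w)⁻¹) = -ratEval h w := by
  simp only [ratEval_eq, ← prod_ratPoles h]
  exact hΓ.integral_rational hΩ _ hh.1 _ hh.degree_num_lt hw

end RatZero

/-! ### Integrability of 1/z and Cauchy transforms of discs -/

section PlaneIntegrals

open Filter Topology Metric Real

theorem integrableOn_ball_norm_inv (R : ℝ) :
    IntegrableOn (fun z : ℂ => ‖z‖⁻¹) (ball 0 R) := by
  rw [integrableOn_fun_norm_addHaar volume (f := fun y : ℝ => y⁻¹)]
  have : IntegrableOn (fun _ : ℝ => (1 : ℝ)) (Ioo 0 R) := by simp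
  refine this.congr_fun (fun y hy => ?_) measurableSet_Ioo
  have : y ≠ 0 := hy.1.ne'
  simp [Complex.finrank_real_complex, this]

theorem integrableOn_ball_norm_sub_inv (a ζ : ℂ) (R : ℝ) :
    IntegrableOn (fun z : ℂ => ‖ζ - z‖⁻¹) (ball a R) := by
  have h := (integrableOn_ball_norm_inv (‖ζ - a‖ + R))
  rw [← integrable_indicator_iff measurableSet_ball] at h
  have h2 := (h.comp_sub_left ζ).integrableOn (s := ball a R)
  refine h2.congr_fun (fun z hz => ?_) measurableSet_ball
  simp only
  rw [indicator_of_mem]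
  rw [mem_ball, dist_eq_norm] at hz
  rw [mem_ball_zero_iff]
  calc ‖ζ - z‖ = ‖(ζ - a) - (z - a)‖ := by ring_nf
    _ ≤ _ := norm_sub_le _ _
    _ < _ := by linarith

theorem integrableOn_ball_sub_inv (a ζ : ℂ) (R : ℝ) :
    IntegrableOn (fun z : ℂ => (ζ - z)⁻¹) (ball a R) :=
  (integrableOn_ball_norm_sub_inv a ζ R).mono'
    (by fun_prop) (ae_of_all _ fun z => by rw [norm_inv])

theorem integrableOn_sub_inv {s : Set ℂ} (hs : Bornology.IsBounded s) (ζ : ℂ) :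
    IntegrableOn (fun z : ℂ => (ζ - z)⁻¹) s := by
  obtain ⟨R, hR⟩ := hs.subset_ball 0
  exact (integrableOn_ball_sub_inv 0 ζ R).mono_set hR

/-- The bound does not depend on ζ in a fixed disc; this uniformity supplies the integrability for
Fubini along a contour. -/
theorem setIntegral_norm_sub_inv_le {s : Set ℂ} {R R' : ℝ} (hs : s ⊆ ball 0 R)
    {ζ : ℂ} (hζ : ‖ζ‖ ≤ R') :
    ∫ z in s, ‖ζ - z‖⁻¹ ≤ ∫ z in ball (0 : ℂ) (R' + R), ‖z‖⁻¹ := by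
  have h := integrableOn_ball_norm_inv (R' + R)
  have hi := h
  rw [← integrable_indicator_iff measurableSet_ball] at hi
  calc ∫ z in s, ‖ζ - z‖⁻¹ ≤ ∫ z in ball 0 R, ‖ζ - z‖⁻¹ :=
        setIntegral_mono_set (integrableOn_ball_norm_sub_inv 0 ζ R)
          (ae_of_all _ fun z => by positivity) hs.eventuallyLE
    _ ≤ ∫ z in ball 0 R, (ball (0 : ℂ) (R' + R)).indicator (fun z => ‖z‖⁻¹) (ζ - z) := by
        refine setIntegral_mono_on (integrableOn_ball_norm_sub_inv 0 ζ R)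
          (hi.comp_sub_left ζ).integrableOn measurableSet_ball fun z hz => ?_
        rw [indicator_of_mem]
        rw [mem_ball_zero_iff] at hz ⊢
        exact (norm_sub_le _ _).trans_lt (by linarith)
    _ ≤ ∫ z, (ball (0 : ℂ) (R' + R)).indicator (fun z => ‖z‖⁻¹) (ζ - z) :=
        setIntegral_le_integral (hi.comp_sub_left ζ)
          (ae_of_all _ fun z => indicator_nonneg (fun z _ => by positivity) _)
    _ = _ := by
        rw [integral_sub_left_eq_self (fun z => (ball (0 : ℂ) (R' + R)).indicator
          (fun z => ‖z‖⁻¹) z), integral_indicator measurableSet_ball]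

theorem integral_angle_eq_circleAverage (F : ℂ → ℂ) (r : ℝ) :
    ∫ θ in Ioo (-π) π, F (r * (Real.cos θ + Real.sin θ * Complex.I)) =
      (2 * π : ℝ) • circleAverage F 0 r := by
  rw [circleAverage_eq_integral_add (-π), smul_smul, mul_inv_cancel₀ (by positivity), one_smul,
    intervalIntegral.integral_comp_add_right (fun θ => F (circleMap 0 r θ)),
    intervalIntegral.integral_of_le (by linarith [pi_pos]), ← integral_Ioc_eq_integral_Ioo,
    show 0 + -π = -π by ring, show 2 * π + -π = π by ring]
  refine integral_congr_ae (ae_of_all _ fun θ => ?_)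
  simp only [circleMap, zero_add, Complex.exp_mul_I, Complex.ofReal_cos, Complex.ofReal_sin]

/-- Integration over the plane by circle averages. -/
theorem integral_eq_integral_circleAverage {F : ℂ → ℂ} (hF : Integrable F) (hm : Measurable F) :
    ∫ z, F z = ∫ r in Ioi (0 : ℝ), (2 * π * r : ℝ) • circleAverage F 0 r := by
  rw [← Complex.integral_comp_polarCoord_symm, polarCoord_target, Measure.volume_eq_prod,
    setIntegral_prod]
  · refine setIntegral_congr_fun measurableSet_Ioi fun r hr => ?_
    simp_rw [Complex.polarCoord_symm_apply]
    rw [integral_smul, integral_angle_eq_circleAverage, smul_smul]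
    ring_nf
  · refine ⟨?_, ?_⟩
    · refine Measurable.aestronglyMeasurable ?_
      have : Measurable fun p : ℝ × ℝ => Complex.polarCoord.symm p := by
        simp only [Complex.polarCoord_symm_apply]
        fun_prop
      exact measurable_fst.smul (hm.comp this)
    · rw [HasFiniteIntegral]
      have := Complex.lintegral_comp_polarCoord_symm fun z => ‖F z‖ₑ
      rw [polarCoord_target, Measure.volume_eq_prod] at this
      have h2 := hF.2
      rw [HasFiniteIntegral, ← this] at h2
      refine lt_of_eq_of_lt (setLIntegral_congr_fun (measurableSet_Ioi.prod measurableSet_Ioo)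
        fun p hp => ?_) h2
      have hp0 : (0 : ℝ) < p.1 := hp.1
      simp only [enorm_smul, smul_eq_mul]
      rw [Real.enorm_of_nonneg hp0.le]

theorem setIntegral_ball_eq_integral_circleAverage {F : ℂ → ℂ} {ε : ℝ}
    (hF : IntegrableOn F (ball 0 ε)) (hm : Measurable F) :
    ∫ z in ball 0 ε, F z = ∫ r in Ioo (0 : ℝ) ε, (2 * π * r : ℝ) • circleAverage F 0 r := by
  rw [← integral_indicator measurableSet_ball, integral_eq_integral_circleAverage
    ((integrable_indicator_iff measurableSet_ball).2 hF) (hm.indicator measurableSet_ball)]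
  have : Ioo 0 ε = Ioi 0 ∩ Iio ε := rfl
  rw [this, inter_comm, ← Measure.restrict_restrict measurableSet_Iio,
    ← integral_indicator measurableSet_Iio]
  refine setIntegral_congr_fun measurableSet_Ioi fun r hr => ?_
  by_cases hrε : r < ε
  · rw [indicator_of_mem (show r ∈ Iio ε from hrε)]
    congr 1
    refine circleAverage_congr_sphere fun z hz => ?_
    rw [indicator_of_mem]
    rw [mem_ball_zero_iff, mem_sphere_zero_iff_norm.1 hz, abs_of_pos hr]
    exact hrε
  · rw [indicator_of_notMem (show r ∉ Iio ε from hrε)]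
    have : circleAverage ((ball 0 ε).indicator F) 0 r = circleAverage (fun _ => 0) 0 r := by
      refine circleAverage_congr_sphere fun z hz => ?_
      rw [indicator_of_notMem]
      rw [mem_ball_zero_iff, mem_sphere_zero_iff_norm.1 hz, abs_of_pos hr]
      exact hrε
    rw [this, circleAverage_const, smul_zero]

theorem circleAverage_sub_inv_of_lt {ζ : ℂ} {r : ℝ} (hr : 0 < r) (h : r < ‖ζ‖) :
    circleAverage (fun z => (ζ - z)⁻¹) 0 r = ζ⁻¹ := by
  have : DiffContOnCl ℂ (fun z => (ζ - z)⁻¹) (ball 0 |r|) := by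
    refine DifferentiableOn.diffContOnCl fun z hz => ?_
    rw [closure_ball _ (by positivity), mem_closedBall_zero_iff, abs_of_pos hr] at hz
    refine DifferentiableAt.differentiableWithinAt ?_
    refine ((differentiableAt_const ζ).sub differentiableAt_id).inv fun h0 => ?_
    have : ζ = z := sub_eq_zero.1 h0
    rw [this] at h
    linarith
  simpa using this.circleAverage

theorem circleAverage_sub_inv_of_gt {ζ : ℂ} {r : ℝ} (h : ‖ζ‖ < r) :
    circleAverage (fun z => (ζ - z)⁻¹) 0 r = 0 := by
  have hr : 0 < r := (norm_nonneg _).trans_lt h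
  -- Inversion on the unit circle turns 1/(ζ - rz) into z/(ζz - r), which is analytic on the closed
  -- disc because |ζ| < r, and vanishes at 0.
  rw [circleAverage_eq_circleAverage_zero_one, ← circleAverage_zero_one_congr_inv]
  have hd : DiffContOnCl ℂ (fun z => z / (ζ * z - r)) (ball 0 |1|) := by
    refine DifferentiableOn.diffContOnCl fun z hz => ?_
    rw [closure_ball _ (by positivity), mem_closedBall_zero_iff, abs_one] at hz
    refine DifferentiableAt.differentiableWithinAt ?_
    refine DifferentiableAt.fun_div (by fun_prop) (by fun_prop) fun h0 => ?_
    have h1 : ‖ζ * z‖ = r := by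
      rw [sub_eq_zero.1 h0, Complex.norm_real, norm_of_nonneg hr.le]
    rw [norm_mul] at h1
    nlinarith [norm_nonneg ζ, norm_nonneg z]
  have := hd.circleAverage
  simp only [zero_div] at this
  refine (circleAverage_congr_sphere fun z hz => ?_).trans this
  have hz0 : z ≠ 0 := by
    rintro rfl
    simp at hz
  change (ζ - (r * z⁻¹ + 0))⁻¹ = z / (ζ * z - r)
  rw [add_zero, div_eq_mul_inv, ← inv_inv z, ← mul_inv, inv_inv]
  congr 1
  field_simp

/-- The Cauchy transform of a disc. -/
theorem setIntegral_ball_sub_inv {ε : ℝ} (hε : 0 ≤ ε) (ζ : ℂ) :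
    ∫ z in ball 0 ε, (ζ - z)⁻¹ = π * (min ε ‖ζ‖ : ℝ) ^ 2 * ζ⁻¹ := by
  rw [setIntegral_ball_eq_integral_circleAverage (integrableOn_ball_sub_inv 0 ζ ε) (by fun_prop)]
  set m := min ε ‖ζ‖ with hm
  have hm0 : 0 ≤ m := le_min hε (norm_nonneg _)
  have h1 : ∀ᵐ r : ℝ, r ∈ Ioo 0 ε → (2 * π * r : ℝ) • circleAverage (fun z => (ζ - z)⁻¹) 0 r =
      (Ioo 0 m).indicator (fun r : ℝ => ((2 * π * r : ℝ) : ℂ) * ζ⁻¹) r := by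
    filter_upwards [(finite_singleton ‖ζ‖).countable.ae_notMem volume] with r hr hr0
    rcases lt_or_gt_of_ne (show r ≠ ‖ζ‖ from hr) with h | h
    · rw [indicator_of_mem (show r ∈ Ioo 0 m from ⟨hr0.1, lt_min hr0.2 h⟩), circleAverage_sub_inv_of_lt hr0.1 h,
        Complex.real_smul]
    · rw [indicator_of_notMem fun h' : r ∈ Ioo 0 m => (h'.2.trans_le (min_le_right _ _)).not_gt h,
        circleAverage_sub_inv_of_gt h, smul_zero]
  rw [setIntegral_congr_ae measurableSet_Ioo h1, setIntegral_indicator measurableSet_Ioo,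
    Ioo_inter_Ioo, sup_idem, inf_eq_right.2 (min_le_left _ _), ← integral_Ioc_eq_integral_Ioo,
    ← intervalIntegral.integral_of_le hm0, intervalIntegral.integral_mul_const,
    intervalIntegral.integral_ofReal, intervalIntegral.integral_const_mul, integral_id]
  push_cast
  ring

theorem setIntegral_ball_sub_inv' {ε : ℝ} (hε : 0 ≤ ε) (c ζ : ℂ) :
    ∫ z in ball c ε, (ζ - z)⁻¹ = π * (min ε ‖ζ - c‖ : ℝ) ^ 2 * (ζ - c)⁻¹ := by
  rw [← setIntegral_ball_sub_inv hε, ← integral_indicator measurableSet_ball,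
    ← integral_indicator measurableSet_ball, ← integral_add_right_eq_self _ c]
  refine integral_congr_ae (ae_of_all _ fun z => ?_)
  simp only [indicator, mem_ball, dist_eq_norm, add_sub_cancel_right, sub_zero, sub_sub, add_comm c]

theorem setIntegral_ball_mul_add_inv {ε : ℝ} (hε : 0 ≤ ε) (ξ : ℂ) :
    ∫ y in ball 0 ε, y * (ξ + y)⁻¹ = ((π * (ε ^ 2 - min ε ‖ξ‖ ^ 2) : ℝ) : ℂ) := by
  have hi : IntegrableOn (fun y : ℂ => (ξ + y)⁻¹) (ball 0 ε) := by
    have := (integrableOn_ball_sub_inv 0 (-ξ) ε).neg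
    refine this.congr_fun (fun y _ => ?_) measurableSet_ball
    simp only [Pi.neg_apply]
    rw [← inv_neg]
    ring_nf
  have h1 : ∫ y in ball 0 ε, (ξ + y)⁻¹ = π * (min ε ‖ξ‖ : ℝ) ^ 2 * ξ⁻¹ := by
    have := setIntegral_ball_sub_inv hε (-ξ)
    rw [norm_neg, inv_neg, mul_neg, ← neg_eq_iff_eq_neg, ← integral_neg] at this
    rw [← this]
    refine integral_congr_ae (ae_of_all _ fun z => ?_)
    change (ξ + z)⁻¹ = -(-ξ - z)⁻¹
    rw [← inv_neg]
    ring_nf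
  -- Away from y = -ξ, y/(ξ + y) = 1 - ξ/(ξ + y), which reduces the integral to the Cauchy transform
  -- of a disc.
  have h2 : ∫ y in ball 0 ε, y * (ξ + y)⁻¹ = ∫ y in ball 0 ε, (1 - ξ * (ξ + y)⁻¹) := by
    refine setIntegral_congr_ae measurableSet_ball ?_
    filter_upwards [(finite_singleton (-ξ)).countable.ae_notMem volume] with y hy _
    have : ξ + y ≠ 0 := fun h => hy (eq_neg_of_add_eq_zero_right h)
    field_simp
    ring
  have : Fact (volume (ball (0 : ℂ) ε) < ⊤) := ⟨measure_ball_lt_top⟩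
  rw [h2, integral_sub (integrable_const 1) (hi.const_mul ξ), integral_const_mul, h1]
  have h3 : ξ * (π * ((min ε ‖ξ‖ : ℝ) : ℂ) ^ 2 * ξ⁻¹) = π * ((min ε ‖ξ‖ : ℝ) : ℂ) ^ 2 := by
    by_cases h : ξ = 0
    · simp [h, hε]
    · field_simp
  rw [h3]
  simp [Measure.real, hε]
  ring

end PlaneIntegrals

/-! ### Contour integrals as area integrals against the winding number -/

section Mollification

open Filter Topology Metric Real

/-- A radial kernel supported in the disc of radius `ε`; its `∂̄`-derivative is a multiple of `z`
on the disc. -/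
noncomputable def discKernel (ε : ℝ) (x : ℂ) : ℝ := π * (ε ^ 2 - min ε ‖x‖ ^ 2)

/-- The first moment of `f` over the disc of radius `ε`. -/
noncomputable def discMoment (f : ℂ → ℂ) (ε : ℝ) (z : ℂ) : ℂ := ∫ x in ball z ε, f x * (x - z)

variable {ε : ℝ}

theorem discKernel_nonneg (hε : 0 ≤ ε) (x : ℂ) : 0 ≤ discKernel ε x := by
  have h1 : min ε ‖x‖ ≤ ε := min_le_left _ _
  have h2 : 0 ≤ min ε ‖x‖ := le_min hε (norm_nonneg _)
  unfold discKernel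
  have : min ε ‖x‖ ^ 2 ≤ ε ^ 2 := pow_le_pow_left₀ h2 h1 2
  have := pi_pos
  nlinarith

theorem discKernel_eq_zero {x : ℂ} (h : ε ≤ ‖x‖) : discKernel ε x = 0 := by
  simp [discKernel, min_eq_left h]

theorem continuous_discKernel : Continuous (discKernel ε) := by
  unfold discKernel
  fun_prop

theorem hasCompactSupport_discKernel : HasCompactSupport (discKernel ε) := by
  refine HasCompactSupport.intro (isCompact_closedBall (0 : ℂ) ε) fun x hx => ?_
  rw [mem_closedBall_zero_iff, not_le] at hx
  exact discKernel_eq_zero hx.le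

theorem integrable_discKernel : Integrable (discKernel ε) :=
  continuous_discKernel.integrable_of_hasCompactSupport hasCompactSupport_discKernel

/-- On the disc of radius ε/2 the kernel is at least (3/4)πε², and the area there is πε²/4; the
product (3/16)π²ε⁴ exceeds ε⁴ since π > 3. -/
theorem pow_le_integral_discKernel (hε : 0 < ε) : ε ^ 4 ≤ ∫ x, discKernel ε x := by
  have h1 : ∫ x in ball (0 : ℂ) (ε / 2), (π * (3 / 4) * ε ^ 2) ≤
      ∫ x in ball (0 : ℂ) (ε / 2), discKernel ε x := by
    refine setIntegral_mono_on (integrableOn_const measure_ball_lt_top.ne)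
      integrable_discKernel.integrableOn measurableSet_ball fun x hx => ?_
    rw [mem_ball_zero_iff] at hx
    unfold discKernel
    rw [min_eq_right (by linarith)]
    have : ‖x‖ ^ 2 ≤ (ε / 2) ^ 2 := pow_le_pow_left₀ (norm_nonneg _) hx.le 2
    rw [mul_assoc]
    refine mul_le_mul_of_nonneg_left ?_ pi_pos.le
    nlinarith
  have h2 : ∫ x in ball (0 : ℂ) (ε / 2), discKernel ε x ≤ ∫ x, discKernel ε x :=
    setIntegral_le_integral integrable_discKernel (ae_of_all _ fun x => discKernel_nonneg hε.le x)
  refine le_trans ?_ (h1.trans h2)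
  have h3 : (0 : ℝ) ≤ ε / 2 := by positivity
  rw [setIntegral_const, Measure.real, Complex.volume_ball, ENNReal.toReal_mul,
    ENNReal.toReal_pow, ENNReal.toReal_ofReal h3]
  simp only [smul_eq_mul, ENNReal.coe_toReal, NNReal.coe_real_pi]
  have : 3 < π := pi_gt_three
  have h4 : 0 ≤ ε ^ 4 := by positivity
  have : 9 ≤ π * π := by nlinarith
  nlinarith [mul_le_mul_of_nonneg_right this h4]

/-- This is the inner integral that appears when Fubini is applied to the Cauchy transform of the
moments; the substitution y = x - z reduces it to a disc about 0. -/
theorem discKernel_eq_setIntegral (hε : 0 ≤ ε) (ζ x : ℂ) :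
    ∫ z, (ball x ε).indicator (fun z => (x - z) * (ζ - z)⁻¹) z = discKernel ε (ζ - x) := by
  rw [discKernel, ← setIntegral_ball_mul_add_inv hε, ← integral_indicator measurableSet_ball,
    ← integral_sub_left_eq_self _ volume x]
  refine integral_congr_ae (ae_of_all _ fun z => ?_)
  have : x - z ∈ ball x ε ↔ z ∈ ball 0 ε := by simp [dist_eq_norm]
  beta_reduce
  by_cases h : z ∈ ball 0 ε
  · rw [indicator_of_mem (this.2 h), indicator_of_mem h, sub_sub_cancel,
      show ζ - (x - z) = ζ - x + z by ring]
  · rw [indicator_of_notMem (mt this.1 h), indicator_of_notMem h]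

variable {f : ℂ → ℂ}

/-- Membership in a disc is symmetric in centre and point. Moving the cutoff to the disc about x
leaves f(x) as a separate factor, in the form needed for Fubini. -/
theorem discMoment_eq (f : ℂ → ℂ) (ε : ℝ) (z : ℂ) :
    discMoment f ε z = ∫ x, f x * (ball x ε).indicator (fun z => x - z) z := by
  rw [discMoment, ← integral_indicator measurableSet_ball]
  refine integral_congr_ae (ae_of_all _ fun x => ?_)
  have : x ∈ ball z ε ↔ z ∈ ball x ε := mem_ball_comm
  beta_reduce
  by_cases h : x ∈ ball z ε
  · rw [indicator_of_mem h, indicator_of_mem (this.1 h)]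
  · rw [indicator_of_notMem h, indicator_of_notMem (mt this.2 h), mul_zero]

theorem norm_discMoment_integrand_le (hε : 0 ≤ ε) (x z : ℂ) :
    ‖f x * (ball x ε).indicator (fun z => x - z) z‖ ≤ ‖f x‖ * ε := by
  rw [norm_mul]
  refine mul_le_mul_of_nonneg_left ?_ (norm_nonneg _)
  by_cases h : z ∈ ball x ε
  · rw [indicator_of_mem h, ← dist_eq_norm, dist_comm]
    exact (mem_ball.1 h).le
  · rw [indicator_of_notMem h, norm_zero]
    exact hε

theorem measurable_discMoment_integrand (hf : Continuous f) :
    Measurable fun p : ℂ × ℂ => f p.2 * (ball p.2 ε).indicator (fun z => p.2 - z) p.1 := by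
  refine (hf.measurable.comp measurable_snd).mul ?_
  have : (fun p : ℂ × ℂ => (ball p.2 ε).indicator (fun z => p.2 - z) p.1) =
      {p : ℂ × ℂ | dist p.1 p.2 < ε}.indicator fun p => p.2 - p.1 := by
    ext p
    simp [indicator]
  rw [this]
  exact (measurable_snd.sub measurable_fst).indicator
    (isOpen_lt (by fun_prop) continuous_const).measurableSet

theorem exists_bound_of_compactSupport (hf : Continuous f) (hc : HasCompactSupport f) :
    ∃ M R : ℝ, 0 ≤ M ∧ (∀ x, ‖f x‖ ≤ M) ∧ ∀ x, R ≤ ‖x‖ → f x = 0 := by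
  obtain ⟨M, hM⟩ := hf.bounded_above_of_compact_support hc
  obtain ⟨R, hR⟩ := hc.isBounded.subset_ball 0
  refine ⟨M, R, (norm_nonneg _).trans (hM 0), hM, fun x hx => ?_⟩
  by_contra h
  have := hR (subset_tsupport f h)
  rw [mem_ball_zero_iff] at this
  linarith

theorem discMoment_props (hf : Continuous f) (hc : HasCompactSupport f) (hε : 0 ≤ ε) :
    StronglyMeasurable (discMoment f ε) ∧ ∃ M R : ℝ, 0 ≤ M ∧ (∀ z, ‖discMoment f ε z‖ ≤ M) ∧
      ∀ z, R ≤ ‖z‖ → discMoment f ε z = 0 := by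
  obtain ⟨M, R, hM0, hM, hR⟩ := exists_bound_of_compactSupport hf hc
  refine ⟨?_, ∫ x, ‖f x‖ * ε, R + ε, integral_nonneg fun x => by positivity, fun z => ?_,
    fun z hz => ?_⟩
  · rw [funext (discMoment_eq f ε)]
    exact (measurable_discMoment_integrand hf).stronglyMeasurable.integral_prod_right
  · rw [discMoment_eq]
    exact norm_integral_le_of_norm_le
      ((hf.norm.integrable_of_hasCompactSupport hc.norm).mul_const ε)
      (ae_of_all _ fun x => norm_discMoment_integrand_le hε x z)
  · rw [discMoment, setIntegral_eq_zero_of_forall_eq_zero]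
    intro x hx
    rw [hR, zero_mul]
    rw [mem_ball, dist_eq_norm] at hx
    have := norm_le_norm_add_norm_sub' z x
    rw [norm_sub_rev] at this
    linarith

theorem integrable_mul_sub_inv {G : ℂ → ℂ} (hG : StronglyMeasurable G) {M R : ℝ}
    (hM : ∀ z, ‖G z‖ ≤ M) (hR : ∀ z, R ≤ ‖z‖ → G z = 0) (ζ : ℂ) :
    Integrable fun z => G z * (ζ - z)⁻¹ := by
  have h := ((integrableOn_ball_norm_sub_inv 0 ζ R).const_mul M)
  have h := (integrable_indicator_iff measurableSet_ball).2 h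
  refine h.mono' (hG.aestronglyMeasurable.mul (by fun_prop)) (ae_of_all _ fun z => ?_)
  by_cases hz : z ∈ ball 0 R
  · rw [indicator_of_mem hz, norm_mul, norm_inv]
    exact mul_le_mul_of_nonneg_right (hM z) (by positivity)
  · rw [hR z (by simpa using hz)]
    simp [indicator_of_notMem hz]

/-- The Cauchy transform of the first moments of `f` is a convolution of `f`. -/
theorem integral_discMoment_mul (hf : Continuous f) (hc : HasCompactSupport f) (hε : 0 ≤ ε)
    (ζ : ℂ) :
    ∫ z, discMoment f ε z * (ζ - z)⁻¹ = ∫ x, f x * discKernel ε (ζ - x) := by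
  obtain ⟨M, R, hM0, hM, hR⟩ := exists_bound_of_compactSupport hf hc
  simp_rw [discMoment_eq, ← integral_mul_const]
  rw [integral_integral_swap]
  · refine integral_congr_ae (ae_of_all _ fun x => ?_)
    simp only
    rw [← discKernel_eq_setIntegral hε, ← integral_const_mul]
    refine integral_congr_ae (ae_of_all _ fun z => ?_)
    simp only [indicator]
    split_ifs <;> simp [mul_assoc]
  · have h1 := (integrable_indicator_iff measurableSet_ball).2
      (integrableOn_ball_norm_sub_inv 0 ζ (R + ε))
    have h2 := ((hf.norm.integrable_of_hasCompactSupport (μ := volume) hc.norm).mul_const ε)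
    refine (h1.mul_prod h2).mono' ?_ (ae_of_all _ fun p => ?_)
    · exact ((measurable_discMoment_integrand hf).mul (by fun_prop)).aestronglyMeasurable
    · simp only [Function.uncurry]
      rw [norm_mul, norm_inv, mul_comm]
      by_cases hp : p.1 ∈ ball (0 : ℂ) (R + ε)
      · rw [indicator_of_mem hp]
        exact mul_le_mul_of_nonneg_left (norm_discMoment_integrand_le hε _ _) (by positivity)
      · rw [indicator_of_notMem hp, zero_mul]
        refine (mul_eq_zero_of_right _ ?_).le
        rw [norm_eq_zero]
        by_cases hx : p.1 ∈ ball p.2 ε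
        · rw [hR, zero_mul]
          rw [mem_ball_zero_iff, not_lt] at hp
          rw [mem_ball, dist_eq_norm] at hx
          have := norm_le_norm_add_norm_sub' p.1 p.2
          linarith
        · rw [indicator_of_notMem hx, mul_zero]

/-- The kernel is nonnegative and sees only points within ε of ζ, so the convolution, once
normalized, is an average of nearby values of f. -/
theorem norm_integral_mul_discKernel_sub_le (hf : Continuous f) (hc : HasCompactSupport f)
    (hε : 0 ≤ ε) {ζ : ℂ} {δ : ℝ} (hδ : ∀ x, dist x ζ < ε → ‖f x - f ζ‖ ≤ δ) :
    ‖(∫ x, f x * discKernel ε (ζ - x)) - f ζ * (∫ x, discKernel ε x : ℝ)‖ ≤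
      δ * ∫ x, discKernel ε x := by
  have hk : Integrable fun x => discKernel ε (ζ - x) := integrable_discKernel.comp_sub_left ζ
  have e1 : ∫ x, discKernel ε x = ∫ x, discKernel ε (ζ - x) :=
    (integral_sub_left_eq_self (discKernel ε) volume ζ).symm
  have h1 : Integrable fun x => f x * (discKernel ε (ζ - x) : ℂ) :=
    (hf.mul (Complex.continuous_ofReal.comp (continuous_discKernel.comp
      (continuous_const.sub continuous_id)))).integrable_of_hasCompactSupport hc.mul_right
  rw [e1, ← integral_complex_ofReal, ← integral_const_mul,
    ← integral_sub h1 (Integrable.const_mul (f := fun x => (discKernel ε (ζ - x) : ℂ)) hk.ofReal (f ζ)),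
    ← integral_const_mul]
  refine norm_integral_le_of_norm_le (hk.const_mul δ) (ae_of_all _ fun x => ?_)
  rw [← sub_mul, norm_mul, Complex.norm_real, norm_of_nonneg (discKernel_nonneg hε _)]
  by_cases hx : dist x ζ < ε
  · exact mul_le_mul_of_nonneg_right (hδ x hx) (discKernel_nonneg hε _)
  · rw [discKernel_eq_zero, mul_zero, mul_zero]
    rwa [← dist_eq_norm, dist_comm, ← not_lt]

namespace RectifiableContour

variable (Γ : RectifiableContour)

/-- Integrating a Cauchy transform along a contour. -/
theorem integral_cauchyTransform {G : ℂ → ℂ} (hG : StronglyMeasurable G) {M R : ℝ}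
    (hM : ∀ z, ‖G z‖ ≤ M) (hR : ∀ z, R ≤ ‖z‖ → G z = 0) :
    Γ.integral (fun ζ => ∫ z, G z * (ζ - z)⁻¹) = ∫ z, G z * Γ.windingNumber z := by
  have hM0 : 0 ≤ M := (norm_nonneg _).trans (hM 0)
  obtain ⟨K, hK0, hK⟩ := Γ.exists_norm_vel_le
  have key : ∀ j, Integrable (Function.uncurry fun (t : ℝ) (z : ℂ) =>
      G z * ((Γ.pos j t - z)⁻¹ * Γ.vel j t)) ((volume.restrict (Ioc 0 1)).prod volume) := by
    intro j
    have hmeas : AEStronglyMeasurable (Function.uncurry fun (t : ℝ) (z : ℂ) =>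
        G z * ((Γ.pos j t - z)⁻¹ * Γ.vel j t)) ((volume.restrict (Ioc 0 1)).prod volume) := by
      refine Measurable.aestronglyMeasurable ?_
      refine (hG.measurable.comp measurable_snd).mul (Measurable.mul (Measurable.inv ?_)
        ((Γ.measurable_vel j).comp measurable_fst))
      exact ((Γ.continuous_pos j).measurable.comp measurable_fst).sub measurable_snd
    rw [integrable_prod_iff hmeas]
    refine ⟨ae_of_all _ fun t => ?_, ?_⟩
    · simp only [Function.uncurry, ← mul_assoc]
      exact (integrable_mul_sub_inv hG hM hR _).mul_const _
    · obtain ⟨R', hR'⟩ := Γ.isCompact_trace.isBounded.subset_closedBall 0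
      have hC := integrable_const (μ := volume.restrict (Ioc (0 : ℝ) 1))
        (K * (M * ∫ z in ball (0 : ℂ) (R' + R), ‖z‖⁻¹))
      refine hC.mono' hmeas.norm.integral_prod_right' (ae_of_all _ fun t => ?_)
      have hpos := hR' (Γ.pos_mem_trace j t)
      rw [mem_closedBall_zero_iff] at hpos
      rw [norm_of_nonneg (integral_nonneg fun _ => norm_nonneg _)]
      simp only [Function.uncurry, norm_mul]
      calc ∫ z, ‖G z‖ * (‖(Γ.pos j t - z)⁻¹‖ * ‖Γ.vel j t‖)
          = ‖Γ.vel j t‖ * ∫ z, ‖G z‖ * ‖(Γ.pos j t - z)⁻¹‖ := by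
            rw [← MeasureTheory.integral_const_mul]
            congr 1
            ext z
            ring
        _ ≤ K * (M * ∫ z in ball (0 : ℂ) (R' + R), ‖z‖⁻¹) := by
            refine mul_le_mul (hK j t) ?_ (integral_nonneg fun _ => by positivity) hK0
            refine le_trans ?_ (mul_le_mul_of_nonneg_left
              (setIntegral_norm_sub_inv_le (subset_refl (ball 0 R)) hpos) hM0)
            rw [← MeasureTheory.integral_const_mul, ← integral_indicator measurableSet_ball]
            refine integral_mono_of_nonneg (ae_of_all _ fun z => by positivity)
              ((integrable_indicator_iff measurableSet_ball).2
                ((integrableOn_ball_norm_sub_inv 0 _ R).const_mul M)) (ae_of_all _ fun z => ?_)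
            by_cases hz : z ∈ ball 0 R
            · simp only [indicator_of_mem hz, norm_inv]
              exact mul_le_mul_of_nonneg_right (hM z) (by positivity)
            · simp only [indicator_of_notMem hz, hR z (by simpa using hz), norm_zero, zero_mul,
                le_refl]
  have e1 : ∀ z, G z * Γ.windingNumber z = (2 * π * Complex.I)⁻¹ *
      ∑ j, ∫ t in Ioc (0 : ℝ) 1, G z * ((Γ.pos j t - z)⁻¹ * Γ.vel j t) := by
    intro z
    rw [windingNumber, integral_eq, mul_left_comm, Finset.mul_sum]
    simp only [intervalIntegral.integral_of_le zero_le_one, MeasureTheory.integral_const_mul]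
  have key' : ∀ j, Integrable fun z =>
      ∫ t in Ioc (0 : ℝ) 1, G z * ((Γ.pos j t - z)⁻¹ * Γ.vel j t) :=
    fun j => (key j).integral_prod_right
  simp_rw [e1]
  rw [MeasureTheory.integral_const_mul, MeasureTheory.integral_finsetSum _ fun j _ => key' j,
    integral_eq]
  congr 1
  refine Finset.sum_congr rfl fun j _ => ?_
  rw [← integral_integral_swap (key j), intervalIntegral.integral_of_le zero_le_one]
  simp only [← integral_mul_const, mul_assoc]

/-- A contour integral is determined by the winding numbers. -/
theorem tendsto_integral_discMoment_mul (hf : Continuous f) (hc : HasCompactSupport f) :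
    Tendsto (fun ε : ℝ => ((∫ x, discKernel ε x : ℝ) : ℂ)⁻¹ *
      ∫ z, discMoment f ε z * Γ.windingNumber z) (𝓝[>] 0) (𝓝 (Γ.integral f)) := by
  obtain ⟨C, hC0, hC⟩ := Γ.exists_norm_integral_le
  have hu := hc.uniformContinuous_of_continuous hf
  rw [Metric.tendsto_nhds]
  intro δ hδ
  -- C may be 0, so C + 1 is used in the denominator; the final error C·δ/(C + 1) is strictly below
  -- δ.
  obtain ⟨η, hη, hη'⟩ := Metric.uniformContinuous_iff.1 hu (δ / (C + 1)) (by positivity)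
  filter_upwards [Ioo_mem_nhdsGT hη] with ε hε
  obtain ⟨hm, M, R, hM0, hM, hR⟩ := discMoment_props hf hc hε.1.le
  have hI : 0 < ∫ x, discKernel ε x :=
    (pow_pos hε.1 4).trans_le (pow_le_integral_discKernel hε.1)
  rw [← Γ.integral_cauchyTransform hm hM hR, ← integral_const_mul, dist_eq_norm]
  simp_rw [integral_discMoment_mul hf hc hε.1.le]
  rw [← integral_sub]
  · refine (hC _ (δ / (C + 1)) fun ζ _ => ?_).trans_lt ?_
    · have := norm_integral_mul_discKernel_sub_le hf hc hε.1.le (ζ := ζ) (δ := δ / (C + 1))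
        fun x hx => (dist_eq_norm (f x) (f ζ) ▸ (hη' (hx.trans hε.2)).le)
      have hI' : ((∫ x, discKernel ε x : ℝ) : ℂ) ≠ 0 := by exact_mod_cast hI.ne'
      rw [show ∀ A : ℂ, ((∫ x, discKernel ε x : ℝ) : ℂ)⁻¹ * A - f ζ =
        ((∫ x, discKernel ε x : ℝ) : ℂ)⁻¹ * (A - f ζ * (∫ x, discKernel ε x : ℝ)) from
        fun A => by field_simp, norm_mul, norm_inv, Complex.norm_real, norm_of_nonneg hI.le,
        inv_mul_le_iff₀ hI, mul_comm _ (δ / _)]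
      exact this
    · rw [mul_div_assoc', div_lt_iff₀ (by positivity)]
      nlinarith
  · refine Continuous.continuousOn (continuous_const.mul ?_)
    obtain ⟨A, hA⟩ := (continuous_discKernel (ε := ε)).bounded_above_of_compact_support
      hasCompactSupport_discKernel
    refine continuous_of_dominated (bound := fun x => ‖f x‖ * A) (fun ζ => ?_)
      (fun ζ => ae_of_all _ fun x => ?_)
      ((hf.norm.integrable_of_hasCompactSupport hc.norm).mul_const A) (ae_of_all _ fun x => ?_)
    · exact (hf.mul (Complex.continuous_ofReal.comp (continuous_discKernel.comp
        (continuous_const.sub continuous_id)))).aestronglyMeasurable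
    · rw [norm_mul, Complex.norm_real]
      exact mul_le_mul_of_nonneg_left (hA _) (norm_nonneg _)
    · exact continuous_const.mul (Complex.continuous_ofReal.comp (continuous_discKernel.comp
        (continuous_id.sub continuous_const)))
  · exact hf.continuousOn

end RectifiableContour

end Mollification

/-! ### Cauchy's theorem up to a rectifiable boundary -/

section CauchyTheorem

open Filter Topology Metric Real

theorem exists_continuous_compactSupport_extension {K : Set ℂ} (hK : IsCompact K) {f : ℂ → ℂ}
    (hf : ContinuousOn f K) : ∃ g : ℂ → ℂ, Continuous g ∧ HasCompactSupport g ∧ EqOn f g K := by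
  obtain ⟨F, hF⟩ := ContinuousMap.exists_restrict_eq hK.isClosed ⟨K.domRestrict f, hf.domRestrict⟩
  obtain ⟨χ, hχ1, -, hχc, -⟩ := exists_continuous_one_zero_of_isCompact hK isClosed_empty
    (disjoint_empty K)
  refine ⟨fun z => (χ z : ℂ) * F z, (Complex.continuous_ofReal.comp χ.continuous).mul F.continuous,
    (hχc.comp_left (g := ((↑) : ℝ → ℂ)) Complex.ofReal_zero).mul_right, fun z hz => ?_⟩
  have h1 : F z = f z := congr($hF ⟨z, hz⟩)
  simp [hχ1 hz, h1]

/-- On each circle about z the mean of the analytic function y ↦ f(z + y)y is its value at y = 0,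
namely 0. -/
theorem discMoment_eq_zero {f : ℂ → ℂ} (hf : Continuous f) {z : ℂ} {ε : ℝ}
    (hd : DifferentiableOn ℂ f (ball z ε)) : discMoment f ε z = 0 := by
  have e1 : discMoment f ε z = ∫ y in ball 0 ε, f (z + y) * y := by
    rw [discMoment, ← integral_indicator measurableSet_ball, ← integral_indicator measurableSet_ball,
      ← integral_add_left_eq_self _ z]
    refine integral_congr_ae (ae_of_all _ fun y => ?_)
    have : z + y ∈ ball z ε ↔ y ∈ ball 0 ε := by simp [dist_eq_norm]
    beta_reduce
    by_cases h : y ∈ ball 0 ε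
    · rw [indicator_of_mem h, indicator_of_mem (this.2 h), add_sub_cancel_left]
    · rw [indicator_of_notMem h, indicator_of_notMem (mt this.1 h)]
  have hc : Continuous fun y => f (z + y) * y := by fun_prop
  rw [e1, setIntegral_ball_eq_integral_circleAverage
    ((hc.continuousOn.integrableOn_compact (isCompact_closedBall 0 ε)).mono_set
      ball_subset_closedBall) hc.measurable]
  refine setIntegral_eq_zero_of_forall_eq_zero fun r hr => ?_
  have : DiffContOnCl ℂ (fun y => f (z + y) * y) (ball 0 |r|) := by
    refine ⟨fun y hy => ?_, hc.continuousOn⟩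
    have hy' : z + y ∈ ball z ε := by
      rw [mem_ball_zero_iff, abs_of_pos hr.1] at hy
      simpa [dist_eq_norm] using hy.trans hr.2
    have h1 : DifferentiableAt ℂ f (z + y) := hd.differentiableAt (isOpen_ball.mem_nhds hy')
    exact ((h1.comp y ((differentiableAt_const z).add differentiableAt_id)).mul
      differentiableAt_id).differentiableWithinAt
  rw [this.circleAverage, mul_zero, smul_zero]

/-- Constants have zero first moment, so f may be replaced by f - f(z); the oscillation of f then
enters as a factor besides ε³. -/
theorem norm_discMoment_le {f : ℂ → ℂ} (hf : Continuous f) {z : ℂ} {ε δ : ℝ} (hε : 0 ≤ ε)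
    (hδ : ∀ x, dist x z < ε → ‖f x - f z‖ ≤ δ) : ‖discMoment f ε z‖ ≤ δ * ε * (ε ^ 2 * π) := by
  have h1 : discMoment (fun _ => f z) ε z = 0 :=
    discMoment_eq_zero continuous_const (differentiableOn_const _)
  have hi : ∀ g : ℂ → ℂ, Continuous g → IntegrableOn (fun x => g x * (x - z)) (ball z ε) :=
    fun g hg => ((Continuous.continuousOn (by fun_prop)).integrableOn_compact
      (isCompact_closedBall z ε)).mono_set ball_subset_closedBall
  have h2 : discMoment f ε z = ∫ x in ball z ε, (f x - f z) * (x - z) := by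
    rw [← sub_zero (discMoment f ε z), ← h1, discMoment, discMoment,
      ← integral_sub (hi f hf) (hi _ continuous_const)]
    simp only [sub_mul]
  rw [h2]
  refine (norm_setIntegral_le_of_norm_le_const (C := δ * ε) measure_ball_lt_top
    fun x hx => ?_).trans (le_of_eq ?_)
  · rw [norm_mul]
    have := hδ x hx
    exact mul_le_mul this (by rw [← dist_eq_norm]; exact (mem_ball.1 hx).le) (norm_nonneg _)
      ((norm_nonneg _).trans this)
  · simp [Measure.real, hε]

namespace RectifiableContour

variable {Γ : RectifiableContour} {D : Set ℂ}

theorem exists_volume_near_trace_le (Γ : RectifiableContour) : ∃ C : ℝ, 0 ≤ C ∧ ∀ ε, 0 < ε → ε ≤ 1 →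
    ∀ s : Set ℂ, (∀ z ∈ s, ∃ w ∈ Γ.trace, dist z w ≤ ε) → volume s ≤ ENNReal.ofReal (C * ε) := by
  obtain ⟨K, hK⟩ := Γ.exists_lipschitz_pos
  refine ⟨Γ.n * (3 * ((K + 1) ^ 2 * π)), by positivity, fun ε hε hε1 s hs => ?_⟩
  -- Sampling each curve at the times i/N leaves gaps at most ε, so discs of radius (K + 1)ε about
  -- the samples cover the ε-neighbourhood. There are N + 1 of them per curve, and (N + 1)ε ≤ 3
  -- because ε ≤ 1.
  set N := ⌈1 / ε⌉₊ with hN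
  have hN1 : 1 / ε ≤ N := Nat.le_ceil _
  have hN2 : (N : ℝ) < 1 / ε + 1 := Nat.ceil_lt_add_one (by positivity)
  have h1ε : 1 ≤ 1 / ε := by rw [le_div_iff₀ hε]; linarith
  have hN0 : (0 : ℝ) < N := by linarith
  have hsub : s ⊆ ⋃ j : Fin Γ.n, ⋃ i ∈ Finset.range (N + 1),
      closedBall (Γ.pos j (i / N)) ((K + 1) * ε) := by
    intro z hz
    obtain ⟨w, hw, hzw⟩ := hs z hz
    obtain ⟨j, t, ht, rfl⟩ := Γ.exists_pos_eq hw
    have htN : 0 ≤ t * N := mul_nonneg ht.1 hN0.le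
    have h1 := Nat.floor_le htN
    have h2 := Nat.lt_floor_add_one (t * N)
    refine mem_iUnion.2 ⟨j, mem_iUnion₂.2 ⟨⌊t * N⌋₊, ?_, ?_⟩⟩
    · rw [Finset.mem_range, Nat.lt_add_one_iff]
      refine Nat.floor_le_of_le ?_
      nlinarith [ht.2]
    · rw [mem_closedBall]
      refine (dist_triangle _ (Γ.pos j t) _).trans ?_
      have h3 := (hK j).dist_le_mul t (⌊t * N⌋₊ / N)
      have h4 : dist t (⌊t * N⌋₊ / N) ≤ ε := by
        rw [Real.dist_eq, abs_le]
        constructor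
        · have : (⌊t * N⌋₊ : ℝ) / N ≤ t := by rwa [div_le_iff₀ hN0]
          linarith
        · have : t - ε ≤ (⌊t * N⌋₊ : ℝ) / N := by
            rw [le_div_iff₀ hN0]
            have : 1 ≤ ε * N := by rwa [div_le_iff₀' hε] at hN1
            nlinarith
          linarith
      nlinarith [mul_le_mul_of_nonneg_left h4 K.2]
  have hKε : (0 : ℝ) ≤ (K + 1) * ε := by positivity
  calc volume s ≤ ∑ j : Fin Γ.n, ∑ i ∈ Finset.range (N + 1),
        volume (closedBall (Γ.pos j (i / N)) ((K + 1) * ε)) := by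
        refine (measure_mono hsub).trans ((measure_iUnion_fintype_le _ _).trans ?_)
        exact Finset.sum_le_sum fun j _ => measure_biUnion_finset_le _ _
    _ = ENNReal.ofReal (Γ.n * ((N + 1) * (((K + 1) * ε) ^ 2 * π))) := by
        have hπ : (NNReal.pi : ENNReal) = ENNReal.ofReal π := by
          rw [← NNReal.coe_real_pi, ENNReal.ofReal_coe_nnreal]
        have hb : ∀ a, volume (closedBall a ((K + 1) * ε)) = ENNReal.ofReal ((K + 1) * ε) ^ 2 * NNReal.pi :=
          fun a => Complex.volume_closedBall a _
        simp only [hb, Finset.sum_const, Finset.card_range,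
          Finset.card_univ, Fintype.card_fin, nsmul_eq_mul]
        have h0 : (0 : ℝ) ≤ Γ.n := by positivity
        have h1 : (0 : ℝ) ≤ N + 1 := by positivity
        rw [ENNReal.ofReal_mul h0, ENNReal.ofReal_mul h1,
          ENNReal.ofReal_mul (pow_nonneg hKε 2), ENNReal.ofReal_pow hKε, ENNReal.ofReal_natCast, hπ]
        congr 2
        rw [← Nat.cast_add_one, ENNReal.ofReal_natCast]
    _ ≤ _ := by
        refine ENNReal.ofReal_le_ofReal ?_
        have : (N + 1 : ℝ) * ε ≤ 3 := by
          have : (1 / ε + 1 + 1) * ε = 1 + 2 * ε := by field_simp; ring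
          nlinarith
        have h5 : (0 : ℝ) ≤ Γ.n * ((K + 1) ^ 2 * π * ε) := by positivity
        nlinarith [mul_le_mul_of_nonneg_left this h5]

theorem volume_trace (Γ : RectifiableContour) : volume Γ.trace = 0 := by
  obtain ⟨C, hC0, hC⟩ := Γ.exists_volume_near_trace_le
  have h1 : Tendsto (fun ε : ℝ => ENNReal.ofReal (C * ε)) (𝓝[>] 0) (𝓝 0) := by
    have : Tendsto (fun ε : ℝ => ENNReal.ofReal (C * ε)) (𝓝 0) (𝓝 (ENNReal.ofReal (C * 0))) :=
      (ENNReal.continuous_ofReal.comp (continuous_const.mul continuous_id)).tendsto 0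
    rw [mul_zero, ENNReal.ofReal_zero] at this
    exact this.mono_left nhdsWithin_le_nhds
  refine le_antisymm (ge_of_tendsto h1 ?_) zero_le
  filter_upwards [Ioo_mem_nhdsGT one_pos] with ε hε
  exact hC ε hε.1 hε.2.le _ fun z hz => ⟨z, hz, by simpa using hε.1.le⟩

theorem IsBoundaryOf.volume_frontier (hΓ : Γ.IsBoundaryOf D) : volume (frontier D) = 0 :=
  hΓ.trace_eq ▸ Γ.volume_trace

/-- The defining winding conditions leave out only the frontier, which is a null set since it is
traced by Lipschitz curves. -/
theorem IsBoundaryOf.ae_windingNumber (hΓ : Γ.IsBoundaryOf D) :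
    Γ.windingNumber =ᵐ[volume] D.indicator fun _ => 1 := by
  have : ∀ᵐ z, z ∉ frontier D := measure_eq_zero_iff_ae_notMem.1 hΓ.volume_frontier
  filter_upwards [this] with z hz
  by_cases h : z ∈ D
  · rw [indicator_of_mem h, hΓ.winding_inside z h]
  · rw [indicator_of_notMem h, hΓ.winding_outside z]
    exact fun hc => hz ⟨hc, fun hi => h (interior_subset hi)⟩

/-- Two positively oriented boundaries of the same set give the same contour integrals. -/
theorem IsBoundaryOf.integral_eq_integral {Γ' : RectifiableContour} (hΓ : Γ.IsBoundaryOf D)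
    (hΓ' : Γ'.IsBoundaryOf D) {f : ℂ → ℂ} (hf : ContinuousOn f (frontier D)) :
    Γ.integral f = Γ'.integral f := by
  obtain ⟨g, hg, hgc, hfg⟩ := exists_continuous_compactSupport_extension
    (hΓ.trace_eq ▸ Γ.isCompact_trace) hf
  rw [Γ.integral_congr (g := g) (hΓ.trace_eq ▸ hfg),
    Γ'.integral_congr (g := g) (hΓ'.trace_eq ▸ hfg)]
  refine tendsto_nhds_unique (Γ.tendsto_integral_discMoment_mul hg hgc)
    ((Γ'.tendsto_integral_discMoment_mul hg hgc).congr fun ε => ?_)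
  congr 1
  refine integral_congr_ae ?_
  filter_upwards [hΓ.ae_windingNumber, hΓ'.ae_windingNumber] with z h1 h2
  rw [h1, h2]

/-- Cauchy's theorem for functions analytic inside and continuous up to the boundary. -/
theorem IsBoundaryOf.integral_eq_zero (hΓ : Γ.IsBoundaryOf D)
    (hb : Bornology.IsBounded D) {f : ℂ → ℂ} (hf : f ∈ AnalyticClass D) : Γ.integral f = 0 := by
  obtain ⟨g, hg, hgc, hfg⟩ := exists_continuous_compactSupport_extension hb.isCompact_closure hf.2
  have hgD : DifferentiableOn ℂ g D := hf.1.congr fun z hz => (hfg (subset_closure hz)).symm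
  rw [Γ.integral_congr (g := g) (hΓ.trace_eq ▸ hfg.mono frontier_subset_closure)]
  have hlim := Γ.tendsto_integral_discMoment_mul hg hgc
  obtain ⟨C, hC0, hC⟩ := Γ.exists_volume_near_trace_le
  have hu := hgc.uniformContinuous_of_continuous hg
  refine tendsto_nhds_unique hlim ?_
  rw [Metric.tendsto_nhds]
  intro δ hδ
  -- The strip has area at most Cε and the moments there are at most ωπε³; this ω keeps the product
  -- below δε⁴.
  obtain ⟨η, hη, hη'⟩ := Metric.uniformContinuous_iff.1 hu (δ / (C * π + 1)) (by positivity)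
  set ω := δ / (C * π + 1)
  filter_upwards [Ioo_mem_nhdsGT hη, Ioo_mem_nhdsGT one_pos] with ε hε hε1
  have hI := pow_le_integral_discKernel hε.1
  have hI0 : 0 < ∫ x, discKernel ε x := (pow_pos hε.1 4).trans_le hI
  set S := {z | ∃ w ∈ Γ.trace, dist z w ≤ ε} with hS
  have hSm : MeasurableSet S := by
    have : S = cthickening ε Γ.trace := by
      rw [Γ.isCompact_trace.cthickening_eq_biUnion_closedBall hε.1.le]
      ext z
      simp [hS]
    rw [this]
    exact isClosed_cthickening.measurableSet
  have hSv := hC ε hε.1 hε1.2.le S fun z hz => hz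
  have hSf : volume S < ⊤ := hSv.trans_lt ENNReal.ofReal_lt_top
  have hω : 0 ≤ ω := by positivity
  have hbound : ‖∫ z, discMoment g ε z * Γ.windingNumber z‖ ≤
      ∫ z, S.indicator (fun _ => ω * ε * (ε ^ 2 * π)) z := by
    refine norm_integral_le_of_norm_le
      ((integrable_indicator_iff hSm).2 (integrableOn_const hSf.ne)) ?_
    filter_upwards [hΓ.ae_windingNumber] with z hz
    rw [hz]
    by_cases hzD : z ∈ D
    · rw [indicator_of_mem hzD, mul_one]
      by_cases hzS : z ∈ S
      · rw [indicator_of_mem hzS]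
        exact norm_discMoment_le hg hε.1.le fun x hx =>
          (dist_eq_norm (g x) (g z) ▸ (hη' (hx.trans hε.2)).le)
      -- A disc of radius ε about z that left D would put a boundary point within ε of z. So the
      -- disc lies in D and its moment vanishes.
      · rw [indicator_of_notMem hzS, discMoment_eq_zero hg, norm_zero]
        refine hgD.mono fun x hx => ?_
        by_contra hxD
        have hne : D ≠ univ := fun h => hxD (h ▸ mem_univ x)
        obtain ⟨y, hy, hzy⟩ := exists_mem_frontier_infDist_compl_eq_dist hzD hne
        refine hzS ⟨y, hΓ.trace_eq ▸ hy, ?_⟩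
        rw [← hzy]
        refine (infDist_le_dist_of_mem hxD).trans ?_
        rw [dist_comm]
        exact (mem_ball.1 hx).le
    · rw [indicator_of_notMem hzD, mul_zero, norm_zero]
      exact indicator_nonneg (fun _ _ => by have := hε.1; positivity) _
  rw [integral_indicator hSm, setIntegral_const, smul_eq_mul] at hbound
  have hSr : volume.real S ≤ C * ε :=
    ENNReal.toReal_le_of_le_ofReal (by have := hε.1; positivity) hSv
  rw [dist_zero_right, norm_mul, norm_inv, Complex.norm_real, norm_of_nonneg hI0.le,
    inv_mul_lt_iff₀ hI0]
  have h4 : 0 < ε ^ 4 := pow_pos hε.1 4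
  calc ‖∫ z, discMoment g ε z * Γ.windingNumber z‖
      ≤ C * ε * (ω * ε * (ε ^ 2 * π)) := hbound.trans (mul_le_mul_of_nonneg_right hSr
        (by have := hε.1; positivity))
    _ = ε ^ 4 * (C * π * ω) := by ring
    _ < ε ^ 4 * δ := by
        refine mul_lt_mul_of_pos_left ?_ h4
        have : 0 < C * π + 1 := by positivity
        rw [show C * π * ω = C * π * δ / (C * π + 1) from (mul_div_assoc _ _ _).symm,
          div_lt_iff₀ this]
        nlinarith
    _ ≤ _ := mul_le_mul_of_nonneg_right hI hδ.le

end RectifiableContour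

end CauchyTheorem

/-! ### The area Cauchy transform of a domain -/

section CauchyTransform

open Filter Topology Metric Real ComplexConjugate

/-- The area Cauchy transform of the indicator function of `Ω`. -/
noncomputable def cauchyTransform (Ω : Set ℂ) (z : ℂ) : ℂ := areaIntegral Ω fun ζ => (z - ζ)⁻¹

variable {Ω : Set ℂ}

/-- In this form the singularity stays at 0 while z moves, so dominated convergence applies near
every z. -/
theorem integral_sub_inv_eq (hm : MeasurableSet Ω) (z : ℂ) :
    ∫ ζ in Ω, (z - ζ)⁻¹ = ∫ x, Ω.indicator (fun _ => (1 : ℂ)) (z - x) * x⁻¹ := by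
  rw [← integral_indicator hm, ← integral_sub_left_eq_self _ volume z]
  refine integral_congr_ae (ae_of_all _ fun x => ?_)
  simp only [indicator, sub_sub_cancel]
  split_ifs <;> simp

theorem continuous_cauchyTransform (hb : Bornology.IsBounded Ω) (hm : MeasurableSet Ω)
    (h0 : volume (frontier Ω) = 0) : Continuous (cauchyTransform Ω) := by
  unfold cauchyTransform areaIntegral
  refine continuous_const.mul ?_
  simp_rw [integral_sub_inv_eq hm]
  obtain ⟨R, hR⟩ := hb.subset_ball 0
  refine continuous_iff_continuousAt.2 fun z => ?_
  refine continuousAt_of_dominated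
    (bound := (ball (0 : ℂ) (‖z‖ + 1 + R)).indicator fun x => ‖x‖⁻¹) ?_ ?_ ?_ ?_
  · refine Eventually.of_forall fun w => Measurable.aestronglyMeasurable ?_
    exact (((measurable_const.indicator hm).comp (measurable_const.sub measurable_id))).mul
      measurable_id.inv
  · filter_upwards [ball_mem_nhds z one_pos] with w hw
    refine ae_of_all _ fun x => ?_
    by_cases hx : w - x ∈ Ω
    · rw [indicator_of_mem hx, one_mul, norm_inv, indicator_of_mem]
      have h1 := hR hx
      rw [mem_ball_zero_iff] at h1 ⊢
      rw [mem_ball, dist_eq_norm] at hw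
      calc ‖x‖ = ‖z + (w - z) - (w - x)‖ := by ring_nf
        _ ≤ ‖z‖ + ‖w - z‖ + ‖w - x‖ := (norm_sub_le _ _).trans (by gcongr; exact norm_add_le _ _)
        _ < _ := by linarith
    · rw [indicator_of_notMem hx, zero_mul, norm_zero]
      exact indicator_nonneg (fun _ _ => by positivity) _
  · exact (integrable_indicator_iff measurableSet_ball).2 (integrableOn_ball_norm_inv _)
  -- The indicator is continuous off the frontier, and x ↦ z - x preserves area, so almost every x
  -- is good.
  · have h1 : ∀ᵐ x : ℂ, x ∉ frontier Ω := measure_eq_zero_iff_ae_notMem.1 h0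
    have h2 := (Measure.measurePreserving_sub_left volume z).quasiMeasurePreserving.ae h1
    filter_upwards [h2] with x hx
    refine ContinuousAt.mul ?_ continuousAt_const
    have : ContinuousAt (Ω.indicator fun _ => (1 : ℂ)) (z - x) := by
      by_cases hi : z - x ∈ interior Ω
      · refine (continuousAt_const (y := (1 : ℂ))).congr ?_
        filter_upwards [mem_interior_iff_mem_nhds.1 hi] with w hw
        rw [indicator_of_mem hw]
      · have hcl : z - x ∈ (closure Ω)ᶜ := fun hcl => hx ⟨hcl, hi⟩
        refine (continuousAt_const (y := (0 : ℂ))).congr ?_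
        filter_upwards [isClosed_closure.isOpen_compl.mem_nhds hcl] with w hw
        rw [indicator_of_notMem fun h => hw (subset_closure h)]
    exact ContinuousAt.comp (f := fun w => w - x) this (by fun_prop)

theorem differentiableAt_integral_sub_inv {s : Set ℂ} (hb : Bornology.IsBounded s)
    (hm : MeasurableSet s) {c : ℂ} {r : ℝ}
    (hr : 0 < r) (hs : Disjoint s (ball c r)) :
    DifferentiableAt ℂ (fun z => ∫ ζ in s, (z - ζ)⁻¹) c := by
  obtain ⟨R, hR⟩ := hb.subset_ball 0
  have hfin : IsFiniteMeasure (volume.restrict s) :=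
    ⟨by rw [Measure.restrict_apply_univ]; exact (measure_mono hR).trans_lt measure_ball_lt_top⟩
  have hr2 : 0 < r / 2 := by positivity
  have hdist : ∀ ζ ∈ s, ∀ z ∈ ball c (r / 2), r / 2 ≤ ‖z - ζ‖ := by
    intro ζ hζ z hz
    have h1 : ζ ∉ ball c r := fun h => hs.le_bot ⟨hζ, h⟩
    rw [mem_ball, not_lt] at h1
    rw [mem_ball] at hz
    have := dist_triangle_left ζ c z
    rw [← dist_eq_norm]
    linarith
  refine (hasDerivAt_integral_of_dominated_loc_of_deriv_le (ball_mem_nhds c hr2)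
    (bound := fun _ => ((r / 2) ^ 2)⁻¹) (F := fun z ζ => (z - ζ)⁻¹) (μ := volume.restrict s)
    (F' := fun z ζ => -1 / (z - ζ) ^ 2)
    (Eventually.of_forall fun z => Measurable.aestronglyMeasurable (by fun_prop))
    (integrableOn_sub_inv hb c) (Measurable.aestronglyMeasurable (by fun_prop)) ?_
    (integrable_const _) ?_).2.differentiableAt
  · filter_upwards [ae_restrict_mem hm] with ζ hζ z hz
    rw [norm_div, norm_neg, norm_one, one_div, norm_pow]
    exact inv_anti₀ (by positivity) (pow_le_pow_left₀ hr2.le (hdist ζ hζ z hz) 2)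
  · filter_upwards [ae_restrict_mem hm] with ζ hζ z hz
    exact ((hasDerivAt_id' z).sub_const ζ).fun_inv
      (norm_pos_iff.1 (hr2.trans_le (hdist ζ hζ z hz)))

/-- Near c the transform splits into that of a disc about c, which is conj(z - c), and that of the
rest of Ω, which is analytic at c. Only the disc part is not analytic, and subtraction from conj z
cancels it. -/
theorem differentiableOn_conj_sub_cauchyTransform (hb : Bornology.IsBounded Ω) (ho : IsOpen Ω) :
    DifferentiableOn ℂ (fun z => conj z - cauchyTransform Ω z) Ω := by
  intro c hc
  obtain ⟨r, hr, hrΩ⟩ := Metric.isOpen_iff.1 ho c hc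
  refine DifferentiableAt.differentiableWithinAt ?_
  have h1 := differentiableAt_integral_sub_inv (s := Ω \ ball c r) (hb.subset sdiff_subset)
    (ho.measurableSet.diff measurableSet_ball) hr disjoint_sdiff_left
  have h2 : (fun z => conj z - cauchyTransform Ω z) =ᶠ[𝓝 c]
      fun z => conj c - (π : ℂ)⁻¹ * ∫ ζ in Ω \ ball c r, (z - ζ)⁻¹ := by
    filter_upwards [ball_mem_nhds c hr] with z hz
    have hi := integrableOn_sub_inv hb z
    have h3 : ∫ ζ in Ω, (z - ζ)⁻¹ =
        (∫ ζ in ball c r, (z - ζ)⁻¹) + ∫ ζ in Ω \ ball c r, (z - ζ)⁻¹ := by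
      rw [← setIntegral_union disjoint_sdiff_right (ho.measurableSet.diff measurableSet_ball)
        (hi.mono_set hrΩ) (hi.mono_set sdiff_subset), union_sdiff_cancel hrΩ]
    have h4 : ∫ ζ in ball c r, (z - ζ)⁻¹ = π * conj (z - c) := by
      rw [setIntegral_ball_sub_inv' hr.le, min_eq_right (by rw [← dist_eq_norm]; exact hz.le)]
      by_cases h : z - c = 0
      · simp [h]
      · rw [← Complex.mul_conj']
        field_simp
    rw [cauchyTransform, areaIntegral, h3, h4, map_sub]
    have : (π : ℂ) ≠ 0 := by exact_mod_cast pi_ne_zero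
    field_simp
    ring
  exact ((differentiableAt_const _).sub (h1.const_mul _)).congr_of_eventuallyEq h2

end CauchyTransform

/-! ### The Schwarz function of a quadrature domain -/

section Schwarz

open Polynomial ComplexConjugate

variable {Ω : Set ℂ} {h : RatFunc ℂ}

theorem IsBoundedRectifiableDomain.compl_eq (hΩ : IsBoundedRectifiableDomain Ω) :
    Ωᶜ = closure (closure Ω)ᶜ := by
  rw [closure_compl, hΩ.interior_closure]

/-- For z in the exterior, test the quadrature identity with ζ ↦ 1/(z - ζ) and apply the Cauchy
formula to h. Both sides are continuous on the complement of Ω, and Ω = Int Cl Ω makes the exterior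
dense in it; this is how the boundary is reached. -/
theorem IsBoundedQD.cauchyTransform_eq (hQ : IsBoundedQD Ω h) :
    EqOn (cauchyTransform Ω) (ratEval h) Ωᶜ := by
  obtain ⟨Γ, hΓ⟩ := hQ.domain.rectifiable
  have hc := continuous_cauchyTransform hQ.domain.isBounded hQ.domain.isOpen.measurableSet
    hΓ.volume_frontier
  refine EqOn.of_subset_closure (s := (closure Ω)ᶜ) (fun z hz => ?_) hc.continuousOn
    hQ.rat.continuousOn (compl_subset_compl.2 subset_closure) hQ.domain.compl_eq.subset
  have hzc : ∀ ζ ∈ closure Ω, z - ζ ≠ 0 := fun ζ hζ h0 => hz (sub_eq_zero.1 h0 ▸ hζ)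
  have hf : (fun ζ => (z - ζ)⁻¹) ∈ AnalyticClass Ω :=
    ⟨fun ζ hζ => (((differentiableAt_const z).sub differentiableAt_id).inv
      (hzc ζ (subset_closure hζ))).differentiableWithinAt,
      ContinuousOn.inv₀ (by fun_prop) hzc⟩
  rw [cauchyTransform, hQ.quadrature Γ hΓ _ hf, ← neg_eq_iff_eq_neg.2
    (hΓ.integral_ratEval hQ.domain.isOpen hQ.rat hz), ← RectifiableContour.integral_neg]
  refine RectifiableContour.integral_congr fun ζ _ => ?_
  rw [← neg_sub ζ z, inv_neg, neg_mul, mul_comm]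

/-- The functions analytic in `Ω` and continuous on its closure form an algebra. -/
def analyticAlgebra (Ω : Set ℂ) : Subalgebra ℂ (ℂ → ℂ) where
  carrier := AnalyticClass Ω
  mul_mem' hf hg := ⟨hf.1.mul hg.1, hf.2.mul hg.2⟩
  add_mem' hf hg := ⟨hf.1.add hg.1, hf.2.add hg.2⟩
  algebraMap_mem' c := ⟨differentiableOn_const c, continuousOn_const⟩

theorem eval_mem_analyticAlgebra (p : ℂ[X]) : (fun z => p.eval z) ∈ analyticAlgebra Ω :=
  ⟨p.differentiable.differentiableOn, p.continuous.continuousOn⟩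

/-- The Schwarz function of a quadrature domain, multiplied by the denominator of its quadrature
function: an analytic function with boundary values `d(z) z̄`. -/
theorem IsBoundedQD.exists_schwarz (hQ : IsBoundedQD Ω h) :
    ∃ σ ∈ analyticAlgebra Ω, ∀ z ∈ frontier Ω, σ z = h.denom.eval z * conj z := by
  obtain ⟨Γ, hΓ⟩ := hQ.domain.rectifiable
  have hc := continuous_cauchyTransform hQ.domain.isBounded hQ.domain.isOpen.measurableSet
    hΓ.volume_frontier
  have h1 : (fun z => conj z - cauchyTransform Ω z) ∈ analyticAlgebra Ω :=
    ⟨differentiableOn_conj_sub_cauchyTransform hQ.domain.isBounded hQ.domain.isOpen,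
      (Complex.continuous_conj.sub hc).continuousOn⟩
  refine ⟨_, add_mem (mul_mem (eval_mem_analyticAlgebra h.denom) h1)
    (eval_mem_analyticAlgebra h.num), fun z hz => ?_⟩
  have hz' : z ∉ Ω := fun h0 => (hQ.domain.isOpen.frontier_eq ▸ hz).2 h0
  have hd := hQ.rat.denom_eval_ne_zero hz'
  simp only [Pi.add_apply, Pi.mul_apply, hQ.cauchyTransform_eq hz', ratEval_eq]
  field_simp
  ring

end Schwarz

/-! ### The boundary lies on an irreducible real algebraic curve -/

section BoundaryPolynomial

open Polynomial ComplexConjugate Filter Topology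
open scoped Polynomial.Bivariate

variable {Ω : Set ℂ} {h : RatFunc ℂ}

namespace analyticAlgebra

/-- The coordinate function. -/
def coord (Ω : Set ℂ) : analyticAlgebra Ω := ⟨fun z => z, by simpa using eval_mem_analyticAlgebra X⟩

/-- Evaluation at a point. -/
def ev (z : ℂ) : analyticAlgebra Ω →ₐ[ℂ] ℂ :=
  (Pi.evalAlgHom ℂ (fun _ : ℂ => ℂ) z).comp (analyticAlgebra Ω).val

theorem ev_apply (f : analyticAlgebra Ω) (z : ℂ) : ev z f = f.1 z := rfl

theorem ev_ext {f g : analyticAlgebra Ω} (h : ∀ z, ev z f = ev z g) : f = g :=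
  Subtype.ext (funext h)

theorem ev_aeval_coord (p : ℂ[X]) (z : ℂ) : ev z (aeval (coord Ω) p) = p.eval z := by
  rw [← aeval_algHom_apply]
  rfl

/-- Newton division: subtract an interpolation polynomial, then divide. -/
theorem exists_eq_add_prod_mul (hΩ : IsOpen Ω) (s : Multiset ℂ) (hs : ∀ p ∈ s, p ∈ Ω)
    (g : analyticAlgebra Ω) :
    ∃ R ∈ degreeLT ℂ (Multiset.card s), ∃ B : analyticAlgebra Ω,
      g = aeval (coord Ω) R + aeval (coord Ω) (s.map fun p => X - C p).prod * B := by
  induction s using Multiset.induction_on with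
  | empty => exact ⟨0, zero_mem _, g, by simp⟩
  | cons a s ih =>
    obtain ⟨R, hR, B, hB⟩ := ih fun p hp => hs p (by simp [hp])
    have ha : Ω ∈ 𝓝 a := hΩ.mem_nhds (hs a (by simp))
    have hBd : DifferentiableAt ℂ B.1 a := B.2.1.differentiableAt ha
    let B' : analyticAlgebra Ω := ⟨dslope B.1 a, (Complex.differentiableOn_dslope ha).2 B.2.1,
      (continuousOn_dslope (Filter.mem_of_superset ha subset_closure)).2 ⟨B.2.2, hBd⟩⟩
    refine ⟨R + C (B.1 a) * (s.map fun p => X - C p).prod, add_mem ?_ ?_, B', ?_⟩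
    · rw [Multiset.card_cons]
      exact degreeLT_mono (Nat.le_succ _) hR
    · rw [mem_degreeLT, Multiset.card_cons]
      refine (degree_le_natDegree.trans (Nat.cast_le.2 (natDegree_C_mul_le _ _))).trans_lt ?_
      rw [natDegree_multiset_prod_X_sub_C_eq_card]
      exact_mod_cast Nat.lt_succ_self _
    · refine ev_ext fun z => ?_
      have h1 : B.1 z = B.1 a + (z - a) * B'.1 z := by
        have := sub_smul_dslope B.1 a z
        rw [smul_eq_mul] at this
        change _ = _ + (z - a) * dslope B.1 a z
        rw [this]
        ring
      rw [hB]
      simp only [map_add, map_mul, ev_aeval_coord, Multiset.map_cons, Multiset.prod_cons, eval_sub,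
        eval_X, eval_C]
      rw [ev_apply B, ev_apply B', h1]
      ring

/-- Dimension count: in a large space of functions some combination is divisible by `q`. -/
theorem exists_mem_ideal {m : ℕ} {q : analyticAlgebra Ω}
    (hq : ∀ g : analyticAlgebra Ω, ∃ R ∈ degreeLT ℂ m, ∃ B : analyticAlgebra Ω,
      g = aeval (coord Ω) R + q * B)
    {ι : Type*} [Fintype ι] (v : ι → analyticAlgebra Ω) (i₀ : ι)
    (hcard : 2 * m + 1 < Fintype.card ι) :
    ∃ c : ι → ℝ, c ≠ 0 ∧ c i₀ = 0 ∧ ∃ B, ∑ i, (c i : ℂ) • v i = q * B := by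
  let T : Submodule ℂ (analyticAlgebra Ω) := LinearMap.range (LinearMap.mulLeft ℂ q)
  let F : degreeLT ℂ m →ₗ[ℂ] (analyticAlgebra Ω ⧸ T) :=
    (T.mkQ.comp (aeval (coord Ω)).toLinearMap).comp (degreeLT ℂ m).subtype
  have hF : Function.Surjective F := by
    intro y
    obtain ⟨g, rfl⟩ := T.mkQ_surjective y
    obtain ⟨R, hR, B, hB⟩ := hq g
    refine ⟨⟨R, hR⟩, ?_⟩
    refine (Submodule.Quotient.eq T).2 ⟨-B, ?_⟩
    rw [LinearMap.mulLeft_apply, hB]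
    change q * -B = aeval (coord Ω) R - (aeval (coord Ω) R + q * B)
    ring
  have hfd : FiniteDimensional ℂ (degreeLT ℂ m) :=
    (degreeLTEquiv ℂ m).symm.finiteDimensional
  have hfin : FiniteDimensional ℂ (analyticAlgebra Ω ⧸ T) := Module.Finite.of_surjective F hF
  have hrank : Module.finrank ℂ (analyticAlgebra Ω ⧸ T) ≤ m := by
    refine (LinearMap.finrank_le_finrank_of_surjective (f := F) hF).trans ?_
    rw [LinearEquiv.finrank_eq (degreeLTEquiv ℂ m), Module.finrank_fin_fun]
  let L : (ι → ℝ) →ₗ[ℝ] (analyticAlgebra Ω ⧸ T) × ℝ :=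
    LinearMap.prod
      { toFun := fun c => T.mkQ (∑ i, (c i : ℂ) • v i)
        map_add' := fun c c' => by
          rw [← map_add, ← Finset.sum_add_distrib]
          simp [add_smul]
        map_smul' := fun r c => by
          rw [RingHom.id_apply, ← LinearMap.map_smul_of_tower, Finset.smul_sum]
          simp [mul_smul] }
      (LinearMap.proj i₀)
  have hfinR : FiniteDimensional ℝ (analyticAlgebra Ω ⧸ T) := FiniteDimensional.complexToReal _
  -- The quotient has complex dimension at most m, hence real dimension at most 2m; the condition on
  -- the coefficient at `i₀` costs one more.
  have hlt : Module.finrank ℝ ((analyticAlgebra Ω ⧸ T) × ℝ) < Module.finrank ℝ (ι → ℝ) := by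
    rw [Module.finrank_prod, finrank_real_of_complex, Module.finrank_self,
      Module.finrank_fintype_fun_eq_card]
    lia
  obtain ⟨c, hc, hc0⟩ := (LinearMap.ker L).ne_bot_iff.1 (LinearMap.ker_ne_bot_of_finrank_lt hlt)
  have hc' := LinearMap.mem_ker.1 hc
  obtain ⟨B, hB⟩ := (Submodule.Quotient.mk_eq_zero T).1 (congrArg Prod.fst hc')
  exact ⟨c, hc0, congrArg Prod.snd hc', B, hB.symm⟩

/-- A function real on the boundary of a bounded domain is constant. -/
theorem exists_eq_const_of_real (ho : IsOpen Ω) (hc : IsConnected Ω) (hb : Bornology.IsBounded Ω)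
    (B : analyticAlgebra Ω) (hB : ∀ z ∈ frontier Ω, (ev z B).im = 0) :
    ∃ b : ℝ, ∀ z ∈ Ω, ev z B = b := by
  have him : ∀ z ∈ Ω, (B.1 z).im = 0 := by
    -- For imaginary k, |exp(kB)| = 1 on the boundary, so the maximum principle gives Re(kB) ≤ 0
    -- inside; k = ±i then force Im B = 0.
    have key : ∀ k : ℂ, k.re = 0 → ∀ z ∈ Ω, (k * B.1 z).re ≤ 0 := by
      intro k hk z hz
      have hd : DiffContOnCl ℂ (fun z => Complex.exp (k * B.1 z)) Ω :=
        ⟨(B.2.1.const_mul k).cexp, (B.2.2.const_mul k).cexp⟩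
      have := Complex.norm_le_of_forall_mem_frontier_norm_le hb hd (C := 1) (fun w hw => ?_)
        (subset_closure hz)
      · rwa [Complex.norm_exp, Real.exp_le_one_iff] at this
      · have h0 : (B.1 w).im = 0 := hB w hw
        rw [Complex.norm_exp, Complex.mul_re, hk, h0]
        simp
    intro z hz
    have h1 := key Complex.I rfl z hz
    have h2 := key (-Complex.I) (by simp) z hz
    simp only [Complex.mul_re, Complex.I_re, Complex.I_im, Complex.neg_re, Complex.neg_im] at h1 h2
    linarith
  obtain ⟨z₀, hz₀⟩ := hc.nonempty
  have han : AnalyticOnNhd ℂ B.1 Ω := B.2.1.analyticOnNhd ho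
  rcases han.is_constant_or_isOpen hc.isPreconnected with ⟨w, hw⟩ | hop
  · refine ⟨w.re, fun z hz => ?_⟩
    have := him z hz
    rw [ev_apply, hw z hz] at *
    exact Complex.ext rfl (by simpa using this)
  · exfalso
    have h1 := hop Ω subset_rfl ho
    obtain ⟨ε, hε, hε'⟩ := Metric.isOpen_iff.1 h1 _ (mem_image_of_mem B.1 hz₀)
    have h2 : B.1 z₀ + (ε / 2 : ℝ) * Complex.I ∈ B.1 '' Ω := by
      refine hε' ?_
      rw [Metric.mem_ball, dist_eq_norm, add_sub_cancel_left, norm_mul, Complex.norm_I, mul_one,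
        Complex.norm_real, Real.norm_of_nonneg (by positivity)]
      linarith
    obtain ⟨z, hz, hzz⟩ := h2
    have h3 := him z hz
    rw [hzz] at h3
    have h4 := him z₀ hz₀
    simp [h4] at h3
    linarith

end analyticAlgebra

open analyticAlgebra

theorem aevalAeval_monomial (x y : ℂ) (j k : ℕ) (r : ℝ) :
    aevalAeval (R := ℝ) x y (monomial k (monomial j r)) = r * x ^ j * y ^ k := by
  simp [aevalAeval, aeval_monomial]

/-- Bivariate polynomial functions of `S₁ / d` and `S₂ / d`, multiplied by a power of `d`, lie in
the algebra. -/
theorem exists_pow_mul_aevalAeval (d S₁ S₂ : analyticAlgebra Ω) (p : ℝ[X][Y]) :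
    ∃ (M : ℕ) (A : analyticAlgebra Ω), ∀ z, ev z d ≠ 0 →
      ev z A = ev z d ^ M * aevalAeval (R := ℝ) (ev z S₁ / ev z d) (ev z S₂ / ev z d) p := by
  have hadd : ∀ p q : ℝ[X][Y],
      (∃ (M : ℕ) (A : analyticAlgebra Ω), ∀ z, ev z d ≠ 0 →
        ev z A = ev z d ^ M * aevalAeval (R := ℝ) (ev z S₁ / ev z d) (ev z S₂ / ev z d) p) →
      (∃ (M : ℕ) (A : analyticAlgebra Ω), ∀ z, ev z d ≠ 0 →
        ev z A = ev z d ^ M * aevalAeval (R := ℝ) (ev z S₁ / ev z d) (ev z S₂ / ev z d) q) →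
      ∃ (M : ℕ) (A : analyticAlgebra Ω), ∀ z, ev z d ≠ 0 →
        ev z A = ev z d ^ M * aevalAeval (R := ℝ) (ev z S₁ / ev z d) (ev z S₂ / ev z d) (p + q) := by
    rintro p q ⟨M, A, hA⟩ ⟨M', A', hA'⟩
    refine ⟨M + M', d ^ M' * A + d ^ M * A', fun z hz => ?_⟩
    simp only [map_add, map_mul, map_pow, hA z hz, hA' z hz]
    ring
  induction p using Polynomial.induction_on' with
  | add p q hp hq => exact hadd p q hp hq
  | monomial k a =>
    induction a using Polynomial.induction_on' with
    | add p q hp hq =>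
      rw [map_add]
      exact hadd _ _ hp hq
    | monomial j r =>
      refine ⟨j + k, (r : ℂ) • (S₁ ^ j * S₂ ^ k), fun z hz => ?_⟩
      rw [aevalAeval_monomial]
      simp only [map_smul, map_mul, map_pow, smul_eq_mul, div_pow, pow_add]
      field_simp

/-- A nonzero real polynomial relation between the "real and imaginary part" of the Schwarz
function. -/
theorem exists_polynomial_relation (ho : IsOpen Ω) (hc : IsConnected Ω)
    (hb : Bornology.IsBounded Ω) (s : Multiset ℂ) (hs : ∀ p ∈ s, p ∈ Ω)
    (S₁ S₂ : analyticAlgebra Ω)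
    (h₁ : ∀ z ∈ frontier Ω, ev z S₁ = (s.map fun p => X - C p).prod.eval z * z.re)
    (h₂ : ∀ z ∈ frontier Ω, ev z S₂ = (s.map fun p => X - C p).prod.eval z * z.im) :
    ∃ Q : ℝ[X][Y], Q ≠ 0 ∧ ∀ z ∈ Ω, (s.map fun p => X - C p).prod.eval z ≠ 0 →
      aevalAeval (R := ℝ) (ev z S₁ / (s.map fun p => X - C p).prod.eval z)
        (ev z S₂ / (s.map fun p => X - C p).prod.eval z) Q = 0 := by
  set D : ℂ[X] := (s.map fun p => X - C p).prod with hD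
  -- There are (N + 1)² monomials, against 2·(2N · card s) + 1 real conditions for divisibility by
  -- D^(2N) and a vanishing constant term; this N makes the former larger.
  set N := 4 * Multiset.card s + 1 with hN
  let d : analyticAlgebra Ω := aeval (coord Ω) D
  have hdz : ∀ z, ev z d = D.eval z := fun z => ev_aeval_coord D z
  have hDs : ((2 * N) • s).map (fun p => X - C p) = (2 * N) • s.map fun p => X - C p :=
    Multiset.map_nsmul _ _ _
  have hq := fun g => exists_eq_add_prod_mul ho ((2 * N) • s)
    (fun p hp => hs p (Multiset.mem_of_mem_nsmul hp)) g
  rw [hDs, Multiset.prod_nsmul, ← hD] at hq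
  -- Monomials in S₁/D and S₂/D, cleared of denominators by the common factor D^(2N). Both exponents
  -- are at most N, so the subtraction is not truncated.
  let v : Fin (N + 1) × Fin (N + 1) → analyticAlgebra Ω := fun i =>
    S₁ ^ (i.1 : ℕ) * S₂ ^ (i.2 : ℕ) * d ^ (2 * N - i.1 - i.2)
  have hv : ∀ i z (x y : ℂ), ev z S₁ = D.eval z * x → ev z S₂ = D.eval z * y →
      ev z (v i) = D.eval z ^ (2 * N) * (x ^ (i.1 : ℕ) * y ^ (i.2 : ℕ)) := by
    intro i z x y h1 h2
    have hpow : (i.1 : ℕ) + i.2 + (2 * N - i.1 - i.2) = 2 * N := by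
      have := i.1.2
      have := i.2.2
      lia
    simp only [v, map_mul, map_pow, h1, h2, hdz]
    generalize 2 * N - (i.1 : ℕ) - i.2 = l at hpow
    rw [← hpow]
    ring
  obtain ⟨c, hc0, hc00, B, hB⟩ := exists_mem_ideal hq v (0, 0) (by
    rw [Fintype.card_prod, Fintype.card_fin, Multiset.card_nsmul]
    nlinarith)
  have hrel : ∀ z (x y : ℂ), ev z S₁ = D.eval z * x → ev z S₂ = D.eval z * y → D.eval z ≠ 0 →
      ∑ i, (c i : ℂ) * (x ^ (i.1 : ℕ) * y ^ (i.2 : ℕ)) = ev z B := by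
    intro z x y h1 h2 hz
    have := congrArg (ev z) hB
    simp only [map_sum, map_smul, smul_eq_mul, map_mul, hv _ z x y h1 h2, map_pow,
      ev_aeval_coord] at this
    refine mul_left_cancel₀ (pow_ne_zero (2 * N) hz) (Eq.trans ?_ this)
    rw [Finset.mul_sum]
    exact Finset.sum_congr rfl fun i _ => by ring
  have hreal : ∀ z ∈ frontier Ω, (ev z B).im = 0 := by
    intro z hz
    have hDz : D.eval z ≠ 0 := by
      rw [hD, eval_multiset_prod, Multiset.map_map]
      refine Multiset.prod_ne_zero fun h0 => ?_
      obtain ⟨p, hp, hp0⟩ := Multiset.mem_map.1 h0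
      have hzp : z = p := by simpa [sub_eq_zero] using hp0
      exact disjoint_right.1 (disjoint_frontier_iff_isOpen.2 ho) (hzp ▸ hs p hp) hz
    rw [← hrel z z.re z.im (h₁ z hz) (h₂ z hz) hDz]
    have : ∑ i, (c i : ℂ) * ((z.re : ℂ) ^ (i.1 : ℕ) * (z.im : ℂ) ^ (i.2 : ℕ)) =
      ((∑ i, c i * (z.re ^ (i.1 : ℕ) * z.im ^ (i.2 : ℕ)) : ℝ) : ℂ) := by push_cast; rfl
    rw [this, Complex.ofReal_im]
  -- On the boundary the quotient B is a real polynomial in Re z and Im z, so it is a real constant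
  -- b. Since the (0, 0) coefficient of c was forced to be 0, subtracting b cannot cancel the
  -- relation.
  obtain ⟨b, hb'⟩ := exists_eq_const_of_real ho hc hb B hreal
  refine ⟨∑ i, monomial (i.2 : ℕ) (monomial (i.1 : ℕ) (c i)) - monomial 0 (monomial 0 b), ?_, ?_⟩
  · intro h0
    refine hc0 (funext fun i => ?_)
    by_cases hi : i = (0, 0)
    · rw [hi, hc00]; rfl
    · have := congrArg (fun P => (P.coeff (i.2 : ℕ)).coeff (i.1 : ℕ)) h0
      simp only [coeff_sub, finsetSum_coeff, coeff_zero] at this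
      rw [Finset.sum_eq_single i (fun j _ hj => ?_) (by simp), coeff_monomial_same,
        coeff_monomial_same, sub_eq_zero] at this
      · rw [this, coeff_monomial]
        split_ifs with h2
        · rw [coeff_monomial, if_neg]
          · rfl
          · exact fun h3 => hi (Prod.ext (Fin.ext h3.symm) (Fin.ext h2.symm))
        · rfl
      · rw [coeff_monomial]
        split_ifs with h2
        · rw [coeff_monomial, if_neg]
          exact fun h3 => hj (Prod.ext (Fin.ext h3) (Fin.ext h2))
        · rfl
  · intro z hz hDz
    have h1 := hrel z (ev z S₁ / D.eval z) (ev z S₂ / D.eval z) (by field_simp) (by field_simp) hDz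
    rw [hb' z hz] at h1
    simp only [map_sub, map_sum, aevalAeval_monomial, pow_zero, mul_one]
    rw [sub_eq_zero, ← h1]
    exact Finset.sum_congr rfl fun i _ => by ring

theorem aevalAeval_ofReal (x y : ℝ) (p : ℝ[X][Y]) :
    aevalAeval (R := ℝ) (x : ℂ) (y : ℂ) p = (p.evalEval x y : ℝ) := by
  rw [← coe_aevalAeval_eq_evalEval]
  have : aevalAeval (R := ℝ) (x : ℂ) (y : ℂ) = (Algebra.ofId ℝ ℂ).comp (aevalAeval x y) := by
    ext <;> simp [Algebra.ofId_apply]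
  rw [this]
  rfl

/-- The boundary of a quadrature domain lies on an irreducible real algebraic curve. -/
theorem IsBoundedQD.exists_irreducible (hQ : IsBoundedQD Ω h) :
    ∃ p : ℝ[X][Y], Irreducible p ∧ ∀ z ∈ frontier Ω, p.evalEval z.re z.im = 0 := by
  have ho := hQ.domain.isOpen
  have hc := hQ.domain.isConnected
  obtain ⟨σ, hσ, hσz⟩ := hQ.exists_schwarz
  let d : analyticAlgebra Ω := aeval (coord Ω) h.denom
  have hdz : ∀ z, ev z d = h.denom.eval z := fun z => ev_aeval_coord _ z
  have hcz : ∀ z, ev z (coord Ω) = z := fun z => rfl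
  have hσz' : ∀ z ∈ frontier Ω, ev z (⟨σ, hσ⟩ : analyticAlgebra Ω) = h.denom.eval z * conj z := hσz
  let S₁ : analyticAlgebra Ω := (2⁻¹ : ℂ) • (coord Ω * d + ⟨σ, hσ⟩)
  let S₂ : analyticAlgebra Ω := (2 * Complex.I)⁻¹ • (coord Ω * d - ⟨σ, hσ⟩)
  have h₁ : ∀ z ∈ frontier Ω, ev z S₁ = h.denom.eval z * z.re := by
    intro z hz
    simp only [S₁, map_smul, map_add, map_mul, hσz' z hz, hdz, hcz, smul_eq_mul]
    rw [Complex.re_eq_add_conj]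
    ring
  have h₂ : ∀ z ∈ frontier Ω, ev z S₂ = h.denom.eval z * z.im := by
    intro z hz
    simp only [S₂, map_smul, map_sub, map_mul, hσz' z hz, hdz, hcz, smul_eq_mul]
    rw [Complex.im_eq_sub_conj]
    field_simp
  obtain ⟨Q, hQ0, hQz⟩ := exists_polynomial_relation ho hc hQ.domain.isBounded (ratPoles h)
    hQ.rat.1 S₁ S₂ (by rwa [prod_ratPoles]) (by rwa [prod_ratPoles])
  rw [prod_ratPoles] at hQz
  have hden : h.denom ≠ 0 := h.denom_ne_zero
  obtain ⟨z₀, hz₀, hdz₀⟩ : ∃ z ∈ Ω, h.denom.eval z ≠ 0 := by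
    by_contra! hcon
    have hinf : Ω.Infinite :=
      infinite_of_mem_nhds _ (ho.mem_nhds hc.nonempty.some_mem)
    exact hden (eq_zero_of_infinite_isRoot _ (hinf.mono hcon))
  let val : ℝ[X][Y] → ℂ → ℂ := fun p z => aevalAeval (R := ℝ) (ev z S₁ / h.denom.eval z)
    (ev z S₂ / h.denom.eval z) p
  -- Induction on the factorization of q: a product of functions analytic on the connected set Ω
  -- vanishes only if one factor does. The extra factor d in the products below makes them vanish at
  -- the zeros of d as well.
  have key : ∀ q : ℝ[X][Y], q ≠ 0 → (∀ z ∈ Ω, h.denom.eval z ≠ 0 → val q z = 0) →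
      ∃ p : ℝ[X][Y], Prime p ∧ ∀ z ∈ Ω, h.denom.eval z ≠ 0 → val p z = 0 := by
    intro q
    induction q using UniqueFactorizationMonoid.induction_on_prime with
    | h₁ => exact fun h0 => absurd rfl h0
    | h₂ u hu =>
      intro _ hz
      exact absurd (hz z₀ hz₀ hdz₀) (hu.map (aevalAeval (R := ℝ) (ev z₀ S₁ / h.denom.eval z₀)
        (ev z₀ S₂ / h.denom.eval z₀))).ne_zero
    | h₃ a p ha hp ih =>
      intro hap hz
      obtain ⟨M, A, hA⟩ := exists_pow_mul_aevalAeval d S₁ S₂ p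
      obtain ⟨M', A', hA'⟩ := exists_pow_mul_aevalAeval d S₁ S₂ a
      have hmul : ∀ z ∈ Ω, ((d * A).1 * (d * A').1) z = 0 := by
        intro z hzΩ
        change (d.1 z * A.1 z) * (d.1 z * A'.1 z) = 0
        by_cases h0 : ev z d = 0
        · have : d.1 z = 0 := h0
          simp [this]
        · have h1 := hz z hzΩ (hdz z ▸ h0)
          simp only [val, map_mul, mul_eq_zero] at h1
          have h2 := hA z h0
          have h3 := hA' z h0
          rw [hdz] at h2 h3
          rcases h1 with h1 | h1
          · rw [h1, mul_zero] at h2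
            have : A.1 z = 0 := h2
            simp [this]
          · rw [h1, mul_zero] at h3
            have : A'.1 z = 0 := h3
            simp [this]
      have aux : ∀ (b : ℝ[X][Y]) (K : ℕ) (B : analyticAlgebra Ω), (∀ z, ev z d ≠ 0 →
          ev z B = ev z d ^ K * aevalAeval (R := ℝ) (ev z S₁ / ev z d) (ev z S₂ / ev z d) b) →
          (∀ z ∈ Ω, (d * B).1 z = 0) → ∀ z ∈ Ω, h.denom.eval z ≠ 0 → val b z = 0 := by
        intro b K B hB hdB z hzΩ hz0
        have h1 : ev z d * ev z B = 0 := hdB z hzΩ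
        rw [hB z (by rwa [hdz]), hdz] at h1
        exact ((mul_eq_zero.1 h1).resolve_left hz0 |> mul_eq_zero.1).resolve_left (pow_ne_zero _ hz0)
      rcases AnalyticOnNhd.eq_zero_or_eq_zero_of_mul_eq_zero
        ((d * A).2.1.analyticOnNhd ho) ((d * A').2.1.analyticOnNhd ho) hmul hc.isPreconnected
        with h4 | h4
      · exact ⟨p, hp, aux p M A hA h4⟩
      · exact ih ha (aux a M' A' hA' h4)
  obtain ⟨p, hp, hpz⟩ := key Q hQ0 hQz
  refine ⟨p, hp.irreducible, fun z hz => ?_⟩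
  obtain ⟨M, A, hA⟩ := exists_pow_mul_aevalAeval d S₁ S₂ p
  -- The relation passes to the boundary by continuity. There d ≠ 0 and the two quotients are Re z
  -- and Im z.
  have h0 : EqOn (d * A).1 0 (closure Ω) := by
    refine EqOn.of_subset_closure (s := Ω) (fun w hw => ?_) (d * A).2.2 continuousOn_const
      subset_closure subset_rfl
    change ev w d * ev w A = 0
    by_cases h0 : ev w d = 0
    · rw [h0, zero_mul]
    · rw [hA w h0, hdz]
      rw [hdz] at h0
      exact mul_eq_zero_of_right _ (mul_eq_zero_of_right _ (hpz w hw h0))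
  have hzd : ev z d ≠ 0 := by
    rw [hdz]
    exact hQ.rat.denom_eval_ne_zero (disjoint_left.1 (disjoint_frontier_iff_isOpen.2 ho) hz)
  have h5 : ev z d * ev z A = 0 := h0 (frontier_subset_closure hz)
  rw [hA z hzd, h₁ z hz, h₂ z hz, hdz] at h5
  rw [hdz] at hzd
  rw [mul_div_cancel_left₀ _ hzd, mul_div_cancel_left₀ _ hzd, aevalAeval_ofReal] at h5
  simpa [hzd] using h5

end BoundaryPolynomial

/-! ### Intersections of plane curves and of their translates -/

section CommonZeros

open Polynomial
open scoped Polynomial.Bivariate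

variable {K : Type*} [Field K]

/-- An irreducible curve meets a curve not containing it in finitely many points. -/
theorem Polynomial.finite_common_zeros {p q : K[X][Y]} (hp : Irreducible p)
    (hdeg : p.natDegree ≠ 0) (hpq : ¬p ∣ q) :
    {z : K × K | p.evalEval z.1 z.2 = 0 ∧ q.evalEval z.1 z.2 = 0}.Finite := by
  classical
  have hprim := hp.isPrimitive hdeg
  let φ : K[X] →+* FractionRing K[X] := algebraMap _ _
  have hφ : Function.Injective φ := IsFractionRing.injective _ _
  -- By Gauss's lemma p stays irreducible over the field of fractions and does not divide q there,
  -- so the resultant is nonzero. It is a combination of p and q, so its roots contain the abscissae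
  -- of the common zeros.
  have hcop : IsCoprime (p.map φ) (q.map φ) := by
    have hirr := (hprim.irreducible_iff_irreducible_map_fraction_map (K := FractionRing K[X])).1 hp
    refine (EuclideanDomain.dvd_or_coprime _ _ hirr).resolve_left fun hd => hpq ?_
    exact hprim.dvd_of_fraction_map_dvd_fraction_map hd
  have hres : resultant p q ≠ 0 := by
    intro h0
    have h1 := resultant_map_map p q p.natDegree q.natDegree φ
    rw [h0, map_zero] at h1
    have h2 : resultant (p.map φ) (q.map φ) = 0 := by
      rwa [natDegree_map_eq_of_injective hφ, natDegree_map_eq_of_injective hφ]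
    exact (resultant_eq_zero_iff.1 h2).2 hcop
  obtain ⟨a, b, -, -, hab⟩ := exists_mul_add_mul_eq_C_resultant p q le_rfl le_rfl (Or.inl hdeg)
  have hfin : ∀ x : K, {y : K | p.evalEval x y = 0}.Finite := by
    intro x
    -- If p vanished on the whole vertical line over x, then X - x would divide all its
    -- coefficients, against primitivity.
    have hne : p.map (evalRingHom x) ≠ 0 := by
      intro h0
      have hdvd : C (X - C x) ∣ p := by
        rw [C_dvd_iff_dvd_coeff]
        intro i
        rw [dvd_iff_isRoot]
        simpa using congrArg (fun r => r.coeff i) h0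
      exact not_isUnit_X_sub_C x (hprim _ hdvd)
    refine (p.map (evalRingHom x)).roots.toFinset.finite_toSet.subset fun y hy => ?_
    simp only [Finset.mem_coe, Multiset.mem_toFinset, mem_roots hne, IsRoot.def]
    rwa [map_evalRingHom_eval]
  refine ((resultant p q).roots.toFinset.finite_toSet.biUnion fun x _ =>
    (hfin x).image (Prod.mk x)).subset ?_
  rintro ⟨x, y⟩ ⟨h1, h2⟩
  have h3 := congrArg (evalEval x y) hab
  rw [evalEval_add, evalEval_mul, evalEval_mul, evalEval_C] at h3
  dsimp only at h1 h2
  rw [h1, h2, zero_mul, zero_mul, add_zero] at h3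
  refine mem_iUnion₂.2 ⟨x, ?_, y, h1, rfl⟩
  simp only [Finset.mem_coe, Multiset.mem_toFinset, mem_roots hres]
  exact h3.symm

/-- A polynomial invariant under a translation is constant. -/
theorem Polynomial.natDegree_eq_zero_of_taylor_eq {R : Type*} [CommRing R] [IsDomain R] [CharZero R]
    {p : R[X]} {t : R} (ht : t ≠ 0) (h : taylor t p = p) : p.natDegree = 0 := by
  have h1 : ∀ n : ℕ, p.eval (n * t) = p.eval 0 := by
    intro n
    induction n with
    | zero => simp
    | succ n ih =>
      rw [← ih]
      conv_rhs => rw [← h, taylor_eval]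
      congr 1
      push_cast
      ring
  have h2 : p - C (p.eval 0) = 0 := by
    refine eq_zero_of_infinite_isRoot _ ((infinite_range_of_injective
      (f := fun n : ℕ => (n : R) * t) fun a b hab => ?_).mono ?_)
    · exact_mod_cast mul_right_cancel₀ ht hab
    · rintro _ ⟨n, rfl⟩
      simp [IsRoot.def, h1 n]
  rw [sub_eq_zero.1 h2, natDegree_C]

/-- An irreducible curve meets a vertical translate of itself in finitely many points, unless it
is a vertical line. -/
theorem Polynomial.finite_common_zeros_translate [CharZero K] {p : K[X][Y]} (hp : Irreducible p)
    (hdeg : p.natDegree ≠ 0) {t : K} (ht : t ≠ 0) :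
    {z : K × K | p.evalEval z.1 z.2 = 0 ∧ p.evalEval z.1 (z.2 + t) = 0}.Finite := by
  -- Translation preserves degree and leading coefficient, so divisibility would make p equal to its
  -- translate, hence constant in the second variable.
  have key : ¬p ∣ taylor (C t) p := by
    rintro ⟨c, hc⟩
    have hp0 := hp.ne_zero
    have hc0 : c ≠ 0 := by
      rintro rfl
      rw [mul_zero, taylor_eq_zero] at hc
      exact hp0 hc
    have h1 := congrArg natDegree hc
    rw [natDegree_taylor, natDegree_mul hp0 hc0] at h1
    obtain ⟨a, rfl⟩ := natDegree_eq_zero.1 (by lia : c.natDegree = 0)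
    have h2 := congrArg leadingCoeff hc
    rw [leadingCoeff_taylor, leadingCoeff_mul, leadingCoeff_C] at h2
    have ha : a = 1 := mul_left_cancel₀ (leadingCoeff_ne_zero.2 hp0) (by rw [← h2, mul_one])
    rw [ha, C_1, mul_one] at hc
    exact hdeg (natDegree_eq_zero_of_taylor_eq (C_ne_zero.2 ht) hc)
  refine (finite_common_zeros hp hdeg key).subset fun z hz => ⟨hz.1, ?_⟩
  rw [evalEval, taylor_eval, ← C_add]
  exact hz.2

end CommonZeros

/-! ### Finiteness of the double points of exp on the boundary -/

section DoublePoints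

open Polynomial Filter Topology
open scoped Polynomial.Bivariate

variable {Ω : Set ℂ} {h : RatFunc ℂ}

/-- A bounded set is met by the boundary on every vertical line through one of its points. -/
theorem exists_mem_frontier_re_eq (hb : Bornology.IsBounded Ω) {z : ℂ} (hz : z ∈ Ω) :
    ∃ w ∈ frontier Ω, w.re = z.re := by
  have hcont : Continuous fun t : ℝ => z + t * Complex.I := by fun_prop
  obtain ⟨t, ht⟩ := nonempty_frontier_iff (s := (fun t : ℝ => z + t * Complex.I) ⁻¹' Ω).2
    ⟨⟨0, by simpa using hz⟩, fun hcon => by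
      obtain ⟨R, hR⟩ := hb.exists_norm_le
      have h1 : z + ((R + 1 + ‖z‖ : ℝ) : ℂ) * Complex.I ∈ Ω := eq_univ_iff_forall.1 hcon _
      have h2 := hR _ h1
      have h3 : R + 1 + ‖z‖ ≤ ‖((R + 1 + ‖z‖ : ℝ) : ℂ) * Complex.I‖ := by
        rw [norm_mul, Complex.norm_I, mul_one, Complex.norm_real]
        exact le_abs_self _
      have h4 := norm_sub_le (z + ((R + 1 + ‖z‖ : ℝ) : ℂ) * Complex.I) z
      rw [add_sub_cancel_left] at h4
      linarith⟩
  exact ⟨_, hcont.frontier_preimage_subset Ω ht, by simp⟩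

theorem infinite_re_image_frontier (ho : IsOpen Ω) (hne : Ω.Nonempty)
    (hb : Bornology.IsBounded Ω) : (Complex.re '' frontier Ω).Infinite := by
  obtain ⟨z, hz⟩ := hne
  have h1 : Complex.re '' Ω ⊆ Complex.re '' frontier Ω := by
    rintro _ ⟨w, hw, rfl⟩
    obtain ⟨w', hw', h⟩ := exists_mem_frontier_re_eq hb hw
    exact ⟨w', hw', h⟩
  refine Infinite.mono h1 ?_
  exact infinite_of_mem_nhds z.re ((Complex.isOpenMap_re Ω ho).mem_nhds ⟨z, hz, rfl⟩)

theorem Bornology.IsBounded.finite_int_translate {s : Set ℂ} (hb : Bornology.IsBounded s) :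
    {n : ℤ | ∃ z ∈ s, z + n * (2 * Real.pi * Complex.I) ∈ s}.Finite := by
  obtain ⟨R, hR⟩ := hb.exists_norm_le
  refine (finite_Icc (-⌈R⌉) ⌈R⌉).subset ?_
  rintro n ⟨z, hz, hzn⟩
  have h1 : ‖(n : ℂ) * (2 * Real.pi * Complex.I)‖ ≤ R + R := by
    have := norm_sub_le (z + n * (2 * Real.pi * Complex.I)) z
    rw [add_sub_cancel_left] at this
    exact this.trans (add_le_add (hR _ hzn) (hR _ hz))
  rw [norm_mul, norm_mul, norm_mul, Complex.norm_I, Complex.norm_intCast, Complex.norm_real,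
    Real.norm_of_nonneg Real.pi_pos.le, Complex.norm_two] at h1
  have h2 : |(n : ℝ)| ≤ R := by nlinarith [Real.pi_gt_three, abs_nonneg (n : ℝ)]
  have h3 := abs_le.1 (h2.trans (Int.le_ceil R))
  exact ⟨by exact_mod_cast h3.1, by exact_mod_cast h3.2⟩

/-- Only finitely many boundary points of a quadrature domain have the same exponential as some
other boundary point. -/
theorem IsBoundedQD.finite_double (hQ : IsBoundedQD Ω h) :
    {z ∈ frontier Ω | ∃ z' ∈ frontier Ω, z' ≠ z ∧ Complex.exp z' = Complex.exp z}.Finite := by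
  obtain ⟨p, hp, hpz⟩ := hQ.exists_irreducible
  have hb := hQ.domain.isBounded
  -- If p involved only the first variable, the boundary points would have finitely many real parts;
  -- but these include the real parts of all points of the open set Ω.
  have hdeg : p.natDegree ≠ 0 := by
    intro h0
    obtain ⟨a, rfl⟩ := natDegree_eq_zero.1 h0
    have ha : a ≠ 0 := by
      rintro rfl
      exact hp.ne_zero C_0
    refine infinite_re_image_frontier hQ.domain.isOpen hQ.domain.isConnected.nonempty hb
      (a.roots.toFinset.finite_toSet.subset ?_)
    rintro _ ⟨z, hz, rfl⟩
    have := hpz z hz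
    rw [evalEval_C] at this
    simpa [ha] using this
  have hbf : Bornology.IsBounded (frontier Ω) := hb.closure.subset frontier_subset_closure
  -- Only finitely many n ≠ 0 allow a boundary point translated by 2πin to lie on the bounded
  -- frontier; each contributes finitely many points.
  refine ((hbf.finite_int_translate.sdiff (t := {0})).biUnion fun n hn =>
    (finite_common_zeros_translate hp hdeg (t := n * (2 * Real.pi)) ?_).preimage
      (f := fun z : ℂ => (z.re, z.im)) ?_).subset ?_
  · have : (n : ℝ) ≠ 0 := by exact_mod_cast hn.2
    have := Real.pi_pos
    positivity
  · intro z _ w _ hzw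
    exact Complex.ext (congrArg Prod.fst hzw) (congrArg Prod.snd hzw)
  · rintro z ⟨hz, z', hz', hne, hexp⟩
    obtain ⟨n, rfl⟩ := Complex.exp_eq_exp_iff_exists_int.1 hexp
    refine mem_iUnion₂.2 ⟨n, ⟨⟨z, hz, hz'⟩, ?_⟩, hpz z hz, ?_⟩
    · rintro (rfl : n = 0)
      simp at hne
    · simpa using hpz _ hz'

end DoublePoints

/-! ### Topology of the image domain -/

section ExpImage

open Filter Topology

variable {Ω : Set ℂ} {h : RatFunc ℂ}

theorem Complex.eq_of_exp_eq_of_norm_lt {x y : ℂ} (h : Complex.exp x = Complex.exp y)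
    (hxy : ‖x - y‖ < 2 * Real.pi) : x = y := by
  obtain ⟨n, rfl⟩ := Complex.exp_eq_exp_iff_exists_int.1 h
  rw [add_sub_cancel_left, norm_mul, norm_mul, norm_mul, Complex.norm_I, Complex.norm_intCast,
    Complex.norm_real, Real.norm_of_nonneg Real.pi_pos.le, Complex.norm_two, mul_one] at hxy
  have h1 : |(n : ℝ)| < 1 := by nlinarith [Real.pi_pos]
  have h2 : n = 0 := Int.abs_lt_one_iff.1 (by exact_mod_cast h1)
  simp [h2]

theorem isOpen_exp_image (ho : IsOpen Ω) : IsOpen (Complex.exp '' Ω) :=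
  Complex.isOpenMap_exp Ω ho

theorem closure_exp_image (hb : Bornology.IsBounded Ω) :
    closure (Complex.exp '' Ω) = Complex.exp '' closure Ω :=
  (hb.isCompact_closure.image Complex.continuous_exp).isClosed.closure_eq ▸
    subset_antisymm (closure_mono (image_mono subset_closure))
      ((hb.isCompact_closure.image Complex.continuous_exp).isClosed.closure_eq.symm ▸
        image_closure_subset_closure_image Complex.continuous_exp)

/-- The translates of `Ω` by multiples of `2πi` are disjoint from the boundary. -/
theorem exp_notMem_exp_image (ho : IsOpen Ω) (hinj : InjOn Complex.exp Ω) {z : ℂ}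
    (hz : z ∈ frontier Ω) : Complex.exp z ∉ Complex.exp '' Ω := by
  rintro ⟨w, hw, hwz⟩
  obtain ⟨n, rfl⟩ := Complex.exp_eq_exp_iff_exists_int.1 hwz
  have h1 : Tendsto (fun u => u + n * (2 * Real.pi * Complex.I)) (𝓝 z)
    (𝓝 (z + n * (2 * Real.pi * Complex.I))) := tendsto_id.add_const _
  obtain ⟨u, hu, hu'⟩ := mem_closure_iff_nhds.1 hz.1 _ (h1 (ho.mem_nhds hw))
  have h2 := hinj hu hu' (Complex.exp_periodic.int_mul n u)
  have h3 : (n : ℂ) * (2 * Real.pi * Complex.I) = 0 := by simpa using h2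
  rw [h3, add_zero] at hw
  exact disjoint_left.1 (disjoint_frontier_iff_isOpen.2 ho) hz hw

theorem frontier_exp_image (ho : IsOpen Ω) (hb : Bornology.IsBounded Ω)
    (hinj : InjOn Complex.exp Ω) :
    frontier (Complex.exp '' Ω) = Complex.exp '' frontier Ω := by
  rw [(isOpen_exp_image ho).frontier_eq, closure_exp_image hb]
  ext w
  constructor
  · rintro ⟨⟨z, hz, rfl⟩, hw⟩
    exact ⟨z, ho.frontier_eq ▸ ⟨hz, fun hz' => hw ⟨z, hz', rfl⟩⟩, rfl⟩
  · rintro ⟨z, hz, rfl⟩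
    exact ⟨⟨z, hz.1, rfl⟩, exp_notMem_exp_image ho hinj hz⟩

/-- A boundary point near which `e^Ω` is dense is a double point. -/
theorem exists_exp_eq_of_mem_interior_closure (ho : IsOpen Ω) (hb : Bornology.IsBounded Ω)
    (hi : interior (closure Ω) = Ω) (hinj : InjOn Complex.exp Ω) {z : ℂ} (hz : z ∈ frontier Ω)
    (hw : Complex.exp z ∈ interior (closure (Complex.exp '' Ω))) :
    ∃ z' ∈ frontier Ω, z' ≠ z ∧ Complex.exp z' = Complex.exp z := by
  by_contra! hcon
  have hK : IsCompact (Complex.exp '' (closure Ω \ Metric.ball z Real.pi)) :=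
    (hb.isCompact_closure.diff Metric.isOpen_ball).image Complex.continuous_exp
  have hzK : Complex.exp z ∉ Complex.exp '' (closure Ω \ Metric.ball z Real.pi) := by
    rintro ⟨z', ⟨hz', hz'b⟩, hexp⟩
    refine hcon z' (ho.frontier_eq ▸ ⟨hz', fun hz'Ω => ?_⟩) ?_ hexp
    · exact exp_notMem_exp_image ho hinj hz ⟨z', hz'Ω, hexp⟩
    · rintro rfl
      exact hz'b (Metric.mem_ball_self Real.pi_pos)
  refine disjoint_left.1 (disjoint_frontier_iff_isOpen.2 ho) hz ?_
  rw [← hi, mem_interior_iff_mem_nhds]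
  filter_upwards [Complex.continuous_exp.continuousAt.preimage_mem_nhds
    (hK.isClosed.isOpen_compl.mem_nhds hzK),
    Complex.continuous_exp.continuousAt.preimage_mem_nhds (mem_interior_iff_mem_nhds.1 hw),
    Metric.ball_mem_nhds z Real.pi_pos] with u hu1 hu2 hu3
  rw [mem_preimage, closure_exp_image hb] at hu2
  obtain ⟨v, hv, hvu⟩ := hu2
  have hvb : v ∈ Metric.ball z Real.pi := by
    by_contra hvb
    exact hu1 ⟨v, ⟨hv, hvb⟩, hvu⟩
  rw [← Complex.eq_of_exp_eq_of_norm_lt hvu]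
  · exact hv
  · rw [← dist_eq_norm]
    have := dist_triangle_right v u z
    rw [Metric.mem_ball] at hvb hu3
    linarith

/-- Suppose e^z is in the interior of the closure but not in e^Ω. As double points are finite, a
small punctured disc about z maps into e^Ω, so it is covered by Ω and its translates by 2πin.
Injectivity makes Ω disjoint from the others, and the punctured disc is connected and meets Ω, so it
lies in Ω. Then z ∈ Int Cl Ω = Ω, a contradiction. -/
theorem interior_closure_exp_image (ho : IsOpen Ω) (hb : Bornology.IsBounded Ω)
    (hi : interior (closure Ω) = Ω) (hinj : InjOn Complex.exp Ω)
    (hfin : {z ∈ frontier Ω | ∃ z' ∈ frontier Ω, z' ≠ z ∧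
      Complex.exp z' = Complex.exp z}.Finite) :
    interior (closure (Complex.exp '' Ω)) = Complex.exp '' Ω := by
  refine subset_antisymm (fun w hw => ?_)
    (interior_maximal subset_closure (isOpen_exp_image ho))
  have hwc := interior_subset hw
  rw [closure_exp_image hb] at hwc
  obtain ⟨z, hz, rfl⟩ := hwc
  by_contra hzU
  have hzf : z ∈ frontier Ω := ho.frontier_eq ▸ ⟨hz, fun hz' => hzU ⟨z, hz', rfl⟩⟩
  set E := Complex.exp '' {z ∈ frontier Ω | ∃ z' ∈ frontier Ω, z' ≠ z ∧
      Complex.exp z' = Complex.exp z}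
  have hE : (E \ {Complex.exp z}).Finite := (hfin.image _).sdiff
  have hnhds : ∀ᶠ u in 𝓝 z, Complex.exp u ∈ interior (closure (Complex.exp '' Ω)) ∧
      Complex.exp u ∉ E \ {Complex.exp z} :=
    (Complex.continuous_exp.continuousAt.eventually (isOpen_interior.mem_nhds hw)).and
      (Complex.continuous_exp.continuousAt.eventually
        (hE.isClosed.isOpen_compl.mem_nhds fun h => h.2 rfl))
  obtain ⟨r, hr, hball⟩ := Metric.eventually_nhds_iff_ball.1
    (hnhds.and (Metric.ball_mem_nhds z Real.two_pi_pos))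
  have hsub : Metric.ball z r \ {z} ⊆ Ω ∪ ⋃ n : {n : ℤ // n ≠ 0},
      (fun u => u + n * (2 * Real.pi * Complex.I)) ⁻¹' Ω := by
    rintro u ⟨hu, huz⟩
    obtain ⟨⟨h1, h2⟩, h3⟩ := hball u hu
    have hexp : Complex.exp u ∈ Complex.exp '' Ω := by
      by_contra hcon
      have h4 := interior_subset h1
      rw [closure_exp_image hb] at h4
      obtain ⟨v, hv, hvu⟩ := h4
      have hvf : v ∈ frontier Ω := ho.frontier_eq ▸ ⟨hv, fun hv' => hcon ⟨v, hv', hvu⟩⟩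
      refine h2 ⟨⟨v, ⟨hvf, ?_⟩, hvu⟩, fun h5 => huz ?_⟩
      · exact exists_exp_eq_of_mem_interior_closure ho hb hi hinj hvf (hvu ▸ h1)
      · exact Complex.eq_of_exp_eq_of_norm_lt h5 (dist_eq_norm u z ▸ h3)
    obtain ⟨v, hv, hvu⟩ := hexp
    obtain ⟨n, rfl⟩ := Complex.exp_eq_exp_iff_exists_int.1 hvu
    by_cases hn : n = 0
    · left
      simpa [hn] using hv
    · right
      exact mem_iUnion.2 ⟨⟨n, hn⟩, hv⟩
  -- The punctured disc is the image of a strip under polar coordinates.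
  have hconn : IsPreconnected (Metric.ball z r \ {z}) := by
    have himg : (fun p : ℝ × ℝ => z + p.1 * Complex.exp (p.2 * Complex.I)) '' (Ioo 0 r ×ˢ univ) =
        Metric.ball z r \ {z} := by
      ext u
      constructor
      · rintro ⟨⟨t, θ⟩, ⟨ht, -⟩, rfl⟩
        refine ⟨?_, ?_⟩
        · rw [Metric.mem_ball, dist_eq_norm, add_sub_cancel_left, norm_mul,
            Complex.norm_exp_ofReal_mul_I, mul_one, Complex.norm_real, Real.norm_of_nonneg ht.1.le]
          exact ht.2
        · simpa [Complex.exp_ne_zero] using ht.1.ne'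
      · rintro ⟨hu, huz⟩
        refine ⟨(‖u - z‖, Complex.arg (u - z)), ⟨⟨norm_pos_iff.2 (sub_ne_zero.2 huz), ?_⟩, trivial⟩, ?_⟩
        · rwa [← dist_eq_norm]
        · simp only [Complex.norm_mul_exp_arg_mul_I]
          ring
    rw [← himg]
    exact (isPreconnected_Ioo.prod isPreconnected_univ).image _ (by fun_prop)
  have hBΩ : Metric.ball z r \ {z} ⊆ Ω := by
    refine hconn.subset_left_of_subset_union ho
      (isOpen_iUnion fun n => ho.preimage (by fun_prop)) ?_ hsub ?_
    · rw [disjoint_iUnion_right]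
      rintro ⟨n, hn⟩
      refine disjoint_left.2 fun u hu hu' => hn ?_
      have h2 := hinj hu hu' (Complex.exp_periodic.int_mul n u).symm
      simpa [Real.pi_ne_zero, Complex.I_ne_zero] using h2
    · obtain ⟨u, hu, huΩ⟩ := mem_closure_iff_nhds.1 hz _ (Metric.ball_mem_nhds z hr)
      exact ⟨u, ⟨hu, fun (h : u = z) => hzU ⟨u, huΩ, h ▸ rfl⟩⟩, huΩ⟩
  refine disjoint_left.1 (disjoint_frontier_iff_isOpen.2 ho) hzf ?_
  rw [← hi, mem_interior_iff_mem_nhds]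
  filter_upwards [Metric.ball_mem_nhds z hr] with u hu
  by_cases huz : u = z
  · rwa [huz]
  · exact subset_closure (hBΩ ⟨hu, huz⟩)

end ExpImage

/-! ### The image contour and its winding numbers -/

section ExpContour

open Filter Topology

variable {Ω : Set ℂ} {h : RatFunc ℂ}

namespace RectifiableContour

/-- The image of a contour under the exponential function. -/
noncomputable def expImage (Γ : RectifiableContour) : RectifiableContour where
  n := Γ.n
  base j := Complex.exp (Γ.base j)
  curve j := (Γ.curve j).map Complex.continuous_exp
  lipschitz j := by
    obtain ⟨K, hK⟩ := exists_lipschitzOnWith_comp_pos (Γ := Γ) isOpen_univ (subset_univ _)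
      Complex.differentiable_exp.differentiableOn j
    refine ⟨K, fun s t => ?_⟩
    have := hK s.2 t.2
    simp only [pos, Path.extend_apply _ s.2, Path.extend_apply _ t.2] at this
    exact this

theorem trace_expImage (Γ : RectifiableContour) : Γ.expImage.trace = Complex.exp '' Γ.trace := by
  simp only [trace, image_iUnion, ← range_comp]
  rfl

theorem integral_expImage (Γ : RectifiableContour) (g : ℂ → ℂ) :
    Γ.expImage.integral g = Γ.integral fun z => g (Complex.exp z) * Complex.exp z := by
  rw [integral_eq, integral_eq]
  congr 1
  refine Finset.sum_congr rfl fun j _ => intervalIntegral.integral_congr_ae ?_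
  filter_upwards [Γ.ae_hasDerivAt_pos j] with t ht _
  have h1 : Γ.expImage.vel j t = Complex.exp (Γ.pos j t) * Γ.vel j t := ht.cexp.deriv
  rw [h1, mul_assoc]
  rfl

end RectifiableContour

theorem differentiable_dslope_exp (p : ℂ) : Differentiable ℂ (dslope Complex.exp p) := by
  rw [← differentiableOn_univ, Complex.differentiableOn_dslope univ_mem]
  exact Complex.differentiable_exp.differentiableOn

theorem exp_sub_exp_eq (p z : ℂ) :
    Complex.exp z - Complex.exp p = (z - p) * dslope Complex.exp p z :=
  (sub_smul_dslope Complex.exp p z).symm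

theorem exp_ne_exp (ho : IsOpen Ω) (hinj : InjOn Complex.exp Ω) {p z : ℂ} (hp : p ∈ Ω)
    (hz : z ∈ closure Ω) (hzp : z ≠ p) : Complex.exp z ≠ Complex.exp p := by
  intro h0
  by_cases hzΩ : z ∈ Ω
  · exact hzp (hinj hzΩ hp h0)
  · exact exp_notMem_exp_image ho hinj (ho.frontier_eq ▸ ⟨hz, hzΩ⟩) ⟨p, hp, h0.symm⟩

/-- The difference quotient (e^z - e^p)/(z - p) cannot vanish: injectivity, extended to boundary
points z, excludes z ≠ p, and at z = p its value is e^p. -/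
theorem dslope_exp_ne_zero (ho : IsOpen Ω) (hinj : InjOn Complex.exp Ω) {p z : ℂ} (hp : p ∈ Ω)
    (hz : z ∈ closure Ω) : dslope Complex.exp p z ≠ 0 := by
  by_cases hzp : z = p
  · rw [hzp, dslope_same, Complex.deriv_exp]
    exact Complex.exp_ne_zero p
  · intro h0
    have := exp_sub_exp_eq p z
    rw [h0, mul_zero] at this
    exact exp_ne_exp ho hinj hp hz hzp (sub_eq_zero.1 this)

namespace AnalyticClass

variable {f g : ℂ → ℂ}

theorem mul (hf : f ∈ AnalyticClass Ω) (hg : g ∈ AnalyticClass Ω) :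
    (fun z => f z * g z) ∈ AnalyticClass Ω := ⟨hf.1.mul hg.1, hf.2.mul hg.2⟩

theorem div (hf : f ∈ AnalyticClass Ω) (hg : g ∈ AnalyticClass Ω) (h0 : ∀ z ∈ closure Ω, g z ≠ 0) :
    (fun z => f z / g z) ∈ AnalyticClass Ω :=
  ⟨hf.1.div hg.1 fun z hz => h0 z (subset_closure hz), hf.2.div hg.2 h0⟩

theorem of_differentiable (hf : Differentiable ℂ f) : f ∈ AnalyticClass Ω :=
  ⟨hf.differentiableOn, hf.continuous.continuousOn⟩

theorem dslope (ho : IsOpen Ω) (hf : f ∈ AnalyticClass Ω) {p : ℂ} (hp : p ∈ Ω) :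
    dslope f p ∈ AnalyticClass Ω :=
  ⟨(Complex.differentiableOn_dslope (ho.mem_nhds hp)).2 hf.1,
    (continuousOn_dslope (Filter.mem_of_superset (ho.mem_nhds hp) subset_closure)).2
      ⟨hf.2, hf.1.differentiableAt (ho.mem_nhds hp)⟩⟩

end AnalyticClass

/-- Pulled back by exp, the winding number about w is ∮ e^z/(e^z - w) dz. For exterior w the
integrand is in A(Ω). For w = e^p it differs from 1/(z - p) by a function in A(Ω), as its residue at
the only pole p is 1. -/
theorem RectifiableContour.IsBoundaryOf.expImage {Γ : RectifiableContour} (hΓ : Γ.IsBoundaryOf Ω)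
    (ho : IsOpen Ω) (hb : Bornology.IsBounded Ω) (hinj : InjOn Complex.exp Ω) :
    Γ.expImage.IsBoundaryOf (Complex.exp '' Ω) where
  trace_eq := by rw [trace_expImage, hΓ.trace_eq, frontier_exp_image ho hb hinj]
  winding_outside w hw := by
    rw [windingNumber, integral_expImage]
    rw [closure_exp_image hb] at hw
    have := hΓ.integral_eq_zero hb (AnalyticClass.div
      (AnalyticClass.of_differentiable Complex.differentiable_exp)
      (AnalyticClass.of_differentiable (Complex.differentiable_exp.sub_const w))
      fun z hz h0 => hw ⟨z, hz, sub_eq_zero.1 h0⟩)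
    rw [← this]
    exact Γ.integral_congr fun z _ => by rw [div_eq_mul_inv, mul_comm]
  winding_inside w hw := by
    obtain ⟨p, hp, rfl⟩ := hw
    rw [windingNumber, integral_expImage]
    have hG : (fun z => Complex.exp z / dslope Complex.exp p z) ∈ AnalyticClass Ω :=
      AnalyticClass.div (AnalyticClass.of_differentiable Complex.differentiable_exp)
        (AnalyticClass.of_differentiable (differentiable_dslope_exp p))
        fun z hz => dslope_exp_ne_zero ho hinj hp hz
    have hD := AnalyticClass.dslope ho hG hp
    have hpT := hΓ.notMem_trace ho hp
    have hT : Γ.trace ⊆ closure Ω := hΓ.trace_eq ▸ frontier_subset_closure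
    rw [Γ.integral_congr (g := fun z => (z - p)⁻¹ +
      dslope (fun z => Complex.exp z / dslope Complex.exp p z) p z),
      Γ.integral_add (continuousOn_sub_inv hpT) (hD.2.mono hT), hΓ.integral_eq_zero hb hD, add_zero]
    · exact hΓ.winding_inside p hp
    · intro z hz
      have hzp : z ≠ p := fun h => hpT (h ▸ hz)
      have hzp' : z - p ≠ 0 := sub_ne_zero.2 hzp
      have hE := dslope_exp_ne_zero ho hinj hp (hT hz)
      have h1 := exp_sub_exp_eq p z
      have h2 := sub_smul_dslope (fun z => Complex.exp z / dslope Complex.exp p z) p z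
      rw [smul_eq_mul, dslope_same, Complex.deriv_exp, div_self (Complex.exp_ne_zero p)] at h2
      beta_reduce
      rw [h1]
      refine mul_left_cancel₀ hzp' ?_
      rw [mul_add, h2, mul_inv_cancel₀ hzp']
      field_simp
      ring

end ExpContour

/-! ### The quadrature function of the image -/

section Pushforward

open Polynomial

variable {Ω : Set ℂ} {h : RatFunc ℂ}

/-- A rational function given by coprime polynomials, the denominator being monic. -/
theorem RatFunc.num_denom_of_coprime {K : Type*} [Field K] {p q : K[X]} (hq : q.Monic)
    (hpq : IsCoprime p q) :
    (algebraMap K[X] (RatFunc K) p / algebraMap K[X] (RatFunc K) q).num = p ∧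
      (algebraMap K[X] (RatFunc K) p / algebraMap K[X] (RatFunc K) q).denom = q := by
  set x := algebraMap K[X] (RatFunc K) p / algebraMap K[X] (RatFunc K) q with hx
  have h1 : x.num * q = p * x.denom := (RatFunc.num_mul_eq_mul_denom_iff hq.ne_zero).2 hx
  have h2 : q ∣ x.denom := hpq.symm.dvd_of_dvd_mul_left ⟨x.num, by rw [← h1, mul_comm]⟩
  have h3 : x.denom = q :=
    eq_of_monic_of_associated (RatFunc.monic_denom x) hq
      (associated_of_dvd_dvd (RatFunc.denom_div_dvd p q) h2)
  rw [h3] at h1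
  exact ⟨mul_right_cancel₀ hq.ne_zero h1, h3⟩

/-- Newton division in the variable `e^z`. -/
theorem exists_eq_eval_exp_add (ho : IsOpen Ω) (hinj : InjOn Complex.exp Ω) (s : Multiset ℂ)
    (hs : ∀ p ∈ s, p ∈ Ω) {g : ℂ → ℂ} (hg : g ∈ AnalyticClass Ω) :
    ∃ N : ℂ[X], N.degree < Multiset.card s ∧ ∃ r ∈ AnalyticClass Ω, ∀ z ∈ closure Ω,
      g z = N.eval (Complex.exp z) +
        ((s.map Complex.exp).map fun p => X - C p).prod.eval (Complex.exp z) * r z := by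
  induction s using Multiset.induction_on with
  | empty => exact ⟨0, by simp, g, hg, by simp⟩
  | cons a s ih =>
    obtain ⟨N, hN, r, hr, hgr⟩ := ih fun p hp => hs p (by simp [hp])
    have ha : a ∈ Ω := hs a (by simp)
    refine ⟨N + C (r a) * ((s.map Complex.exp).map fun p => X - C p).prod, ?_,
      fun z => dslope r a z / dslope Complex.exp a z,
      AnalyticClass.div (AnalyticClass.dslope ho hr ha)
        (AnalyticClass.of_differentiable (differentiable_dslope_exp a))
        fun z hz => dslope_exp_ne_zero ho hinj ha hz, fun z hz => ?_⟩
    · rw [Multiset.card_cons]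
      refine (degree_add_le _ _).trans_lt (max_lt (hN.trans (by exact_mod_cast Nat.lt_succ_self _)) ?_)
      refine (degree_le_natDegree.trans (Nat.cast_le.2 (natDegree_C_mul_le _ _))).trans_lt ?_
      rw [natDegree_multiset_prod_X_sub_C_eq_card, Multiset.card_map]
      exact_mod_cast Nat.lt_succ_self _
    · have h1 := sub_smul_dslope r a z
      rw [smul_eq_mul] at h1
      have h2 := dslope_exp_ne_zero ho hinj ha hz
      -- One Newton step with node e^a: the quotient by e^z - e^a remains in A(Ω) because the
      -- difference quotient of exp has no zeros on the closure.
      have h3 : r z = r a + (Complex.exp z - Complex.exp a) *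
          (dslope r a z / dslope Complex.exp a z) := by
        rw [exp_sub_exp_eq, mul_assoc, mul_div_cancel₀ _ h2, h1]
        ring
      rw [hgr z hz]
      simp only [Multiset.map_cons, Multiset.prod_cons, eval_add, eval_mul, eval_sub, eval_X, eval_C]
      conv_lhs => rw [h3]
      ring

/-- The quadrature function of the image: a rational function of `e^z` with the same principal
parts as `h(z) e^{-z}`. -/
theorem IsRatZero.exists_pushforward (ho : IsOpen Ω) (hinj : InjOn Complex.exp Ω)
    (hh : IsRatZero Ω h) :
    ∃ h' : RatFunc ℂ, IsRatZero (Complex.exp '' Ω) h' ∧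
      ratPoles h' = (ratPoles h).map Complex.exp ∧
      ∃ r ∈ AnalyticClass Ω, ∀ z ∈ frontier Ω,
        ratEval h z = ratEval h' (Complex.exp z) * Complex.exp z + Complex.exp z * r z := by
  set s := ratPoles h with hs
  -- E is the zero-free factor by which ∏(e^z - e^p) differs from the denominator ∏(z - p) of h.
  let E : ℂ → ℂ := fun z => (s.map fun p => dslope Complex.exp p z).prod
  have hE : Differentiable ℂ E := by
    change Differentiable ℂ fun z => (s.map fun p => dslope Complex.exp p z).prod
    generalize s = t
    induction t using Multiset.induction_on with
    | empty => simp
    | cons a t ih =>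
      simp only [Multiset.map_cons, Multiset.prod_cons]
      exact (differentiable_dslope_exp a).mul ih
  have hE0 : ∀ z ∈ closure Ω, E z ≠ 0 := fun z hz => Multiset.prod_ne_zero fun h0 => by
    obtain ⟨p, hp, hp0⟩ := Multiset.mem_map.1 h0
    exact dslope_exp_ne_zero ho hinj (hh.1 p hp) hz hp0
  let q : ℂ[X] := ((s.map Complex.exp).map fun p => X - C p).prod
  have hqm : q.Monic := monic_multiset_prod_of_monic _ _ fun p _ => monic_X_sub_C p
  have hqE : ∀ z, q.eval (Complex.exp z) = h.denom.eval z * E z := by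
    intro z
    rw [← prod_ratPoles, eval_multiset_prod, eval_multiset_prod, Multiset.map_map, Multiset.map_map,
      Multiset.map_map, ← Multiset.prod_map_mul]
    congr 1
    refine Multiset.map_congr rfl fun p _ => ?_
    simp [exp_sub_exp_eq]
  have hg : (fun z => h.num.eval z * E z * Complex.exp (-z)) ∈ AnalyticClass Ω :=
    AnalyticClass.of_differentiable ((h.num.differentiable.mul hE).mul
      (Complex.differentiable_exp.comp differentiable_neg))
  obtain ⟨N, hN, r, hr, hgr⟩ := exists_eq_eval_exp_add ho hinj s hh.1 hg
  have hroots : q.roots = s.map Complex.exp := roots_multiset_prod_X_sub_C _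
  -- At a pole p the value N(e^p) equals num(p) E(p) e^(-p), which is nonzero since num and denom
  -- are coprime. No pole cancels, so multiplicities are preserved.
  have hcop : IsCoprime N q := by
    refine (isCoprime_iff_aeval_ne_zero_of_isAlgClosed ℂ ℂ N q).2 fun w => ?_
    by_contra! hw
    rw [coe_aeval_eq_eval] at hw
    have hwq : w ∈ q.roots := (mem_roots hqm.ne_zero).2 hw.2
    rw [hroots] at hwq
    obtain ⟨p, hp, rfl⟩ := Multiset.mem_map.1 hwq
    have hpc := subset_closure (hh.1 p hp)
    have h1 := hgr p hpc
    change _ = _ + q.eval (Complex.exp p) * r p at h1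
    rw [hw.1, hw.2, zero_mul, add_zero] at h1
    have hnp : h.num.eval p = 0 := by simpa [hE0 p hpc, Complex.exp_ne_zero] using h1
    have hdp : h.denom.eval p = 0 := (mem_roots h.denom_ne_zero).1 hp
    obtain ⟨a, b, hab⟩ := h.isCoprime_num_denom
    simpa [hnp, hdp] using congrArg (eval p) hab
  obtain ⟨hnum, hden⟩ := RatFunc.num_denom_of_coprime hqm hcop
  set h' := algebraMap ℂ[X] (RatFunc ℂ) N / algebraMap ℂ[X] (RatFunc ℂ) q
  have hpoles : ratPoles h' = s.map Complex.exp := by rw [ratPoles, hden, hroots]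
  refine ⟨h', ⟨?_, ?_⟩, hpoles, r, hr, fun z hz => ?_⟩
  · rw [hpoles]
    intro w hw
    obtain ⟨p, hp, rfl⟩ := Multiset.mem_map.1 hw
    exact ⟨p, hh.1 p hp, rfl⟩
  · rw [hnum, hden, degree_eq_natDegree hqm.ne_zero, natDegree_multiset_prod_X_sub_C_eq_card,
      Multiset.card_map]
    exact hN
  · have hzc := frontier_subset_closure hz
    have hdz : h.denom.eval z ≠ 0 :=
      hh.denom_eval_ne_zero (disjoint_left.1 (disjoint_frontier_iff_isOpen.2 ho) hz)
    have h1 := hgr z hzc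
    change _ = _ + q.eval (Complex.exp z) * r z at h1
    have hE0z := hE0 z hzc
    have hq0 : q.eval (Complex.exp z) ≠ 0 := by rw [hqE]; exact mul_ne_zero hdz hE0z
    rw [ratEval_eq, ratEval_eq, hnum, hden]
    have h2 : h.num.eval z * E z = (N.eval (Complex.exp z) + q.eval (Complex.exp z) * r z) *
        Complex.exp z := by
      rw [← h1, mul_assoc _ (Complex.exp (-z)), ← Complex.exp_add, neg_add_cancel, Complex.exp_zero,
        mul_one]
    have h3 : h.num.eval z / h.denom.eval z =
        (h.num.eval z * E z) / q.eval (Complex.exp z) := by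
      rw [hqE, mul_div_mul_right _ _ hE0z]
    rw [h3, h2]
    field_simp

end Pushforward

/-! ### Integrands with finitely many discontinuities -/

section FiniteDiscontinuities

open Filter Topology

variable {D : Set ℂ}

/-- Contour integrals of bounded functions with finitely many discontinuities depend only on the
domain. -/
theorem RectifiableContour.IsBoundaryOf.integral_eq_integral_of_bounded {Γ Γ' : RectifiableContour}
    (hΓ : Γ.IsBoundaryOf D) (hΓ' : Γ'.IsBoundaryOf D) {s : Set ℂ} (hs : s.Finite) {f : ℂ → ℂ}
    (hf : ContinuousOn f (frontier D \ s)) {M : ℝ} (hM : ∀ z ∈ frontier D, ‖f z‖ ≤ M) :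
    Γ.integral f = Γ'.integral f := by
  rcases s.eq_empty_or_nonempty with rfl | hne
  · exact hΓ.integral_eq_integral hΓ' (by simpa using hf)
  -- Cutoffs that vanish on s, so that χₙf is continuous for bounded f, and that tend to 1 off s.
  let χ : ℕ → ℂ → ℝ := fun n z => min 1 (n * Metric.infDist z s)
  have hχc : ∀ n, Continuous (χ n) := fun n =>
    continuous_const.min (continuous_const.mul (Metric.continuous_infDist_pt s))
  have hχ0 : ∀ n z, 0 ≤ χ n z := fun n z =>
    le_min zero_le_one (mul_nonneg n.cast_nonneg Metric.infDist_nonneg)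
  have hχs : ∀ n, ∀ z ∈ s, χ n z = 0 := fun n z hz => by
    simp [χ, Metric.infDist_zero_of_mem hz]
  have hcont : ∀ n, ContinuousOn (fun z => (χ n z : ℂ) * f z) (frontier D) := by
    intro n z hz
    by_cases hzs : z ∈ s
    · rw [ContinuousWithinAt, hχs n z hzs, Complex.ofReal_zero, zero_mul]
      refine squeeze_zero_norm' (a := fun z => χ n z * M) ?_ ?_
      · filter_upwards [self_mem_nhdsWithin] with w hw
        rw [norm_mul, Complex.norm_real, Real.norm_of_nonneg (hχ0 n w)]
        exact mul_le_mul_of_nonneg_left (hM w hw) (hχ0 n w)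
      · have := ((hχc n).mul_const M).tendsto z
        rw [hχs n z hzs, zero_mul] at this
        exact this.mono_left nhdsWithin_le_nhds
    · refine (Complex.continuous_ofReal.comp (hχc n)).continuousWithinAt.mul ?_
      refine (hf z ⟨hz, hzs⟩).mono_of_mem_nhdsWithin ?_
      exact inter_mem self_mem_nhdsWithin
        (mem_nhdsWithin_of_mem_nhds (hs.isClosed.isOpen_compl.mem_nhds hzs))
  have hbound : ∀ n, ∀ z ∈ frontier D, ‖(χ n z : ℂ) * f z‖ ≤ M := by
    intro n z hz
    rw [norm_mul, Complex.norm_real, Real.norm_of_nonneg (hχ0 n z)]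
    exact (mul_le_of_le_one_left (norm_nonneg _) (min_le_left _ _)).trans (hM z hz)
  have hlim : ∀ z ∈ frontier D \ s, Tendsto (fun n => (χ n z : ℂ) * f z) atTop (𝓝 (f z)) := by
    rintro z ⟨-, hzs⟩
    have hpos : 0 < Metric.infDist z s := (hs.isClosed.notMem_iff_infDist_pos hne).1 hzs
    obtain ⟨N, hN⟩ := exists_nat_ge (1 / Metric.infDist z s)
    refine tendsto_const_nhds.congr' ?_
    filter_upwards [eventually_ge_atTop N] with n hn
    have h1 : 1 ≤ n * Metric.infDist z s := by
      rw [← div_le_iff₀ hpos]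
      exact hN.trans (by exact_mod_cast hn)
    simp [χ, min_eq_left h1]
  refine tendsto_nhds_unique (Γ.tendsto_integral_of_dominated hs M (hΓ.trace_eq ▸ hcont)
    (hΓ.trace_eq ▸ hbound) (hΓ.trace_eq ▸ hlim)) ?_
  refine (Γ'.tendsto_integral_of_dominated hs M (hΓ'.trace_eq ▸ hcont)
    (hΓ'.trace_eq ▸ hbound) (hΓ'.trace_eq ▸ hlim)).congr fun n => ?_
  exact hΓ'.integral_eq_integral hΓ (hcont n)

end FiniteDiscontinuities

/-! ### Transfer of the quadrature identity and the Cauchy projection -/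

section ExpTransform

open Filter Topology

variable {Ω : Set ℂ} {h h' : RatFunc ℂ}

theorem IsBoundedQD.exp_image_domain (hQ : IsBoundedQD Ω h) (hinj : InjOn Complex.exp Ω) :
    IsBoundedRectifiableDomain (Complex.exp '' Ω) where
  isOpen := isOpen_exp_image hQ.domain.isOpen
  isConnected := hQ.domain.isConnected.image _ Complex.continuous_exp.continuousOn
  isBounded := (hQ.domain.isBounded.isCompact_closure.image Complex.continuous_exp).isBounded.subset
    (image_mono subset_closure)
  interior_closure := interior_closure_exp_image hQ.domain.isOpen hQ.domain.isBounded
    hQ.domain.interior_closure hinj hQ.finite_double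
  rectifiable := by
    obtain ⟨Γ, hΓ⟩ := hQ.domain.rectifiable
    exact ⟨Γ.expImage, hΓ.expImage hQ.domain.isOpen hQ.domain.isBounded hinj⟩

theorem zero_notMem_closure_exp_image (hb : Bornology.IsBounded Ω) :
    (0 : ℂ) ∉ closure (Complex.exp '' Ω) := by
  rw [closure_exp_image hb]
  rintro ⟨z, -, hz⟩
  exact Complex.exp_ne_zero z hz

/-- Change of variables `w = e^z` in area integrals. -/
theorem areaIntegral_exp_image (ho : IsOpen Ω) (hinj : InjOn Complex.exp Ω) (f : ℂ → ℂ) :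
    areaIntegral (Complex.exp '' Ω) (fun w => f w / (‖w‖ : ℂ) ^ 2) =
      areaIntegral Ω fun z => f (Complex.exp z) := by
  unfold areaIntegral
  congr 1
  have hd : ∀ z ∈ Ω, HasFDerivWithinAt Complex.exp
      ((ContinuousLinearMap.toSpanSingleton ℂ (Complex.exp z)).restrictScalars ℝ) Ω z := fun z _ =>
    ((Complex.hasDerivAt_exp z).hasFDerivAt.restrictScalars ℝ).hasFDerivWithinAt
  rw [integral_image_eq_integral_abs_det_fderiv_smul volume ho.measurableSet hd hinj]
  refine setIntegral_congr_fun ho.measurableSet fun z _ => ?_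
  -- The real Jacobian of exp is |e^z|², which cancels the weight exactly.
  have hdet : ((ContinuousLinearMap.toSpanSingleton ℂ (Complex.exp z)).restrictScalars ℝ).det =
      ‖Complex.exp z‖ ^ 2 := by
    simp [ContinuousLinearMap.det, LinearMap.det_restrictScalars, Algebra.norm_complex_eq,
      Complex.normSq_eq_norm_sq]
  have hne : (‖Complex.exp z‖ : ℂ) ≠ 0 := by
    exact_mod_cast (norm_pos_iff.2 (Complex.exp_ne_zero z)).ne'
  rw [hdet, abs_of_nonneg (by positivity), Complex.real_smul]
  push_cast
  field_simp

theorem AnalyticClass.comp_exp (hb : Bornology.IsBounded Ω) {f : ℂ → ℂ}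
    (hf : f ∈ AnalyticClass (Complex.exp '' Ω)) :
    (fun z => f (Complex.exp z)) ∈ AnalyticClass Ω :=
  ⟨hf.1.comp Complex.differentiable_exp.differentiableOn (mapsTo_image _ _),
    hf.2.comp Complex.continuous_exp.continuousOn fun z hz => by
      rw [closure_exp_image hb]
      exact ⟨z, hz, rfl⟩⟩

/-- Replace `h(z)` by `h'(e^z) e^z` under the contour integral: the difference is analytic. -/
theorem integral_comp_exp_mul_ratEval {Γ : RectifiableContour} (hΓ : Γ.IsBoundaryOf Ω)
    (ho : IsOpen Ω) (hb : Bornology.IsBounded Ω) (hinj : InjOn Complex.exp Ω)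
    (hh' : IsRatZero (Complex.exp '' Ω) h') {r : ℂ → ℂ} (hr : r ∈ AnalyticClass Ω)
    (hhr : ∀ z ∈ frontier Ω,
      ratEval h z = ratEval h' (Complex.exp z) * Complex.exp z + Complex.exp z * r z)
    {f : ℂ → ℂ} (hf : f ∈ AnalyticClass (Complex.exp '' Ω)) :
    Γ.integral (fun z => f (Complex.exp z) * ratEval h z) =
      Γ.expImage.integral fun w => f w * ratEval h' w := by
  have hT : Γ.trace ⊆ closure Ω := hΓ.trace_eq ▸ frontier_subset_closure
  have hfe := AnalyticClass.comp_exp hb hf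
  have hR : (fun z => f (Complex.exp z) * (Complex.exp z * r z)) ∈ AnalyticClass Ω :=
    AnalyticClass.mul hfe
      (AnalyticClass.mul (AnalyticClass.of_differentiable Complex.differentiable_exp) hr)
  have hc : ContinuousOn (fun z => f (Complex.exp z) * ratEval h' (Complex.exp z) * Complex.exp z)
      Γ.trace := by
    refine ((hfe.2.mono hT).mul (hh'.continuousOn.comp Complex.continuous_exp.continuousOn
      fun z hz => ?_)).mul Complex.continuous_exp.continuousOn
    rw [hΓ.trace_eq] at hz
    exact exp_notMem_exp_image ho hinj hz
  rw [RectifiableContour.integral_expImage]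
  rw [Γ.integral_congr (g := fun z =>
      f (Complex.exp z) * ratEval h' (Complex.exp z) * Complex.exp z +
        f (Complex.exp z) * (Complex.exp z * r z)),
    Γ.integral_add hc (hR.2.mono hT), hΓ.integral_eq_zero hb hR, add_zero]
  intro z hz
  beta_reduce
  rw [hhr z (hΓ.trace_eq ▸ hz)]
  ring

theorem IsBoundedQD.exp_image_quadrature (hQ : IsBoundedQD Ω h) (hinj : InjOn Complex.exp Ω)
    (hh' : IsRatZero (Complex.exp '' Ω) h') {r : ℂ → ℂ} (hr : r ∈ AnalyticClass Ω)
    (hhr : ∀ z ∈ frontier Ω,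
      ratEval h z = ratEval h' (Complex.exp z) * Complex.exp z + Complex.exp z * r z)
    {Γ : RectifiableContour} (hΓ : Γ.IsBoundaryOf (Complex.exp '' Ω)) {f : ℂ → ℂ}
    (hf : f ∈ AnalyticClass (Complex.exp '' Ω)) :
    areaIntegral (Complex.exp '' Ω) (fun w => f w / (‖w‖ : ℂ) ^ 2) =
      Γ.integral fun w => f w * ratEval h' w := by
  have ho := hQ.domain.isOpen
  have hb := hQ.domain.isBounded
  obtain ⟨Γ₀, hΓ₀⟩ := hQ.domain.rectifiable
  rw [areaIntegral_exp_image ho hinj, hQ.quadrature Γ₀ hΓ₀ _ (AnalyticClass.comp_exp hb hf),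
    integral_comp_exp_mul_ratEval hΓ₀ ho hb hinj hh' hr hhr hf]
  refine (hΓ₀.expImage ho hb hinj).integral_eq_integral hΓ
    ((hf.2.mono frontier_subset_closure).mul (hh'.continuousOn.mono fun z hz => ?_))
  exact disjoint_left.1 (disjoint_frontier_iff_isOpen.2 (isOpen_exp_image ho)) hz

theorem IsLogInto.mem_frontier {ℓ : ℂ → ℂ} (hℓ : IsLogInto Ω ℓ) (ho : IsOpen Ω) {w : ℂ}
    (hw : w ∈ frontier (Complex.exp '' Ω)) : ℓ w ∈ frontier Ω ∧ Complex.exp (ℓ w) = w := by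
  obtain ⟨h1, h2⟩ := hℓ w (frontier_subset_closure hw)
  refine ⟨ho.frontier_eq ▸ ⟨h1, fun h3 => ?_⟩, h2⟩
  exact disjoint_left.1 (disjoint_frontier_iff_isOpen.2 (isOpen_exp_image ho)) hw ⟨_, h3, h2⟩

/-- Where the logarithm on the boundary is unique, compactness suffices: boundary points of Ω
outside a disc about ℓ(w) have a compact image missing w. -/
theorem IsLogInto.continuousOn {ℓ : ℂ → ℂ} (hℓ : IsLogInto Ω ℓ) (ho : IsOpen Ω)
    (hb : Bornology.IsBounded Ω) :
    ContinuousOn ℓ (frontier (Complex.exp '' Ω) \ Complex.exp '' {z ∈ frontier Ω |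
      ∃ z' ∈ frontier Ω, z' ≠ z ∧ Complex.exp z' = Complex.exp z}) := by
  rintro w ⟨hw, hwd⟩
  obtain ⟨h1, h2⟩ := hℓ.mem_frontier ho hw
  have hc : IsCompact (frontier Ω) := hb.isCompact_closure.of_isClosed_subset isClosed_frontier
    frontier_subset_closure
  refine Metric.nhds_basis_ball.tendsto_right_iff.2 fun ε hε => ?_
  have hK : IsCompact (Complex.exp '' (frontier Ω \ Metric.ball (ℓ w) ε)) :=
    (hc.diff Metric.isOpen_ball).image Complex.continuous_exp
  have hwK : w ∉ Complex.exp '' (frontier Ω \ Metric.ball (ℓ w) ε) := by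
    rintro ⟨z, ⟨hz, hzb⟩, hzw⟩
    refine hwd ⟨ℓ w, ⟨h1, z, hz, ?_, hzw.trans h2.symm⟩, h2⟩
    rintro rfl
    exact hzb (Metric.mem_ball_self hε)
  filter_upwards [self_mem_nhdsWithin,
    mem_nhdsWithin_of_mem_nhds (hK.isClosed.isOpen_compl.mem_nhds hwK)] with u hu huK
  by_contra hcon
  obtain ⟨h3, h4⟩ := hℓ.mem_frontier ho hu.1
  exact huK ⟨ℓ u, ⟨h3, hcon⟩, h4⟩

theorem IsBoundedQD.exteriorCauchyProjection_eq (hQ : IsBoundedQD Ω h)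
    (hinj : InjOn Complex.exp Ω) (hh' : IsRatZero (Complex.exp '' Ω) h') {r : ℂ → ℂ}
    (hr : r ∈ AnalyticClass Ω)
    (hhr : ∀ z ∈ frontier Ω,
      ratEval h z = ratEval h' (Complex.exp z) * Complex.exp z + Complex.exp z * r z)
    {Γ : RectifiableContour} (hΓ : Γ.IsBoundaryOf (Complex.exp '' Ω)) {ℓ : ℂ → ℂ}
    (hℓ : IsLogInto Ω ℓ) {w : ℂ} (hw : w ∉ closure (Complex.exp '' Ω)) :
    Γ.exteriorCauchyProjection (fun ξ => ratEval h (ℓ ξ) / ξ) w = ratEval h' w := by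
  have ho := hQ.domain.isOpen
  have hb := hQ.domain.isBounded
  have hU := isOpen_exp_image ho
  have hfc : IsCompact (frontier Ω) := hb.isCompact_closure.of_isClosed_subset isClosed_frontier
    frontier_subset_closure
  have hfU := frontier_exp_image ho hb hinj
  obtain ⟨Γ₀, hΓ₀⟩ := hQ.domain.rectifiable
  have hΓ₁ := hΓ₀.expImage ho hb hinj
  have hhc : ContinuousOn (ratEval h) (frontier Ω) := hQ.rat.continuousOn.mono
    (disjoint_left.1 (disjoint_frontier_iff_isOpen.2 ho))
  have hξ0 : ∀ ξ ∈ frontier (Complex.exp '' Ω), ξ ≠ 0 := fun ξ hξ h0 =>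
    zero_notMem_closure_exp_image hb (h0 ▸ frontier_subset_closure hξ)
  have hξw : ∀ ξ ∈ closure (Complex.exp '' Ω), ξ - w ≠ 0 := fun ξ hξ h0 =>
    hw (sub_eq_zero.1 h0 ▸ hξ)
  have hcw : ContinuousOn (fun ξ : ℂ => (ξ * (ξ - w))⁻¹) (frontier (Complex.exp '' Ω)) :=
    ContinuousOn.inv₀ (by fun_prop) fun ξ hξ =>
      mul_ne_zero (hξ0 ξ hξ) (hξw ξ (frontier_subset_closure hξ))
  obtain ⟨M₁, hM₁⟩ := hfc.exists_bound_of_continuousOn hhc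
  obtain ⟨M₂, hM₂⟩ := (hfU ▸ hfc.image Complex.continuous_exp :
    IsCompact (frontier (Complex.exp '' Ω))).exists_bound_of_continuousOn hcw
  have hF : (fun ξ => ratEval h (ℓ ξ) / ξ / (ξ - w)) =
      fun ξ => ratEval h (ℓ ξ) * (ξ * (ξ - w))⁻¹ := by
    ext ξ
    rw [div_div, div_eq_mul_inv]
  -- The integrand is bounded and continuous off the finite image of the double points, so Γ may be
  -- exchanged for the exponential image of a boundary contour of Ω, where ℓ(e^z) = z off the double
  -- points.
  rw [RectifiableContour.exteriorCauchyProjection, hF, hΓ.integral_eq_integral_of_bounded hΓ₁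
    (hQ.finite_double.image Complex.exp) (M := M₁ * M₂) ?_ ?_]
  · have hf : (fun ξ => (ξ - w)⁻¹) ∈ AnalyticClass (Complex.exp '' Ω) :=
      ⟨(differentiableOn_id.sub_const w).inv fun ξ hξ => hξw ξ (subset_closure hξ),
        ContinuousOn.inv₀ (by fun_prop) hξw⟩
    rw [RectifiableContour.integral_expImage,
      Γ₀.integral_congr_off_finite hQ.finite_double
        (g := fun z => (Complex.exp z - w)⁻¹ * ratEval h z),
      integral_comp_exp_mul_ratEval hΓ₀ ho hb hinj hh' hr hhr hf]
    · simp_rw [mul_comm _ (ratEval h' _)]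
      rw [hΓ₁.integral_ratEval hU hh' hw, neg_neg]
    · rintro z ⟨hz, hzd⟩
      rw [hΓ₀.trace_eq] at hz
      obtain ⟨h1, h2⟩ := hℓ.mem_frontier ho (w := Complex.exp z) (hfU ▸ ⟨z, hz, rfl⟩)
      have h3 : ℓ (Complex.exp z) = z := by
        by_contra hne
        exact hzd ⟨hz, _, h1, hne, h2⟩
      beta_reduce
      rw [h3, mul_inv]
      field_simp [Complex.exp_ne_zero z]
  · exact (hhc.comp (hℓ.continuousOn ho hb) fun ξ hξ => (hℓ.mem_frontier ho hξ.1).1).mul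
      (hcw.mono sdiff_subset)
  · intro ξ hξ
    rw [norm_mul]
    have h1 := hM₁ _ (hℓ.mem_frontier ho hξ).1
    exact mul_le_mul h1 (hM₂ ξ hξ) (norm_nonneg _) ((norm_nonneg _).trans h1)

end ExpTransform

theorem theorem2p1 (Ω : Set ℂ) (h : RatFunc ℂ) (hQD : IsBoundedQD Ω h)
    (hinj : Set.InjOn Complex.exp Ω) :
    ∃ h' : RatFunc ℂ,
      IsBoundedLQD (Complex.exp '' Ω) h' ∧
      (∀ Γ : RectifiableContour, Γ.IsBoundaryOf (Complex.exp '' Ω) →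
        ∀ ℓ : ℂ → ℂ, IsLogInto Ω ℓ →
          ∀ w ∉ closure (Complex.exp '' Ω),
            ratEval h' w = Γ.exteriorCauchyProjection (fun ξ => ratEval h (ℓ ξ) / ξ) w) ∧
      ratPoles h' = (ratPoles h).map Complex.exp := by
  obtain ⟨h', hh', hpoles, r, hr, hhr⟩ := hQD.rat.exists_pushforward hQD.domain.isOpen hinj
  refine ⟨h', ⟨hQD.exp_image_domain hinj, ?_, hh', ?_⟩, ?_, hpoles⟩
  · exact fun h0 => zero_notMem_closure_exp_image hQD.domain.isBounded (frontier_subset_closure h0)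
  · exact fun Γ hΓ f hf => hQD.exp_image_quadrature hinj hh' hr hhr hΓ hf.1
  · exact fun Γ hΓ ℓ hℓ w hw => (hQD.exteriorCauchyProjection_eq hinj hh' hr hhr hΓ hℓ hw).symm
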